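/- A \emph{2-complex} $K=(V(K),E(K),F(K))$ consists of finite sets of vertices (points), edges and faces in a Hausdorff space, and is regarded as a topological space, the union of its cells. Each edge is homeomorphic to the unit interval and its endpoints are two distinct vertices; each face is homeomorphic to a closed $n$-gon for some $n\ge 3$, its corners being vertices and its sides being distinct edges; the interiors of distinct cells are disjoint. The \emph{degree} of an edge is the number of faces that contain it. $K$ is \emph{even} if every edge has positive even degree. $K$ is a \emph{face-disjoint union} of 2-complexes $K_1,\dots,K_n$ if its vertex, edge and face sets are the unions of those of the $K_i$ and no face belongs to two of the $K_i$. A \emph{circlet} is an even 2-complex that is not a face-disjoint union of two even 2-complexes, each having at least one face. A \emph{cellular map} $M\to K$ is a continuous map whose restriction to each $k$-cell of $M$ is a homeomorphism onto a $k$-cell of $K$, for $k=0,1,2$. An \emph{Euler cover} of $K$ is a cellular map $\varphi\colon M\to K$ where $M$ is a 2-complex that is a connected (in particular non-empty) surface, i.e. each point of $M$ has a neighborhood homeomorphic to an open disk, and each face of $K$ is the image under $\varphi$ of exactly one face of $M$. $K$ is \emph{strongly connected} if both $K$ and $K-V(K)$ are connected (and non-empty). \textbf{Theorem 2.} For a strongly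 connected 2-complex $K$ the following are equivalent: (i) $K$ is even; (ii) $K$ is a face-disjoint union of circlets; (iii) $K$ has an Euler cover. Moreover, (i)$\Leftrightarrow$(ii) holds for every 2-complex $K$, and (iii)$\Rightarrow$(i) holds for every 2-complex $K$ in which each edge belongs to at least one face. -/

import Mathlib

open Topology

universe u v

/-- The `k`-th corner of the regular `n`-gon inscribed in the unit circle of the plane
(it depends only on `k` modulo `n`). -/
noncomputable def polygonCorner (n k : ℕ) : ℂ :=
  Complex.exp (2 * Real.pi * Complex.I * k / n)

/-- The side of the regular `n`-gon that joins the corners number `k` and `k + 1`. -/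
def polygonSide (n k : ℕ) : Set ℂ :=
  segment ℝ (polygonCorner n k) (polygonCorner n (k + 1))

/-- The closed (filled) regular `n`-gon. -/
def closedPolygon (n : ℕ) : Set ℂ :=
  convexHull ℝ (Set.range (polygonCorner n))

/-- A (finite) 2-complex in a Hausdorff space `X`: finitely many vertices (points), edges (arcs
that join two distinct vertices) and faces (closed polygons with at least three sides, whose sides
are edges and whose corners are vertices), such that distinct cells have disjoint interiors.
The interior of an edge is what remains of it after removing its endpoints, the interior of a face
what remains of it after removing its sides. As `X` is Hausdorff and the cells are compact and
finite in number, the subspace topology on their union is the topology of the cell complex. -/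
structure TwoComplex (X : Type u) [TopologicalSpace X] [T2Space X] where
  /-- the vertices, or 0-cells -/
  vertices : Set X
  /-- the (closed) edges, or 1-cells -/
  edges : Set (Set X)
  /-- the (closed) faces, or 2-cells -/
  faces : Set (Set X)
  finite_vertices : vertices.Finite
  finite_edges : edges.Finite
  finite_faces : faces.Finite
  /-- An edge is homeomorphic to the unit interval; its endpoints (which are distinct, as the
  parametrization is injective) are vertices, and no other vertex lies on it. -/
  edge_spec : ∀ e ∈ edges, ∃ γ : unitInterval ≃ₜ e, e ∩ vertices = {(γ 0 : X), (γ 1 : X)}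
  /-- A face is homeomorphic to a closed `n`-gon with `n ≥ 3`; the homeomorphism takes corners to
  vertices and sides to edges, and no vertex or edge meets the interior of the face. -/
  face_spec : ∀ f ∈ faces, ∃ n : ℕ, 3 ≤ n ∧ ∃ h : closedPolygon n ≃ₜ f,
    (∀ (k : ℕ) (x : closedPolygon n), (x : ℂ) = polygonCorner n k → (h x : X) ∈ vertices) ∧
    (∀ k : ℕ, (fun x => (h x : X)) '' {x | (x : ℂ) ∈ polygonSide n k} ∈ edges) ∧
    f ∩ (vertices ∪ ⋃₀ edges) = (fun x => (h x : X)) '' {x | ∃ k : ℕ, (x : ℂ) ∈ polygonSide n k}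
  /-- Distinct edges have disjoint interiors. -/
  edges_inter : ∀ e ∈ edges, ∀ e' ∈ edges, e ≠ e' → e ∩ e' ⊆ vertices
  /-- Distinct faces have disjoint interiors. -/
  faces_inter : ∀ f ∈ faces, ∀ f' ∈ faces, f ≠ f' → f ∩ f' ⊆ ⋃₀ edges

/-- `φ` restricts to a homeomorphism from `s` onto `t`. -/
def RestrictsToHomeomorph {Y : Type v} {X : Type u} [TopologicalSpace Y] [TopologicalSpace X]
    (φ : Y → X) (s : Set Y) (t : Set X) : Prop :=
  ∃ h : s ≃ₜ t, ∀ x : s, (h x : X) = φ x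

namespace TwoComplex

variable {X : Type u} [TopologicalSpace X] [T2Space X]

/-- The underlying space of a 2-complex, the union of its cells. -/
def space (K : TwoComplex X) : Set X :=
  K.vertices ∪ ⋃₀ K.edges ∪ ⋃₀ K.faces

/-- The degree of an edge: the number of faces to which it belongs. -/
noncomputable def degree (K : TwoComplex X) (e : Set X) : ℕ :=
  {f | f ∈ K.faces ∧ e ⊆ f}.ncard

/-- A 2-complex is even if each of its edges has positive even degree. -/
def IsEven (K : TwoComplex X) : Prop :=
  ∀ e ∈ K.edges, 0 < K.degree e ∧ Even (K.degree e)

/-- `K` is the union of the 2-complexes `C i`, no two of which have a face in common. -/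
def IsFaceDisjointUnion (K : TwoComplex X) {ι : Type} (C : ι → TwoComplex X) : Prop :=
  K.vertices = ⋃ i, (C i).vertices ∧
  K.edges = ⋃ i, (C i).edges ∧
  K.faces = ⋃ i, (C i).faces ∧
  ∀ i j, i ≠ j → Disjoint (C i).faces (C j).faces

/-- A circlet is an even 2-complex that is not a face-disjoint union of two even 2-complexes
(each with at least one face). -/
def IsCirclet (K : TwoComplex X) : Prop :=
  K.IsEven ∧ ¬ ∃ A B : TwoComplex X, A.IsEven ∧ B.IsEven ∧
    A.faces.Nonempty ∧ B.faces.Nonempty ∧ K.IsFaceDisjointUnion ![A, B]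

/-- `K` is a face-disjoint union of (finitely many) circlets. -/
def IsFaceDisjointUnionOfCirclets (K : TwoComplex X) : Prop :=
  ∃ (n : ℕ) (C : Fin n → TwoComplex X), (∀ i, (C i).IsCirclet) ∧ K.IsFaceDisjointUnion C

/-- A 2-complex is a surface if each of its points has an open neighbourhood (in the complex) that
is homeomorphic to an open disk. -/
def IsSurface (M : TwoComplex X) : Prop :=
  ∀ x : M.space, ∃ U : Set M.space, IsOpen U ∧ x ∈ U ∧
    Nonempty (U ≃ₜ Metric.ball (0 : ℂ) 1)

/-- A cellular map from `M` to `K`: a continuous map from the space of `M` whose restriction to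
each `k`-cell of `M` is a homeomorphism onto a `k`-cell of `K`, for `k = 0, 1, 2`.
(Only the values on `M.space` matter.) -/
def IsCellularMap {Y : Type v} [TopologicalSpace Y] [T2Space Y]
    (M : TwoComplex Y) (K : TwoComplex X) (φ : Y → X) : Prop :=
  ContinuousOn φ M.space ∧
  (∀ x ∈ M.vertices, φ x ∈ K.vertices) ∧
  (∀ e ∈ M.edges, ∃ e' ∈ K.edges, RestrictsToHomeomorph φ e e') ∧
  (∀ f ∈ M.faces, ∃ f' ∈ K.faces, RestrictsToHomeomorph φ f f')

/-- An Euler cover of `K`: a cellular map from a connected surface to `K` such that each face of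
`K` is the image of exactly one face of the surface. -/
def IsEulerCover {Y : Type v} [TopologicalSpace Y] [T2Space Y]
    (M : TwoComplex Y) (K : TwoComplex X) (φ : Y → X) : Prop :=
  M.IsSurface ∧ IsConnected M.space ∧ IsCellularMap M K φ ∧
    ∀ f ∈ K.faces, ∃! f' : Set Y, f' ∈ M.faces ∧ φ '' f' = f

/-- `K` has an Euler cover. -/
def HasEulerCover (K : TwoComplex X) : Prop :=
  ∃ (Y : Type u) (_ : TopologicalSpace Y) (_ : T2Space Y) (M : TwoComplex Y) (φ : Y → X),
    IsEulerCover M K φ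

/-- A 2-complex is strongly connected if it is connected and remains connected after removing
its vertices. -/
def StronglyConnected (K : TwoComplex X) : Prop :=
  IsConnected K.space ∧ IsConnected (K.space \ K.vertices)

end TwoComplex

/-!
The equivalence of being even with being a face-disjoint union of circlets is a decomposition
argument: an even complex that is not a circlet splits, and its faces are finite in number. The
converse adds up degrees; it uses that the sides of a face `f` in a subcomplex containing `f` are
all the sides of `f` (`exists_side_image_eq`), so that an edge missing from a summand has degree
zero there.

If `φ : M → K` is an Euler cover, the faces of `K` at an edge `e` correspond to the faces of `M` at
the edges over `e`, so it suffices that every edge of a surface lies in exactly two faces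
(`IsSurface.degree_eq_two`). This is a statement about the local topology of the plane, and all of
it follows from one fact: a disk that is mapped injectively to the plane has a boundary loop whose
winding number around the image of the centre is odd (`exists_odd_winding`). Near an interior point
of an edge in no face or one face, the complex embeds into a half-plane, which contradicts this. At
an edge in three faces, each two of the three pages form a disk, and the three winding numbers,
which are odd, have sum zero. In a strongly connected complex with a face every edge lies in a face
(`StronglyConnected.exists_face`), so all degrees are positive.

Conversely, let `K` be even and strongly connected. Match the faces at each edge in pairs, and glue
the faces of `K` along the matched pairs only; the result maps to `K`, and every face of `K` comes
from exactly one face. It is a surface (`isSurface_of_degree_eq_two`): each edge lies in two faces,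
and the faces at a vertex form a cycle of sectors, as two copies of a vertex are identified only if
they are connected through matched pairs at edges through it. What is left is to choose the matching
so that the surface is connected (`exists_connected_isPairing`). Take one that connects as many
pairs of faces as possible. If it does not connect all faces, then, `K` without its vertices being
connected, two faces at some edge `e` lie in different components. Exchange the two pairs to which
they belong. The new links join the two components, provided that a matched pair stays connected
when its link at `e` is cut; and it does, because at an endpoint `v` of `e` the link is not a
bridge: each face has an even number (zero or two) of edges at `v`, and the matching at the edges
through `v` would leave a single one of these incidences in a component unmatched.
-/

/-! ### The regular polygon as a disk -/

theorem polygonCorner_eq (n k : ℕ) :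
    polygonCorner n k = Complex.exp ((2 * Real.pi * k / n : ℝ) * Complex.I) := by
  unfold polygonCorner; congr 1; push_cast; ring

theorem polygonCorner_add_self {n : ℕ} (hn : n ≠ 0) (k : ℕ) :
    polygonCorner n (k + n) = polygonCorner n k := by
  have hn' : (n : ℂ) ≠ 0 := by exact_mod_cast hn
  unfold polygonCorner
  rw [show 2 * (Real.pi : ℂ) * Complex.I * ((k + n : ℕ) : ℂ) / n =
    2 * Real.pi * Complex.I * k / n + 2 * Real.pi * Complex.I by push_cast; field_simp]
  exact Complex.exp_periodic _

theorem polygonCorner_eq_iff {n : ℕ} (hn : n ≠ 0) (k l : ℕ) :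
    polygonCorner n k = polygonCorner n l ↔ (k : ZMod n) = l := by
  have hn' : (n : ℂ) ≠ 0 := by exact_mod_cast hn
  have hpi : (Real.pi : ℂ) ≠ 0 := by exact_mod_cast Real.pi_ne_zero
  rw [← Int.cast_natCast k, ← Int.cast_natCast l, ZMod.intCast_eq_intCast_iff_dvd_sub]
  unfold polygonCorner
  rw [Complex.exp_eq_exp_iff_exists_int]
  constructor
  · rintro ⟨j, hj⟩
    refine ⟨-j, ?_⟩
    have hI := Complex.I_ne_zero
    field_simp at hj
    have : (k : ℂ) = l + j * n := by linear_combination hj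
    have : (k : ℤ) = l + j * n := by exact_mod_cast this
    linarith
  · rintro ⟨j, hj⟩
    refine ⟨-j, ?_⟩
    have : (l : ℂ) - k = n * j := by exact_mod_cast hj
    field_simp
    push_cast
    linear_combination -this

/-- The linear functional that attains its maximum over the regular `n`-gon on the side `k`: the
inner product with the unit vector through the midpoint of that side. -/
noncomputable def sideFunctional (n k : ℕ) : ℂ →ₗ[ℝ] ℝ :=
  Complex.reLm ∘ₗ LinearMap.mulRight ℝ
    (Complex.exp (((-(2 * Real.pi * (k + 1 / 2) / n) : ℝ) : ℂ) * Complex.I))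

theorem sideFunctional_polygonCorner (n k j : ℕ) :
    sideFunctional n k (polygonCorner n j) = Real.cos (2 * Real.pi * (j - k - 1 / 2) / n) := by
  rw [polygonCorner_eq]
  simp only [sideFunctional, LinearMap.coe_comp, Function.comp_apply, LinearMap.mulRight_apply,
    Complex.reLm_coe]
  rw [← Complex.exp_add, ← add_mul, ← Complex.ofReal_add, Complex.exp_ofReal_mul_I_re]
  congr 1; ring

theorem sideFunctional_le_norm (n k : ℕ) (z : ℂ) : sideFunctional n k z ≤ ‖z‖ := by
  simp only [sideFunctional, LinearMap.coe_comp, Function.comp_apply, LinearMap.mulRight_apply,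
    Complex.reLm_coe]
  refine (Complex.re_le_norm _).trans ?_
  rw [norm_mul, Complex.norm_exp_ofReal_mul_I, mul_one]

theorem cos_pi_div_pos {n : ℕ} (hn : 3 ≤ n) : 0 < Real.cos (Real.pi / n) := by
  have h3 : (3 : ℝ) ≤ n := by exact_mod_cast hn
  apply Real.cos_pos_of_mem_Ioo
  constructor
  · have : 0 < Real.pi / n := by positivity
    linarith [Real.pi_pos]
  · apply div_lt_div_of_pos_left Real.pi_pos (by norm_num); linarith

theorem sideFunctional_left (n k : ℕ) :
    sideFunctional n k (polygonCorner n k) = Real.cos (Real.pi / n) := by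
  rw [sideFunctional_polygonCorner, ← Real.cos_neg]; congr 1; ring

theorem sideFunctional_right (n k : ℕ) :
    sideFunctional n k (polygonCorner n (k + 1)) = Real.cos (Real.pi / n) := by
  rw [sideFunctional_polygonCorner]; congr 1; push_cast; ring

theorem sideFunctional_le {n : ℕ} (hn : 3 ≤ n) (k j : ℕ) :
    sideFunctional n k (polygonCorner n j) ≤ Real.cos (Real.pi / n) := by
  have hn0 : n ≠ 0 := by omega
  have hnr : (0 : ℝ) < n := by exact_mod_cast Nat.pos_of_ne_zero hn0
  -- shift `j` by a multiple of `n` so that `k < j ≤ k + n`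
  obtain ⟨d, hd1, hd2, hd⟩ : ∃ d : ℕ, 1 ≤ d ∧ d ≤ n ∧
      polygonCorner n j = polygonCorner n (k + d) := by
    have : NeZero n := ⟨hn0⟩
    by_cases h0 : ((j : ZMod n) - k).val = 0
    · refine ⟨n, by omega, le_rfl, ?_⟩
      rw [polygonCorner_add_self hn0, polygonCorner_eq_iff hn0]
      rw [ZMod.val_eq_zero] at h0
      exact sub_eq_zero.mp h0
    · refine ⟨((j : ZMod n) - k).val, by omega, (ZMod.val_lt _).le, ?_⟩
      rw [polygonCorner_eq_iff hn0]
      push_cast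
      rw [ZMod.natCast_zmod_val]; ring
  rw [hd, sideFunctional_polygonCorner, ← sub_nonpos, Real.cos_sub_cos]
  have e1 : (2 * Real.pi * (((k + d : ℕ) : ℝ) - k - 1 / 2) / n + Real.pi / n) / 2
      = d / n * Real.pi := by push_cast; field_simp; ring
  have e2 : (2 * Real.pi * (((k + d : ℕ) : ℝ) - k - 1 / 2) / n - Real.pi / n) / 2
      = (d - 1) / n * Real.pi := by push_cast; field_simp; ring
  rw [e1, e2]
  have hd1' : (1 : ℝ) ≤ d := by exact_mod_cast hd1
  have hd2' : (d : ℝ) ≤ n := by exact_mod_cast hd2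
  have hdn : (d : ℝ) / n ≤ 1 := (div_le_one hnr).mpr hd2'
  have hdn' : ((d : ℝ) - 1) / n ≤ 1 := (div_le_one hnr).mpr (by linarith)
  have s1 : 0 ≤ Real.sin (d / n * Real.pi) := by
    apply Real.sin_nonneg_of_nonneg_of_le_pi (by positivity)
    nlinarith [Real.pi_pos]
  have s2 : 0 ≤ Real.sin ((d - 1) / n * Real.pi) := by
    apply Real.sin_nonneg_of_nonneg_of_le_pi
    · apply mul_nonneg (div_nonneg (by linarith) hnr.le) Real.pi_pos.le
    · nlinarith [Real.pi_pos]
  nlinarith [mul_nonneg s1 s2]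

/-- The cones over the sides of the regular polygon cover the plane. -/
theorem exists_eq_smul_corner_add {n : ℕ} (hn : 3 ≤ n) (z : ℂ) :
    ∃ (k : ℕ) (s t : ℝ), 0 ≤ s ∧ 0 ≤ t ∧
      z = s • polygonCorner n k + t • polygonCorner n (k + 1) := by
  have h3 : (3 : ℝ) ≤ n := by exact_mod_cast hn
  have hnr : (0 : ℝ) < n := by linarith
  have hpi := Real.pi_pos
  obtain ⟨θ, hθ, hz⟩ : ∃ θ : ℝ, 0 ≤ θ ∧ z = ‖z‖ * Complex.exp (θ * Complex.I) := by
    refine ⟨z.arg + 2 * Real.pi, by linarith [Complex.neg_pi_lt_arg z], ?_⟩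
    push_cast
    rw [add_mul, Complex.exp_periodic (z.arg * Complex.I), Complex.norm_mul_exp_arg_mul_I]
  set α : ℝ := 2 * Real.pi / n with hα
  have hα0 : 0 < α := by positivity
  have hα1 : α < Real.pi := by
    rw [hα, div_lt_iff₀ hnr]; nlinarith
  have hsin : 0 < Real.sin α := Real.sin_pos_of_pos_of_lt_pi hα0 hα1
  set k := ⌊θ / α⌋₊ with hk
  set φ := θ - k * α with hφ
  have hφ0 : 0 ≤ φ := by
    have := Nat.floor_le (div_nonneg hθ hα0.le)
    rw [le_div_iff₀ hα0] at this
    linarith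
  have hφ1 : φ ≤ α := by
    have := (Nat.lt_floor_add_one (θ / α)).le
    rw [div_le_iff₀ hα0] at this
    linarith
  refine ⟨k, ‖z‖ * (Real.sin (α - φ) / Real.sin α), ‖z‖ * (Real.sin φ / Real.sin α), ?_, ?_, ?_⟩
  · exact mul_nonneg (norm_nonneg _) (div_nonneg
      (Real.sin_nonneg_of_nonneg_of_le_pi (by linarith) (by linarith)) hsin.le)
  · exact mul_nonneg (norm_nonneg _) (div_nonneg
      (Real.sin_nonneg_of_nonneg_of_le_pi hφ0 (by linarith)) hsin.le)
  · conv_lhs => rw [hz]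
    have e0 : polygonCorner n k = Complex.exp ((k * α : ℝ) * Complex.I) := by
      rw [polygonCorner_eq, hα]; congr 3; ring
    have e1 : polygonCorner n (k + 1) = Complex.exp ((k * α : ℝ) * Complex.I) *
        Complex.exp (α * Complex.I) := by
      rw [polygonCorner_eq, hα, ← Complex.exp_add]; congr 1; push_cast; ring
    have e2 : Complex.exp (θ * Complex.I) = Complex.exp ((k * α : ℝ) * Complex.I) *
        Complex.exp (φ * Complex.I) := by
      rw [hφ, ← Complex.exp_add]; congr 1; push_cast; ring
    rw [e0, e1, e2]
    have key : Complex.exp (φ * Complex.I) = ((Real.sin (α - φ) / Real.sin α : ℝ) : ℂ) +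
        ((Real.sin φ / Real.sin α : ℝ) : ℂ) * Complex.exp (α * Complex.I) := by
      apply Complex.ext
      · rw [Complex.add_re, Complex.re_ofReal_mul, Complex.exp_ofReal_mul_I_re,
          Complex.exp_ofReal_mul_I_re, Complex.ofReal_re, Real.sin_sub]
        field_simp; ring
      · rw [Complex.add_im, Complex.im_ofReal_mul, Complex.exp_ofReal_mul_I_im,
          Complex.exp_ofReal_mul_I_im, Complex.ofReal_im]
        field_simp; ring
    rw [key]
    simp only [Complex.real_smul]
    push_cast
    ring

theorem polygonCorner_mem_closedPolygon (n k : ℕ) : polygonCorner n k ∈ closedPolygon n :=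
  subset_convexHull ℝ _ ⟨k, rfl⟩

theorem convex_closedPolygon (n : ℕ) : Convex ℝ (closedPolygon n) := convex_convexHull ℝ _

theorem polygonSide_subset (n k : ℕ) : polygonSide n k ⊆ closedPolygon n :=
  (convex_closedPolygon n).segment_subset (polygonCorner_mem_closedPolygon n k)
    (polygonCorner_mem_closedPolygon n (k + 1))

theorem zero_mem_closedPolygon {n : ℕ} (hn : 3 ≤ n) : (0 : ℂ) ∈ closedPolygon n := by
  obtain ⟨k, s, t, hs, ht, h⟩ := exists_eq_smul_corner_add hn (-polygonCorner n 0)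
  have hpos : 0 < 1 + s + t := by linarith
  have := (convex_closedPolygon n).sum_mem (t := Finset.univ)
    (w := ![1 / (1 + s + t), s / (1 + s + t), t / (1 + s + t)])
    (z := ![polygonCorner n 0, polygonCorner n k, polygonCorner n (k + 1)]) ?_ ?_ ?_
  · convert this using 1
    simp only [Fin.sum_univ_three, Matrix.cons_val_zero, Matrix.cons_val_one, Matrix.cons_val,
      Complex.real_smul] at h ⊢
    push_cast
    have hp : (1 + s + t : ℂ) ≠ 0 := by exact_mod_cast hpos.ne'
    field_simp
    linear_combination h
  · intro i _
    fin_cases i <;> simp <;> positivity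
  · simp only [Fin.sum_univ_three, Matrix.cons_val_zero, Matrix.cons_val_one, Matrix.cons_val]
    field_simp
  · intro i _
    fin_cases i <;> exact polygonCorner_mem_closedPolygon _ _

theorem exists_mem_side_smul {n : ℕ} (hn : 3 ≤ n) (z : ℂ) :
    ∃ (k : ℕ) (r : ℝ) (w : ℂ), 0 ≤ r ∧ w ∈ polygonSide n k ∧ z = r • w := by
  obtain ⟨k, s, t, hs, ht, h⟩ := exists_eq_smul_corner_add hn z
  rcases (add_nonneg hs ht).eq_or_lt with h0 | hpos
  · have hs0 : s = 0 := by linarith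
    have ht0 : t = 0 := by linarith
    refine ⟨k, 0, polygonCorner n k, le_rfl, left_mem_segment ℝ _ _, ?_⟩
    rw [h, hs0, ht0]; simp
  · refine ⟨k, s + t, (s / (s + t)) • polygonCorner n k + (t / (s + t)) • polygonCorner n (k + 1),
      hpos.le, ⟨_, _, by positivity, by positivity, by field_simp, rfl⟩, ?_⟩
    rw [h, smul_add, smul_smul, smul_smul, mul_div_cancel₀ _ hpos.ne', mul_div_cancel₀ _ hpos.ne']

theorem sideFunctional_side {n k : ℕ} {w : ℂ} (hw : w ∈ polygonSide n k) :
    sideFunctional n k w = Real.cos (Real.pi / n) := by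
  obtain ⟨a, b, -, -, hab, rfl⟩ := hw
  rw [map_add, map_smul, map_smul, sideFunctional_left, sideFunctional_right, smul_eq_mul,
    smul_eq_mul, ← add_mul, hab, one_mul]

theorem sideFunctional_le_of_mem {n : ℕ} (hn : 3 ≤ n) (k : ℕ) {z : ℂ} (hz : z ∈ closedPolygon n) :
    sideFunctional n k z ≤ Real.cos (Real.pi / n) := by
  have : closedPolygon n ⊆ {z | sideFunctional n k z ≤ Real.cos (Real.pi / n)} := by
    apply convexHull_min
    · rintro _ ⟨j, rfl⟩; exact sideFunctional_le hn k j
    · exact convex_halfSpace_le (sideFunctional n k).isLinear _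
  exact this hz

theorem zero_mem_interior_closedPolygon {n : ℕ} (hn : 3 ≤ n) :
    (0 : ℂ) ∈ interior (closedPolygon n) := by
  rw [mem_interior_iff_mem_nhds]
  refine Filter.mem_of_superset (Metric.ball_mem_nhds 0 (cos_pi_div_pos hn)) fun z hz => ?_
  rw [mem_ball_zero_iff] at hz
  obtain ⟨k, r, w, hr, hw, rfl⟩ := exists_mem_side_smul hn z
  have h1 := (sideFunctional_le_norm n k (r • w)).trans hz.le
  rw [map_smul, sideFunctional_side hw, smul_eq_mul] at h1
  have hr1 : r ≤ 1 := by nlinarith [cos_pi_div_pos hn]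
  exact (convex_closedPolygon n).smul_mem_of_zero_mem (zero_mem_closedPolygon hn)
    (polygonSide_subset n k hw) ⟨hr, hr1⟩

theorem isCompact_closedPolygon (n : ℕ) : IsCompact (closedPolygon n) := by
  rcases Nat.eq_zero_or_pos n with rfl | hn
  · have : Set.range (polygonCorner 0) = {1} := by
      ext z; simp [polygonCorner, eq_comm]
    rw [closedPolygon, this, convexHull_singleton]; exact isCompact_singleton
  · apply Set.Finite.isCompact_convexHull
    apply Set.Finite.subset (Set.finite_range (fun k : Fin n => polygonCorner n k))
    rintro _ ⟨k, rfl⟩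
    refine ⟨⟨k % n, Nat.mod_lt _ hn⟩, ?_⟩
    simp only
    rw [polygonCorner_eq_iff hn.ne', ZMod.natCast_mod]

theorem frontier_closedPolygon {n : ℕ} (hn : 3 ≤ n) :
    frontier (closedPolygon n) = ⋃ k, polygonSide n k := by
  have hcl := (isCompact_closedPolygon n).isClosed
  rw [hcl.frontier_eq]
  ext z
  rw [Set.mem_sdiff, Set.mem_iUnion]
  constructor
  · rintro ⟨hz, hz'⟩
    obtain ⟨k, r, w, hr, hw, rfl⟩ := exists_mem_side_smul hn z
    have h1 := sideFunctional_le_of_mem hn k hz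
    rw [map_smul, sideFunctional_side hw, smul_eq_mul] at h1
    have hr1 : r ≤ 1 := by nlinarith [cos_pi_div_pos hn]
    rcases hr1.eq_or_lt with rfl | hlt
    · exact ⟨k, by rwa [one_smul]⟩
    · refine absurd ?_ hz'
      have := (convex_closedPolygon n).combo_self_interior_mem_interior
        (polygonSide_subset n k hw) (zero_mem_interior_closedPolygon hn) hr
        (sub_pos.mpr hlt) (by ring)
      simpa using this
  · rintro ⟨k, hk⟩
    refine ⟨polygonSide_subset n k hk, fun hint => ?_⟩
    have hc : Filter.Tendsto (fun t : ℝ => t • z) (𝓝 1) (𝓝 z) := by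
      have : Continuous fun t : ℝ => t • z := by fun_prop
      simpa using this.tendsto 1
    have h1 := hc (mem_interior_iff_mem_nhds.mp hint)
    have h1' : ∀ᶠ t in 𝓝[>] (1 : ℝ), t • z ∈ closedPolygon n :=
      nhdsWithin_le_nhds h1
    obtain ⟨t, ht, ht1⟩ := (h1'.and self_mem_nhdsWithin).exists
    have h2 := sideFunctional_le_of_mem hn k ht
    rw [map_smul, sideFunctional_side hk, smul_eq_mul] at h2
    have : (1 : ℝ) < t := ht1
    nlinarith [cos_pi_div_pos hn]

/-- The regular polygon is homeomorphic to the closed unit disk, the sides forming the circle. -/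
theorem exists_homeomorph_closedPolygon {n : ℕ} (hn : 3 ≤ n) :
    ∃ G : Metric.closedBall (0 : ℂ) 1 ≃ₜ closedPolygon n,
      ∀ z : Metric.closedBall (0 : ℂ) 1, ‖(z : ℂ)‖ = 1 ↔ ∃ k, (G z : ℂ) ∈ polygonSide n k := by
  obtain ⟨e, -, hcl, hfr⟩ := exists_homeomorph_image_interior_closure_frontier_eq_unitBall
    (convex_closedPolygon n) ⟨0, zero_mem_interior_closedPolygon hn⟩
    (isCompact_closedPolygon n).isBounded
  rw [(isCompact_closedPolygon n).isClosed.closure_eq] at hcl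
  refine ⟨((e.image (closedPolygon n)).trans (Homeomorph.setCongr hcl)).symm, fun z => ?_⟩
  obtain ⟨x, rfl⟩ := ((e.image (closedPolygon n)).trans (Homeomorph.setCongr hcl)).surjective z
  rw [Homeomorph.symm_apply_apply]
  have : ‖e x‖ = 1 ↔ (x : ℂ) ∈ frontier (closedPolygon n) := by
    rw [← mem_sphere_zero_iff_norm, ← hfr, e.injective.mem_set_image]
  rw [frontier_closedPolygon hn, Set.mem_iUnion] at this
  exact this

namespace TwoComplex

variable {X : Type u} [TopologicalSpace X] [T2Space X]

/-! ### Edges and the boundary cycles of faces -/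

/-- The 1-skeleton of a 2-complex, as a set of points. -/
def skeleton (K : TwoComplex X) : Set X :=
  K.vertices ∪ ⋃₀ K.edges

theorem subset_skeleton (K : TwoComplex X) {e : Set X} (he : e ∈ K.edges) : e ⊆ K.skeleton :=
  fun _ hx => Or.inr ⟨e, he, hx⟩

theorem skeleton_subset_space (K : TwoComplex X) : K.skeleton ⊆ K.space := fun _ => Or.inl

theorem edge_isCompact (K : TwoComplex X) {e : Set X} (he : e ∈ K.edges) : IsCompact e := by
  obtain ⟨γ, -⟩ := K.edge_spec e he
  rw [isCompact_iff_compactSpace]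
  exact γ.compactSpace

theorem face_isCompact (K : TwoComplex X) {f : Set X} (hf : f ∈ K.faces) : IsCompact f := by
  obtain ⟨n, -, h, -⟩ := K.face_spec f hf
  have := isCompact_iff_compactSpace.mp (isCompact_closedPolygon n)
  rw [isCompact_iff_compactSpace]
  exact h.compactSpace

theorem edge_infinite (K : TwoComplex X) {e : Set X} (he : e ∈ K.edges) : e.Infinite := by
  obtain ⟨γ, -⟩ := K.edge_spec e he
  have : Infinite unitInterval := Set.infinite_coe_iff.mpr (Set.Icc_infinite zero_lt_one)
  exact Set.infinite_coe_iff.mp (Infinite.of_injective γ γ.injective)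

/-- A point of an edge that is not a vertex. -/
theorem exists_mem_edge_notMem_vertices (K : TwoComplex X) {e : Set X} (he : e ∈ K.edges) :
    ∃ x ∈ e, x ∉ K.vertices := by
  obtain ⟨x, hx, hx'⟩ := ((K.edge_infinite he).sdiff K.finite_vertices).nonempty
  exact ⟨x, hx, hx'⟩

theorem edge_eq_of_mem (K : TwoComplex X) {e e' : Set X} (he : e ∈ K.edges) (he' : e' ∈ K.edges)
    {x : X} (hx : x ∈ e) (hx' : x ∈ e') (hV : x ∉ K.vertices) : e = e' := by
  by_contra h
  exact hV (K.edges_inter e he e' he' h ⟨hx, hx'⟩)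

theorem exists_edge_inter_vertices (K : TwoComplex X) {e : Set X} (he : e ∈ K.edges) :
    ∃ a b, a ≠ b ∧ e ∩ K.vertices = {a, b} := by
  obtain ⟨γ, hγ⟩ := K.edge_spec e he
  refine ⟨_, _, fun h => ?_, hγ⟩
  exact zero_ne_one (γ.injective (Subtype.ext h))

/-- An edge is determined to have the endpoints `a` and `b` by containing these two vertices. -/
theorem edge_inter_vertices_eq (K : TwoComplex X) {e : Set X} (he : e ∈ K.edges) {a b : X}
    (ha : a ∈ e) (ha' : a ∈ K.vertices) (hb : b ∈ e) (hb' : b ∈ K.vertices) (hab : a ≠ b) :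
    e ∩ K.vertices = {a, b} := by
  obtain ⟨c, d, -, h⟩ := K.exists_edge_inter_vertices he
  have h1 : a ∈ ({c, d} : Set X) := h ▸ ⟨ha, ha'⟩
  have h2 : b ∈ ({c, d} : Set X) := h ▸ ⟨hb, hb'⟩
  rw [h]
  rcases h1 with rfl | rfl <;> rcases h2 with rfl | rfl
  · exact absurd rfl hab
  · rfl
  · exact Set.pair_comm _ _
  · exact absurd rfl hab

/-- The boundary of the face `f` is the cycle of the `n` distinct edges `s k`, where `s k` joins the
vertices `v k` and `v (k + 1)`. -/
structure IsBoundaryCycle (K : TwoComplex X) (f : Set X) (n : ℕ) (s : ZMod n → Set X)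
    (v : ZMod n → X) : Prop where
  three_le : 3 ≤ n
  side_mem : ∀ k, s k ∈ K.edges
  side_inter : ∀ k, s k ∩ K.vertices = {v k, v (k + 1)}
  corner_injective : Function.Injective v
  side_injective : Function.Injective s
  boundary : f ∩ K.skeleton = ⋃ k, s k

theorem exists_isBoundaryCycle (K : TwoComplex X) {f : Set X} (hf : f ∈ K.faces) :
    ∃ n s v, K.IsBoundaryCycle f n s v := by
  obtain ⟨n, hn, h, hv, hs, hb⟩ := K.face_spec f hf
  have hn0 : n ≠ 0 := by omega
  have : NeZero n := ⟨hn0⟩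
  have : Fact (1 < n) := ⟨by omega⟩
  have hcorner : ∀ k : ℕ, polygonCorner n ((k : ZMod n).val) = polygonCorner n k := fun k => by
    rw [polygonCorner_eq_iff hn0, ZMod.natCast_zmod_val]
  have hcorner1 : ∀ k : ZMod n, polygonCorner n ((k + 1).val) = polygonCorner n (k.val + 1) :=
    fun k => by
      rw [polygonCorner_eq_iff hn0, ZMod.natCast_zmod_val]; push_cast
      rw [ZMod.natCast_zmod_val]
  have hside : ∀ k : ℕ, polygonSide n ((k : ZMod n).val) = polygonSide n k := fun k => by
    unfold polygonSide
    rw [hcorner, ← hcorner1, ← hcorner (k + 1)]; push_cast; rfl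
  let v : ZMod n → X := fun k => h ⟨_, polygonCorner_mem_closedPolygon n k.val⟩
  let s : ZMod n → Set X := fun k => (fun x => (h x : X)) '' {x | (x : ℂ) ∈ polygonSide n k.val}
  have hvinj : Function.Injective v := fun k l hkl => by
    have := congrArg Subtype.val (h.injective (Subtype.ext hkl))
    rw [polygonCorner_eq_iff hn0] at this
    simpa using this
  have hvV : ∀ k, v k ∈ K.vertices := fun k => hv k.val _ rfl
  have hsE : ∀ k, s k ∈ K.edges := fun k => hs k.val
  have hv0 : ∀ k, v k ∈ s k := fun k => ⟨_, left_mem_segment ℝ _ _, rfl⟩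
  have hv1 : ∀ k, v (k + 1) ∈ s k := fun k =>
    ⟨_, by simp only [Set.mem_ofPred_eq, hcorner1]; exact right_mem_segment ℝ _ _, rfl⟩
  have hne : ∀ k : ZMod n, v k ≠ v (k + 1) := fun k hk => by simpa using hvinj hk
  have hsi : ∀ k, s k ∩ K.vertices = {v k, v (k + 1)} := fun k =>
    K.edge_inter_vertices_eq (hsE k) (hv0 k) (hvV k) (hv1 k) (hvV _) (hne k)
  refine ⟨n, s, v, hn, hsE, hsi, hvinj, fun k l hkl => ?_, ?_⟩
  · have h1 : ({v k, v (k + 1)} : Set X) = {v l, v (l + 1)} := by rw [← hsi, ← hsi, hkl]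
    have h2 : v k = v l ∨ v k = v (l + 1) := by
      have : v k ∈ ({v l, v (l + 1)} : Set X) := h1 ▸ Or.inl rfl
      exact this
    have h3 : v (k + 1) = v l ∨ v (k + 1) = v (l + 1) := by
      have : v (k + 1) ∈ ({v l, v (l + 1)} : Set X) := h1 ▸ Or.inr rfl
      exact this
    rcases h2 with h2 | h2
    · exact hvinj h2
    rcases h3 with h3 | h3
    · -- then `2 = 0` in `ZMod n`, against `n ≥ 3`
      exfalso
      have e1 := hvinj h2
      have e2 := hvinj h3
      rw [e1] at e2
      have : ((2 : ℕ) : ZMod n) = 0 := by push_cast; linear_combination e2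
      rw [ZMod.natCast_eq_zero_iff] at this
      have := Nat.le_of_dvd (by norm_num) this
      omega
    · simpa using hvinj h3
  · refine hb.trans ?_
    ext x
    simp only [Set.mem_image, Set.mem_ofPred_eq, Set.mem_iUnion, s]
    constructor
    · rintro ⟨y, ⟨k, hk⟩, rfl⟩
      exact ⟨k, y, by rwa [hside], rfl⟩
    · rintro ⟨k, y, hk, rfl⟩
      exact ⟨y, ⟨_, hk⟩, rfl⟩

namespace IsBoundaryCycle

variable {K : TwoComplex X} {f : Set X} {n : ℕ} {s : ZMod n → Set X} {v : ZMod n → X}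

theorem neZero (h : K.IsBoundaryCycle f n s v) : NeZero n := ⟨by have := h.three_le; omega⟩

theorem side_subset (h : K.IsBoundaryCycle f n s v) (k : ZMod n) : s k ⊆ f := fun _ hx =>
  (h.boundary.symm ▸ Set.mem_iUnion.mpr ⟨k, hx⟩ : _ ∈ f ∩ K.skeleton).1

theorem corner_mem_vertices (h : K.IsBoundaryCycle f n s v) (k : ZMod n) : v k ∈ K.vertices :=
  (h.side_inter k ▸ Or.inl rfl : v k ∈ s k ∩ K.vertices).2

theorem corner_mem (h : K.IsBoundaryCycle f n s v) (k : ZMod n) : v k ∈ s k :=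
  (h.side_inter k ▸ Or.inl rfl : v k ∈ s k ∩ K.vertices).1

theorem corner_succ_mem (h : K.IsBoundaryCycle f n s v) (k : ZMod n) : v (k + 1) ∈ s k :=
  (h.side_inter k ▸ Or.inr rfl : v (k + 1) ∈ s k ∩ K.vertices).1

theorem corner_mem_side_iff (h : K.IsBoundaryCycle f n s v) (j k : ZMod n) :
    v j ∈ s k ↔ k = j ∨ k + 1 = j := by
  constructor
  · intro hj
    have : v j ∈ ({v k, v (k + 1)} : Set X) := h.side_inter k ▸ ⟨hj, h.corner_mem_vertices j⟩
    rcases this with h' | h'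
    · exact Or.inl (h.corner_injective h').symm
    · exact Or.inr (h.corner_injective h').symm
  · rintro (rfl | rfl)
    · exact h.corner_mem k
    · exact h.corner_succ_mem k

theorem exists_side_of_mem (h : K.IsBoundaryCycle f n s v) {x : X} (hx : x ∈ f)
    (hx' : x ∈ K.skeleton) : ∃ k, x ∈ s k :=
  Set.mem_iUnion.mp (h.boundary ▸ ⟨hx, hx'⟩ : x ∈ ⋃ k, s k)

theorem exists_corner_eq (h : K.IsBoundaryCycle f n s v) {x : X} (hx : x ∈ f)
    (hx' : x ∈ K.vertices) : ∃ k, x = v k := by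
  obtain ⟨k, hk⟩ := h.exists_side_of_mem hx (Or.inl hx')
  have : x ∈ ({v k, v (k + 1)} : Set X) := h.side_inter k ▸ ⟨hk, hx'⟩
  rcases this with h' | h'
  exacts [⟨_, h'⟩, ⟨_, h'⟩]

theorem exists_side_eq (h : K.IsBoundaryCycle f n s v) {e : Set X} (he : e ∈ K.edges)
    (hef : e ⊆ f) : ∃ k, e = s k := by
  obtain ⟨x, hx, hxV⟩ := K.exists_mem_edge_notMem_vertices he
  obtain ⟨k, hk⟩ := h.exists_side_of_mem (hef hx) (K.subset_skeleton he hx)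
  exact ⟨k, K.edge_eq_of_mem he (h.side_mem k) hx hk hxV⟩

end IsBoundaryCycle

variable {K : TwoComplex X}

theorem exists_edge_of_mem_face {f : Set X} (hf : f ∈ K.faces) {x : X} (hx : x ∈ f)
    (hx' : x ∈ K.skeleton) : ∃ e ∈ K.edges, x ∈ e ∧ e ⊆ f := by
  obtain ⟨n, s, v, h⟩ := K.exists_isBoundaryCycle hf
  obtain ⟨k, hk⟩ := h.exists_side_of_mem hx hx'
  exact ⟨s k, h.side_mem k, hk, h.side_subset k⟩

/-- A point other than a vertex lies on a face only if the whole edge through it does. -/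
theorem edge_subset_of_mem_face {e f : Set X} (he : e ∈ K.edges) (hf : f ∈ K.faces) {x : X}
    (hx : x ∈ e) (hxV : x ∉ K.vertices) (hxf : x ∈ f) : e ⊆ f := by
  obtain ⟨e', he', hxe', hef'⟩ := exists_edge_of_mem_face hf hxf (K.subset_skeleton he hx)
  rwa [K.edge_eq_of_mem he he' hx hxe' hxV]

/-- Exactly two edges of a face meet at each of its corners. -/
theorem exists_edges_at_corner {f : Set X} (hf : f ∈ K.faces) {x : X} (hx : x ∈ f)
    (hxV : x ∈ K.vertices) : ∃ e e', e ≠ e' ∧ {e | e ∈ K.edges ∧ x ∈ e ∧ e ⊆ f} = {e, e'} := by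
  obtain ⟨n, s, v, h⟩ := K.exists_isBoundaryCycle hf
  have := h.neZero
  have : Fact (1 < n) := ⟨by have := h.three_le; omega⟩
  obtain ⟨j, rfl⟩ := h.exists_corner_eq hx hxV
  refine ⟨s j, s (j - 1), fun hs => ?_, ?_⟩
  · have := h.side_injective hs
    rw [eq_comm, sub_eq_self] at this
    exact one_ne_zero this
  · ext e
    constructor
    · rintro ⟨he, hje, hef⟩
      obtain ⟨k, rfl⟩ := h.exists_side_eq he hef
      rcases (h.corner_mem_side_iff j k).mp hje with rfl | rfl
      · exact Or.inl rfl
      · right; rw [add_sub_cancel_right]; rfl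
    · rintro (rfl | rfl)
      · exact ⟨h.side_mem _, h.corner_mem j, h.side_subset _⟩
      · exact ⟨h.side_mem _, (h.corner_mem_side_iff _ _).mpr (Or.inr (sub_add_cancel _ _)),
          h.side_subset _⟩

/-- A face has an edge other than two given ones. -/
theorem exists_edge_ne_ne {f : Set X} (hf : f ∈ K.faces) (e e' : Set X) :
    ∃ e'' ∈ K.edges, e'' ⊆ f ∧ e'' ≠ e ∧ e'' ≠ e' := by
  obtain ⟨n, s, v, h⟩ := K.exists_isBoundaryCycle hf
  have := h.neZero
  by_contra! hcon
  have hsub : Set.range s ⊆ {e, e'} := by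
    rintro _ ⟨k, rfl⟩
    by_cases hk : s k = e
    · exact Or.inl hk
    · exact Or.inr (hcon _ (h.side_mem k) (h.side_subset k) hk)
  have h1 := Set.ncard_le_ncard hsub (Set.toFinite _)
  have h2 := Set.ncard_insert_le e {e'}
  rw [Set.ncard_singleton] at h2
  rw [← Set.image_univ, Set.ncard_image_of_injective _ h.side_injective, Set.ncard_univ,
    Nat.card_zmod] at h1
  have := h.three_le
  omega

/-- A face is parametrized by the closed unit disk, its boundary by the unit circle. -/
theorem exists_homeomorph_face {f : Set X} (hf : f ∈ K.faces) :
    ∃ G : Metric.closedBall (0 : ℂ) 1 ≃ₜ f, ∀ z : Metric.closedBall (0 : ℂ) 1,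
      ‖(z : ℂ)‖ = 1 ↔ (G z : X) ∈ K.skeleton := by
  obtain ⟨n, hn, h, -, -, hb⟩ := K.face_spec f hf
  obtain ⟨G, hG⟩ := exists_homeomorph_closedPolygon hn
  refine ⟨G.trans h, fun z => ?_⟩
  rw [hG]
  have h1 : (h (G z) : X) ∈ K.skeleton ↔ (h (G z) : X) ∈ f ∩ (K.vertices ∪ ⋃₀ K.edges) :=
    ⟨fun h' => ⟨Subtype.coe_prop _, h'⟩, fun h' => h'.2⟩
  simp only [Homeomorph.trans_apply]
  rw [h1, hb]
  constructor
  · intro hk; exact ⟨G z, hk, rfl⟩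
  · rintro ⟨y, hy, hyz⟩
    rwa [← h.injective (Subtype.ext hyz)]

theorem exists_mem_face_notMem_skeleton {f : Set X} (hf : f ∈ K.faces) :
    ∃ x ∈ f, x ∉ K.skeleton := by
  obtain ⟨G, hG⟩ := exists_homeomorph_face hf
  refine ⟨G ⟨0, by simp⟩, Subtype.coe_prop _, fun h => ?_⟩
  rw [← hG] at h
  simp at h

theorem face_eq_of_mem {f g : Set X} (hf : f ∈ K.faces) (hg : g ∈ K.faces) {x : X} (hx : x ∈ f)
    (hx' : x ∈ g) (h : x ∉ K.skeleton) : f = g := by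
  by_contra hne
  exact h (Or.inr (K.faces_inter f hf g hg hne ⟨hx, hx'⟩))

/-- If a map carries a face `g` of `A` injectively onto a face `f` of `K`, and the corners and sides
of `g` to vertices and edges of `K`, then it carries the sides of `g` onto all sides of `f`: a
nonempty set of sides of the cycle `∂f`, no endpoint of which is an endpoint of just one of them,
consists of all the sides. -/
theorem exists_side_image_eq {Y : Type v} [TopologicalSpace Y] [T2Space Y] {A : TwoComplex Y}
    {φ : Y → X} {f : Set X} {g : Set Y} (hf : f ∈ K.faces) (hg : g ∈ A.faces) (hφ : φ '' g = f)
    (hinj : Set.InjOn φ g) (hV : ∀ x ∈ A.vertices, φ x ∈ K.vertices)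
    (hE : ∀ e ∈ A.edges, φ '' e ∈ K.edges) {e : Set X} (he : e ∈ K.edges) (hef : e ⊆ f) :
    ∃ e' ∈ A.edges, e' ⊆ g ∧ φ '' e' = e := by
  obtain ⟨n, s, v, h⟩ := K.exists_isBoundaryCycle hf
  obtain ⟨m, t, w, h'⟩ := A.exists_isBoundaryCycle hg
  have := h.neZero
  have := h'.neZero
  have : Fact (1 < m) := ⟨by have := h'.three_le; omega⟩
  have him : ∀ j, ∃ k, φ '' t j = s k := fun j =>
    h.exists_side_eq (hE _ (h'.side_mem j)) (hφ ▸ Set.image_mono (h'.side_subset j))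
  -- the set of sides that are hit is closed under passing to the next side
  have hstep : ∀ k, (∃ j, φ '' t j = s k) → ∃ j, φ '' t j = s (k + 1) := by
    rintro k ⟨j, hj⟩
    have hne : φ (w j) ≠ φ (w (j + 1)) := fun heq => by
      have := h'.corner_injective (hinj (h'.side_subset j (h'.corner_mem j))
        (h'.side_subset j (h'.corner_succ_mem j)) heq)
      simp at this
    have hends : s k ∩ K.vertices = {φ (w j), φ (w (j + 1))} :=
      K.edge_inter_vertices_eq (h.side_mem k) (hj ▸ ⟨_, h'.corner_mem j, rfl⟩)
        (hV _ (h'.corner_mem_vertices j)) (hj ▸ ⟨_, h'.corner_succ_mem j, rfl⟩)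
        (hV _ (h'.corner_mem_vertices _)) hne
    -- the corner `v (k + 1)` lies on a second side of `g`
    obtain ⟨i, j', hij, hi, hi'⟩ : ∃ i j', j' ≠ j ∧ v (k + 1) = φ (w i) ∧ w i ∈ t j' := by
      have hmem : v (k + 1) ∈ ({φ (w j), φ (w (j + 1))} : Set X) :=
        hends ▸ ⟨h.corner_succ_mem k, h.corner_mem_vertices _⟩
      rcases hmem with h1 | h1
      · refine ⟨j, j - 1, by simp, h1, ?_⟩
        exact (h'.corner_mem_side_iff _ _).mpr (Or.inr (sub_add_cancel _ _))
      · exact ⟨j + 1, j + 1, by simp, h1, h'.corner_mem _⟩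
    obtain ⟨l, hl⟩ := him j'
    have hvl : v (k + 1) ∈ s l := by rw [← hl, hi]; exact ⟨_, hi', rfl⟩
    have hlk : l ≠ k := fun hlk => by
      rw [hlk, ← hj] at hl
      have hsub := (hinj.image_eq_image_iff (h'.side_subset j') (h'.side_subset j)).mp hl
      exact hij (h'.side_injective hsub)
    rcases (h.corner_mem_side_iff _ _).mp hvl with rfl | h2
    · exact ⟨j', hl⟩
    · exact absurd (add_right_cancel h2) hlk
  obtain ⟨k, rfl⟩ := h.exists_side_eq he hef
  obtain ⟨k₀, hk₀⟩ := him 0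
  have hall : ∀ i : ℕ, ∃ j, φ '' t j = s (k₀ + i) := by
    intro i
    induction i with
    | zero => exact ⟨0, by simpa using hk₀⟩
    | succ i ih => simpa [add_assoc] using hstep _ ih
  obtain ⟨j, hj⟩ := hall (k - k₀).val
  rw [ZMod.natCast_zmod_val, add_sub_cancel] at hj
  exact ⟨t j, h'.side_mem j, h'.side_subset j, hj⟩

/-! ### Even complexes and circlets -/

theorem degree_eq_sum_of_isFaceDisjointUnion {n : ℕ} {C : Fin n → TwoComplex X}
    (h : K.IsFaceDisjointUnion C) (e : Set X) : K.degree e = ∑ i, (C i).degree e := by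
  obtain ⟨-, -, hF, hdisj⟩ := h
  have hset : {f | f ∈ K.faces ∧ e ⊆ f} = ⋃ i, {f | f ∈ (C i).faces ∧ e ⊆ f} := by
    ext f; simp [hF]
  rw [degree, hset, Set.ncard_iUnion_of_finite]
  · rw [finsum_eq_sum_of_fintype]; rfl
  · intro i
    exact (C i).finite_faces.subset fun f hf => hf.1
  · intro i j hij
    exact (hdisj i j hij).mono (fun f hf => hf.1) (fun f hf => hf.1)

/-- An edge that does not belong to a subcomplex lies in no face of it, as a face of the subcomplex
has the same sides there as in the whole complex. -/
theorem degree_eq_zero_of_notMem {A : TwoComplex X} (hV : A.vertices ⊆ K.vertices)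
    (hE : A.edges ⊆ K.edges) (hF : A.faces ⊆ K.faces) {e : Set X} (he : e ∈ K.edges)
    (heA : e ∉ A.edges) : A.degree e = 0 := by
  have : {f | f ∈ A.faces ∧ e ⊆ f} = ∅ := by
    refine Set.eq_empty_of_forall_notMem fun f hf => heA ?_
    obtain ⟨e', he', -, h⟩ := exists_side_image_eq (φ := id) (hF hf.1) hf.1 (Set.image_id f)
      Function.injective_id.injOn (fun x hx => hV hx) (fun e he => by simpa using hE he) he hf.2
    rw [Set.image_id] at h
    rwa [← h]
  rw [degree, this, Set.ncard_empty]

theorem isEven_of_isFaceDisjointUnion {n : ℕ} {C : Fin n → TwoComplex X}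
    (h : K.IsFaceDisjointUnion C) (hC : ∀ i, (C i).IsEven) : K.IsEven := by
  intro e he
  have hd := degree_eq_sum_of_isFaceDisjointUnion h e
  obtain ⟨hV, hE, hF, -⟩ := h
  have hmem : ∀ i, e ∉ (C i).edges → (C i).degree e = 0 := fun i =>
    degree_eq_zero_of_notMem (hV ▸ Set.subset_iUnion (fun i => (C i).vertices) i)
      (hE ▸ Set.subset_iUnion (fun i => (C i).edges) i)
      (hF ▸ Set.subset_iUnion (fun i => (C i).faces) i) he
  rw [hd]
  constructor
  · rw [hE, Set.mem_iUnion] at he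
    obtain ⟨i, hi⟩ := he
    exact (hC i e hi).1.trans_le
      (Finset.single_le_sum (f := fun i => (C i).degree e) (fun _ _ => Nat.zero_le _)
        (Finset.mem_univ i))
  · refine Finset.even_sum _ fun i _ => ?_
    by_cases hi : e ∈ (C i).edges
    · exact (hC i e hi).2
    · rw [hmem i hi]; exact Even.zero

/-- By induction on the number of faces: an even complex that is not a circlet splits into two even
complexes with fewer faces. -/
theorem isFaceDisjointUnionOfCirclets_of_isEven (K : TwoComplex X) (hK : K.IsEven) :
    K.IsFaceDisjointUnionOfCirclets := by
  induction hn : K.faces.ncard using Nat.strong_induction_on generalizing K with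
  | _ n ih =>
  by_cases hc : K.IsCirclet
  · exact ⟨1, fun _ => K, fun _ => hc, by simp [IsFaceDisjointUnion, Set.iUnion_const]⟩
  · obtain ⟨A, B, hA, hB, hAne, hBne, hV, hE, hF, hd⟩ :
        ∃ A B : TwoComplex X, A.IsEven ∧ B.IsEven ∧ A.faces.Nonempty ∧ B.faces.Nonempty ∧
          K.IsFaceDisjointUnion ![A, B] := by
      by_contra h
      exact hc ⟨hK, h⟩
    have hdAB : Disjoint A.faces B.faces := hd 0 1 (by decide)
    have hV' : K.vertices = A.vertices ∪ B.vertices := by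
      rw [hV]; ext x; simp [Fin.exists_fin_two]
    have hE' : K.edges = A.edges ∪ B.edges := by
      rw [hE]; ext x; simp [Fin.exists_fin_two]
    have hF' : K.faces = A.faces ∪ B.faces := by
      rw [hF]; ext x; simp [Fin.exists_fin_two]
    have hcard : K.faces.ncard = A.faces.ncard + B.faces.ncard := by
      rw [hF', Set.ncard_union_eq hdAB A.finite_faces B.finite_faces]
    have hA0 := (Set.ncard_pos A.finite_faces).mpr hAne
    have hB0 := (Set.ncard_pos B.finite_faces).mpr hBne
    obtain ⟨a, C, hC, hCV, hCE, hCF, hCd⟩ := ih _ (by omega) A hA rfl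
    obtain ⟨b, D, hD, hDV, hDE, hDF, hDd⟩ := ih _ (by omega) B hB rfl
    have hCsub : ∀ i, (C i).faces ⊆ A.faces := fun i =>
      hCF ▸ Set.subset_iUnion (fun i => (C i).faces) i
    have hDsub : ∀ i, (D i).faces ⊆ B.faces := fun i =>
      hDF ▸ Set.subset_iUnion (fun i => (D i).faces) i
    have hun : ∀ {β : Type u} (g : TwoComplex X → Set β),
        ⋃ i, g (Fin.append C D i) = (⋃ i, g (C i)) ∪ ⋃ i, g (D i) := by
      intro β g
      ext x
      simp only [Set.mem_iUnion, Set.mem_union]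
      constructor
      · rintro ⟨i, hi⟩
        induction i using Fin.addCases with
        | left i => left; exact ⟨i, by rwa [Fin.append_left] at hi⟩
        | right i => right; exact ⟨i, by rwa [Fin.append_right] at hi⟩
      · rintro (⟨i, hi⟩ | ⟨i, hi⟩)
        · exact ⟨Fin.castAdd b i, by rwa [Fin.append_left]⟩
        · exact ⟨Fin.natAdd a i, by rwa [Fin.append_right]⟩
    refine ⟨a + b, Fin.append C D, fun i => ?_, ?_, ?_, ?_, fun i j hij => ?_⟩
    · induction i using Fin.addCases with
      | left i => rw [Fin.append_left]; exact hC i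
      | right i => rw [Fin.append_right]; exact hD i
    · rw [hun TwoComplex.vertices, hV', hCV, hDV]
    · rw [hun TwoComplex.edges, hE', hCE, hDE]
    · rw [hun TwoComplex.faces, hF', hCF, hDF]
    · induction i using Fin.addCases with
      | left i =>
        induction j using Fin.addCases with
        | left j =>
          rw [Fin.append_left, Fin.append_left]
          exact hCd i j fun h => hij (h ▸ rfl)
        | right j =>
          rw [Fin.append_left, Fin.append_right]
          exact hdAB.mono (hCsub i) (hDsub j)
      | right i =>
        induction j using Fin.addCases with
        | left j =>
          rw [Fin.append_left, Fin.append_right]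
          exact (hdAB.mono (hCsub j) (hDsub i)).symm
        | right j =>
          rw [Fin.append_right, Fin.append_right]
          exact hDd i j fun h => hij (h ▸ rfl)

theorem isEven_iff_isFaceDisjointUnionOfCirclets :
    K.IsEven ↔ K.IsFaceDisjointUnionOfCirclets :=
  ⟨isFaceDisjointUnionOfCirclets_of_isEven K, fun ⟨_, _, hC, h⟩ =>
    isEven_of_isFaceDisjointUnion h fun i => (hC i).1⟩

end TwoComplex

namespace TwoComplex

variable {X : Type u} [TopologicalSpace X] [T2Space X] {K : TwoComplex X}

/-! ### Half-plane charts and sectors of a face -/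

theorem cayley_normSq (w : ℂ) :
    Complex.normSq (Complex.I + w) - Complex.normSq (Complex.I - w) = 4 * w.im := by
  simp [Complex.normSq_apply]; ring

theorem I_add_ne_zero {w : ℂ} (hw : 0 ≤ w.im) : Complex.I + w ≠ 0 := fun h => by
  have := congrArg Complex.im h
  simp at this
  linarith

theorem norm_cayley_le {w : ℂ} (hw : 0 ≤ w.im) : ‖(Complex.I - w) / (Complex.I + w)‖ ≤ 1 := by
  rw [norm_div, div_le_one (norm_pos_iff.mpr (I_add_ne_zero hw))]
  have := cayley_normSq w
  rw [Complex.normSq_eq_norm_sq, Complex.normSq_eq_norm_sq] at this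
  exact abs_le_of_sq_le_sq' (by linarith) (norm_nonneg _) |>.2

theorem norm_cayley_eq_one_iff {w : ℂ} (hw : 0 ≤ w.im) :
    ‖(Complex.I - w) / (Complex.I + w)‖ = 1 ↔ w.im = 0 := by
  have h0 := norm_pos_iff.mpr (I_add_ne_zero hw)
  rw [norm_div, div_eq_one_iff_eq h0.ne']
  have := cayley_normSq w
  rw [Complex.normSq_eq_norm_sq, Complex.normSq_eq_norm_sq] at this
  constructor
  · intro h; rw [h] at this; linarith
  · intro h
    rw [h] at this
    have := abs_eq_abs.mpr (sq_eq_sq_iff_eq_or_eq_neg.mp (by linarith :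
      ‖Complex.I - w‖ ^ 2 = ‖Complex.I + w‖ ^ 2))
    simpa using this

theorem cayley_inv_im {z : ℂ} (hz : ‖z‖ ≤ 1) :
    0 ≤ (Complex.I * (1 - z) / (1 + z)).im := by
  have h1 : (Complex.I * (1 - z) / (1 + z)).im =
      (1 - Complex.normSq z) / Complex.normSq (1 + z) := by
    simp [Complex.div_im, Complex.normSq_apply]; ring
  rw [h1, Complex.normSq_eq_norm_sq]
  apply div_nonneg _ (Complex.normSq_nonneg _)
  nlinarith [norm_nonneg z]

/-- A face without a boundary point `q` is a closed half-plane, in which another boundary point `p`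
may be taken for the origin. The chart `h` and its inverse `g` are total functions that are
meaningful on the half-plane and on `f \ {q}` only. -/
theorem exists_halfPlane_chart {f : Set X} (hf : f ∈ K.faces) {p q : X} (hp : p ∈ f)
    (hpK : p ∈ K.skeleton) (hq : q ∈ f) (hqK : q ∈ K.skeleton) (hpq : p ≠ q) :
    ∃ (h : ℂ → X) (g : X → ℂ), ContinuousOn h {w | 0 ≤ w.im} ∧ ContinuousOn g (f \ {q}) ∧
      (∀ w, 0 ≤ w.im → h w ∈ f \ {q} ∧ g (h w) = w) ∧
      (∀ y ∈ f \ {q}, 0 ≤ (g y).im ∧ h (g y) = y) ∧ h 0 = p ∧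
      ∀ w, 0 ≤ w.im → (h w ∈ K.skeleton ↔ w.im = 0) := by
  classical
  obtain ⟨G, hG⟩ := exists_homeomorph_face hf
  set ζ : ℂ := ((G.symm ⟨q, hq⟩ : Metric.closedBall (0 : ℂ) 1) : ℂ) with hζ
  have hζ1 : ‖ζ‖ = 1 := (hG _).mpr (by rwa [Homeomorph.apply_symm_apply])
  have hζ0 : ζ ≠ 0 := norm_pos_iff.mp (by rw [hζ1]; exact one_pos)
  set ξ : ℂ := ((G.symm ⟨p, hp⟩ : Metric.closedBall (0 : ℂ) 1) : ℂ) with hξ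
  have hξ1 : ‖ξ‖ = 1 := (hG _).mpr (by rwa [Homeomorph.apply_symm_apply])
  let c : ℂ → ℂ := fun w => -ζ * ((Complex.I - w) / (Complex.I + w))
  let d : ℂ → ℂ := fun z => Complex.I * (1 - -z / ζ) / (1 + -z / ζ)
  have hcn : ∀ w : ℂ, 0 ≤ w.im → ‖c w‖ ≤ 1 := fun w hw => by
    simp only [c]
    rw [norm_mul, norm_neg, hζ1, one_mul]; exact norm_cayley_le hw
  have hcn1 : ∀ w : ℂ, 0 ≤ w.im → (‖c w‖ = 1 ↔ w.im = 0) := fun w hw => by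
    simp only [c]
    rw [norm_mul, norm_neg, hζ1, one_mul]; exact norm_cayley_eq_one_iff hw
  have hdi : ∀ z : ℂ, ‖z‖ ≤ 1 → 0 ≤ (d z).im := fun z hz =>
    cayley_inv_im (by rwa [norm_div, norm_neg, hζ1, div_one])
  have hdc : ∀ w : ℂ, 0 ≤ w.im → d (c w) = w := fun w hw => by
    have h0 := I_add_ne_zero hw
    have hI := Complex.I_ne_zero
    have e1 : -c w / ζ = (Complex.I - w) / (Complex.I + w) := by
      simp only [c]; field_simp
    simp only [d, e1]
    have e2 : 1 + (Complex.I - w) / (Complex.I + w) = 2 * Complex.I / (Complex.I + w) := by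
      field_simp; ring
    have e3 : 1 - (Complex.I - w) / (Complex.I + w) = 2 * w / (Complex.I + w) := by
      field_simp; ring
    rw [e2, e3]; field_simp
  have hz0 : ∀ z : ℂ, z ≠ ζ → 1 + -z / ζ ≠ 0 := fun z hz h => hz (by
    field_simp at h; linear_combination -h)
  have hcd : ∀ z : ℂ, z ≠ ζ → c (d z) = z := fun z hz => by
    have h0 := hz0 z hz
    have hI := Complex.I_ne_zero
    simp only [c, d]
    set t := -z / ζ with ht
    have e2 : Complex.I - Complex.I * (1 - t) / (1 + t) = 2 * Complex.I * t / (1 + t) := by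
      field_simp; ring
    have e3 : Complex.I + Complex.I * (1 - t) / (1 + t) = 2 * Complex.I / (1 + t) := by
      field_simp; ring
    have e4 : z = -ζ * t := by rw [ht]; field_simp
    rw [e2, e3, e4]; field_simp
  have hcζ : ∀ w : ℂ, 0 ≤ w.im → c w ≠ ζ := fun w hw h => by
    have h0 := I_add_ne_zero hw
    simp only [c] at h
    field_simp at h
    have h' : -(Complex.I - w) = Complex.I + w := by linear_combination h
    have := congrArg Complex.im h'
    simp at this
    linarith
  have hξζ : ξ ≠ ζ := fun h => hpq (by
    have := G.symm.injective (Subtype.ext h)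
    exact congrArg Subtype.val this)
  have hd0 : (d ξ).im = 0 := by
    rw [← hcn1 _ (hdi ξ hξ1.le), hcd ξ hξζ, hξ1]
  set x₀ := d ξ with hx₀
  have him : ∀ w : ℂ, (w + x₀).im = w.im := fun w => by rw [Complex.add_im, hd0, add_zero]
  let h : ℂ → X := fun w => if hw : 0 ≤ (w + x₀).im then
    (G ⟨c (w + x₀), mem_closedBall_zero_iff.mpr (hcn _ hw)⟩ : X) else p
  let g : X → ℂ := fun y =>
    if hy : y ∈ f then d ((G.symm ⟨y, hy⟩ : Metric.closedBall (0 : ℂ) 1) : ℂ) - x₀ else 0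
  have hh : ∀ (w : ℂ) (hw : 0 ≤ (w + x₀).im), h w =
      (G ⟨c (w + x₀), mem_closedBall_zero_iff.mpr (hcn _ hw)⟩ : X) := fun w hw => dif_pos hw
  have hg : ∀ y (hy : y ∈ f),
      g y = d ((G.symm ⟨y, hy⟩ : Metric.closedBall (0 : ℂ) 1) : ℂ) - x₀ := fun y hy => dif_pos hy
  have hGζ : ∀ y (hy : y ∈ f), y ≠ q →
      ((G.symm ⟨y, hy⟩ : Metric.closedBall (0 : ℂ) 1) : ℂ) ≠ ζ := fun y hy hyq he =>
    hyq (congrArg Subtype.val (G.symm.injective (Subtype.ext he)))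
  refine ⟨h, g, ?_, ?_, ?_, ?_, ?_, ?_⟩
  · rw [continuousOn_iff_continuous_domRestrict]
    have : Set.domRestrict {w : ℂ | 0 ≤ w.im} h = fun w : {w : ℂ | 0 ≤ w.im} =>
        (G ⟨c (w + x₀), mem_closedBall_zero_iff.mpr (hcn _ ((him w).symm ▸ w.2))⟩ : X) := by
      funext w
      exact hh w ((him w).symm ▸ w.2)
    rw [this]
    refine continuous_subtype_val.comp (G.continuous.comp (Continuous.subtype_mk ?_ _))
    refine continuous_const.mul (Continuous.div (by fun_prop) (by fun_prop) fun w => ?_)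
    exact I_add_ne_zero ((him w).symm ▸ w.2)
  · rw [continuousOn_iff_continuous_domRestrict]
    have : Set.domRestrict (f \ {q}) g = fun y : (f \ {q} : Set X) =>
        d ((G.symm ⟨y, y.2.1⟩ : Metric.closedBall (0 : ℂ) 1) : ℂ) - x₀ := by
      funext y
      exact hg y y.2.1
    rw [this]
    have hc : Continuous fun y : (f \ {q} : Set X) =>
        ((G.symm ⟨y, y.2.1⟩ : Metric.closedBall (0 : ℂ) 1) : ℂ) :=
      continuous_subtype_val.comp (G.symm.continuous.comp
        (Continuous.subtype_mk continuous_subtype_val _))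
    refine Continuous.sub (Continuous.div (by fun_prop) (by fun_prop) fun y => ?_) continuous_const
    exact hz0 _ (hGζ y y.2.1 y.2.2)
  · intro w hw
    have hw' : 0 ≤ (w + x₀).im := (him w).symm ▸ hw
    rw [hh w hw']
    refine ⟨⟨Subtype.coe_prop _, fun he => ?_⟩, ?_⟩
    · have he' : G ⟨c (w + x₀), mem_closedBall_zero_iff.mpr (hcn _ hw')⟩ = ⟨q, hq⟩ :=
        Subtype.ext he
      apply hcζ _ hw'
      rw [hζ, ← he', Homeomorph.symm_apply_apply]
    · rw [hg _ (Subtype.coe_prop _)]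
      simp only [Subtype.coe_eta, Homeomorph.symm_apply_apply]
      rw [hdc _ hw', add_sub_cancel_right]
  · rintro y ⟨hy, hyq⟩
    have hi : 0 ≤ (d ((G.symm ⟨y, hy⟩ : Metric.closedBall (0 : ℂ) 1) : ℂ)).im :=
      hdi _ (mem_closedBall_zero_iff.mp (Subtype.coe_prop _))
    rw [hg y hy]
    refine ⟨by rw [Complex.sub_im, hd0, sub_zero]; exact hi, ?_⟩
    rw [hh _ (by rwa [sub_add_cancel])]
    simp only [sub_add_cancel, hcd _ (hGζ y hy hyq), Subtype.coe_eta, Homeomorph.apply_symm_apply]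
  · rw [hh 0 (by rw [zero_add, hd0])]
    simp only [zero_add, hx₀, hcd ξ hξζ]
    simp only [hξ, Subtype.coe_eta, Homeomorph.apply_symm_apply]
  · intro w hw
    have hw' : 0 ≤ (w + x₀).im := (him w).symm ▸ hw
    rw [hh w hw', ← hG]
    simp only
    rw [hcn1 _ hw', him]

/-- A continuous injection of `[0, 1]` into the line that starts at `0` is monotone up to a sign. -/
theorem exists_sign_strictMonoOn {u : ℝ → ℝ} (hc : ContinuousOn u (Set.Icc 0 1))
    (hi : Set.InjOn u (Set.Icc 0 1)) : ∃ σ : ℝ, (σ = 1 ∨ σ = -1) ∧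
      StrictMonoOn (fun a => σ * u a) (Set.Icc 0 1) := by
  rcases hc.strictMonoOn_of_injOn_Icc' zero_le_one hi with h | h
  · exact ⟨1, Or.inl rfl, by simpa using h⟩
  · exact ⟨-1, Or.inr rfl, fun a ha b hb hab => by simpa using h ha hb hab⟩

/-- A half-edge at a point `p`: an arc in the 1-skeleton, parametrized by `[0, 1]`, that starts
at `p`. -/
structure IsHalfEdge (K : TwoComplex X) (p : X) (η : ℝ → X) : Prop where
  continuousOn : ContinuousOn η (Set.Icc 0 1)
  injOn : Set.InjOn η (Set.Icc 0 1)
  map_zero : η 0 = p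
  mem_skeleton : ∀ a ∈ Set.Icc (0 : ℝ) 1, η a ∈ K.skeleton

/-- A parametrization `ψ` by the unit square of the corner of a face `f` between the half-edges `η`
and `η'`, which form two sides of the square. -/
structure IsSector (K : TwoComplex X) (f : Set X) (η η' : ℝ → X) (ψ : ℝ × ℝ → X) : Prop where
  continuousOn : ContinuousOn ψ (Set.Icc 0 1 ×ˢ Set.Icc 0 1)
  injOn : Set.InjOn ψ (Set.Icc 0 1 ×ˢ Set.Icc 0 1)
  mapsTo : Set.MapsTo ψ (Set.Icc 0 1 ×ˢ Set.Icc 0 1) f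
  left : ∀ a ∈ Set.Icc (0 : ℝ) 1, ψ (a, 0) = η a
  right : ∀ b ∈ Set.Icc (0 : ℝ) 1, ψ (0, b) = η' b
  interior : ∀ a b : ℝ, 0 < a → a ≤ 1 → 0 < b → b ≤ 1 → ψ (a, b) ∉ K.skeleton
  nhds : ∃ W : Set X, IsOpen W ∧ η 0 ∈ W ∧
    ∀ y ∈ W ∩ f, ∃ a b : ℝ, 0 ≤ a ∧ 0 ≤ b ∧ a + b ≤ 1 ∧ ψ (a, b) = y

/-- In the half-plane chart, the two half-edges are the two halves of the boundary line after
reparametrizations `α`, `β`; the map `(a, b) ↦ (α a - β b) + i * min (α a) (β b)` is the required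
parametrization. -/
theorem exists_isSector {f : Set X} (hf : f ∈ K.faces) {p q : X} (hq : q ∈ f)
    (hqK : q ∈ K.skeleton) {η η' : ℝ → X} (hη : K.IsHalfEdge p η) (hη' : K.IsHalfEdge p η')
    (hηf : ∀ a ∈ Set.Icc (0 : ℝ) 1, η a ∈ f \ {q}) (hηf' : ∀ a ∈ Set.Icc (0 : ℝ) 1, η' a ∈ f \ {q})
    (hdisj : ∀ a ∈ Set.Icc (0 : ℝ) 1, ∀ b ∈ Set.Icc (0 : ℝ) 1, η a = η' b → a = 0) :
    ∃ ψ, K.IsSector f η η' ψ := by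
  have h00 : (0 : ℝ) ∈ Set.Icc (0 : ℝ) 1 := ⟨le_rfl, zero_le_one⟩
  have hpf : p ∈ f \ {q} := hη.map_zero ▸ hηf 0 h00
  have hpK : p ∈ K.skeleton := hη.map_zero ▸ hη.mem_skeleton 0 h00
  obtain ⟨h, g, hhc, hgc, hh, hg, hh0, hhs⟩ :=
    exists_halfPlane_chart hf hpf.1 hpK hq hqK hpf.2
  have hgp : g p = 0 := by rw [← hh0]; exact (hh 0 le_rfl).2
  -- the half-edges in the chart
  have hline : ∀ {θ : ℝ → X}, K.IsHalfEdge p θ → (∀ a ∈ Set.Icc (0 : ℝ) 1, θ a ∈ f \ {q}) →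
      ∃ (σ : ℝ) (α : ℝ → ℝ), (σ = 1 ∨ σ = -1) ∧ StrictMonoOn α (Set.Icc 0 1) ∧
        ContinuousOn α (Set.Icc 0 1) ∧ α 0 = 0 ∧
        ∀ a ∈ Set.Icc (0 : ℝ) 1, h ((σ * α a : ℝ) : ℂ) = θ a := by
    intro θ hθ hθf
    have him : ∀ a ∈ Set.Icc (0 : ℝ) 1, (g (θ a)).im = 0 := fun a ha => by
      rw [← hhs _ (hg _ (hθf a ha)).1, (hg _ (hθf a ha)).2]
      exact hθ.mem_skeleton a ha
    have hre : ∀ a ∈ Set.Icc (0 : ℝ) 1, (((g (θ a)).re : ℝ) : ℂ) = g (θ a) := fun a ha =>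
      Complex.ext (by simp) (by simp [him a ha])
    have hc : ContinuousOn (fun a => (g (θ a)).re) (Set.Icc 0 1) :=
      Complex.continuous_re.comp_continuousOn (hgc.comp hθ.continuousOn hθf)
    have hi : Set.InjOn (fun a => (g (θ a)).re) (Set.Icc 0 1) := fun a ha b hb hab => by
      have h1 : g (θ a) = g (θ b) := by
        rw [← hre a ha, ← hre b hb]; exact congrArg _ hab
      have h2 := congrArg h h1
      rw [(hg _ (hθf a ha)).2, (hg _ (hθf b hb)).2] at h2
      exact hθ.injOn ha hb h2
    obtain ⟨σ, hσ, hm⟩ := exists_sign_strictMonoOn hc hi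
    refine ⟨σ, _, hσ, hm, continuousOn_const.mul hc, ?_, fun a ha => ?_⟩
    · simp only [hθ.map_zero, hgp, Complex.zero_re, mul_zero]
    · have hσσ : σ * σ = 1 := by rcases hσ with rfl | rfl <;> norm_num
      rw [← mul_assoc, hσσ, one_mul, hre a ha, (hg _ (hθf a ha)).2]
  obtain ⟨σ, α, hσ, hαm, hαc, hα0, hα⟩ := hline hη hηf
  obtain ⟨σ', β, hσ', hβm, hβc, hβ0, hβ⟩ := hline hη' hηf'
  have hαpos : ∀ a ∈ Set.Icc (0 : ℝ) 1, 0 ≤ α a := fun a ha =>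
    hα0 ▸ hαm.monotoneOn h00 ha ha.1
  have hβpos : ∀ a ∈ Set.Icc (0 : ℝ) 1, 0 ≤ β a := fun a ha =>
    hβ0 ▸ hβm.monotoneOn h00 ha ha.1
  have hαivt : ∀ r ∈ Set.Icc (0 : ℝ) 1, ∀ x, 0 ≤ x → x ≤ α r → ∃ a ∈ Set.Icc 0 r, α a = x :=
    fun r hr x hx hx' => intermediate_value_Icc hr.1
      (hαc.mono (Set.Icc_subset_Icc_right hr.2)) ⟨by rwa [hα0], hx'⟩
  have hβivt : ∀ r ∈ Set.Icc (0 : ℝ) 1, ∀ x, 0 ≤ x → x ≤ β r → ∃ a ∈ Set.Icc 0 r, β a = x :=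
    fun r hr x hx hx' => intermediate_value_Icc hr.1
      (hβc.mono (Set.Icc_subset_Icc_right hr.2)) ⟨by rwa [hβ0], hx'⟩
  have h11 : (1 : ℝ) ∈ Set.Icc (0 : ℝ) 1 := ⟨zero_le_one, le_rfl⟩
  have hα1 : 0 < α 1 := hα0 ▸ hαm h00 h11 zero_lt_one
  have hβ1 : 0 < β 1 := hβ0 ▸ hβm h00 h11 zero_lt_one
  -- disjoint half-edges leave `p` in opposite directions
  have hσσ' : σ' = -σ := by
    by_contra hne
    have heq : σ' = σ := by
      rcases hσ with h | h <;> rcases hσ' with h' | h' <;> rw [h, h'] at hne ⊢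
      · exact absurd (by norm_num) hne
      · exact absurd (by norm_num) hne
    obtain ⟨a, ha, hae⟩ := hαivt 1 h11 (min (α 1) (β 1)) (by positivity) (min_le_left _ _)
    obtain ⟨b, hb, hbe⟩ := hβivt 1 h11 (min (α 1) (β 1)) (by positivity) (min_le_right _ _)
    have h1 : η a = η' b := by rw [← hα a ha, ← hβ b hb, hae, hbe, heq]
    have h2 := hdisj a ha b hb h1
    rw [h2, hα0] at hae
    have : 0 < min (α 1) (β 1) := lt_min hα1 hβ1
    linarith
  subst hσσ'
  have hσ2 : σ * σ = 1 := by rcases hσ with rfl | rfl <;> norm_num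
  let F : ℝ × ℝ → ℂ := fun x => ⟨σ * (α x.1 - β x.2), min (α x.1) (β x.2)⟩
  have hF : ∀ x ∈ Set.Icc (0 : ℝ) 1 ×ˢ Set.Icc (0 : ℝ) 1, 0 ≤ (F x).im := fun x hx =>
    le_min (hαpos _ hx.1) (hβpos _ hx.2)
  have hFc : ContinuousOn F (Set.Icc 0 1 ×ˢ Set.Icc 0 1) := by
    have h1 : ContinuousOn (fun x : ℝ × ℝ => α x.1) (Set.Icc 0 1 ×ˢ Set.Icc 0 1) :=
      hαc.comp continuousOn_fst fun x hx => hx.1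
    have h2 : ContinuousOn (fun x : ℝ × ℝ => β x.2) (Set.Icc 0 1 ×ˢ Set.Icc 0 1) :=
      hβc.comp continuousOn_snd fun x hx => hx.2
    have h3 : ContinuousOn (fun x : ℝ × ℝ => (σ * (α x.1 - β x.2), min (α x.1) (β x.2)))
        (Set.Icc 0 1 ×ˢ Set.Icc 0 1) :=
      (continuousOn_const.mul (h1.sub h2)).prodMk (continuous_min.comp_continuousOn (h1.prodMk h2))
    exact Complex.equivRealProdCLM.symm.continuous.comp_continuousOn h3
  refine ⟨fun x => h (F x), ?_, ?_, ?_, ?_, ?_, ?_, ?_⟩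
  · exact hhc.comp hFc hF
  · rintro ⟨a, b⟩ ⟨ha, hb⟩ ⟨a', b'⟩ ⟨ha', hb'⟩ hab
    have h1 := congrArg g hab
    simp only at h1
    rw [(hh _ (hF (a, b) ⟨ha, hb⟩)).2, (hh _ (hF (a', b') ⟨ha', hb'⟩)).2] at h1
    have h2 : σ * (α a - β b) = σ * (α a' - β b') := congrArg Complex.re h1
    have h3 : min (α a) (β b) = min (α a') (β b') := congrArg Complex.im h1
    have h4 : α a - β b = α a' - β b' := by
      have := congrArg (σ * ·) h2
      simpa [← mul_assoc, hσ2] using this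
    have h5 : α a = α a' ∧ β b = β b' := by
      rcases le_total (α a) (β b) with h | h <;> rcases le_total (α a') (β b') with h' | h' <;>
        simp only [min_eq_left, min_eq_right, h, h'] at h3 <;> constructor <;> linarith
    exact Prod.ext (hαm.injOn ha ha' h5.1) (hβm.injOn hb hb' h5.2)
  · intro x hx
    exact (hh _ (hF x hx)).1.1
  · intro a ha
    rw [← hα a ha]
    congr 1
    apply Complex.ext
    · simp [F, hβ0]
    · simp [F, hβ0, hαpos a ha]
  · intro b hb
    rw [← hβ b hb]
    congr 1
    apply Complex.ext
    · simp [F, hα0]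
    · simp [F, hα0, hβpos b hb]
  · intro a b ha ha1 hb hb1 hmem
    rw [hhs _ (hF (a, b) ⟨⟨ha.le, ha1⟩, ⟨hb.le, hb1⟩⟩)] at hmem
    have h1 : 0 < α a := hα0 ▸ hαm h00 ⟨ha.le, ha1⟩ ha
    have h2 : 0 < β b := hβ0 ▸ hβm h00 ⟨hb.le, hb1⟩ hb
    have : 0 < min (α a) (β b) := lt_min h1 h2
    exact absurd hmem this.ne'
  · have hhalf : (1 / 2 : ℝ) ∈ Set.Icc (0 : ℝ) 1 := by constructor <;> norm_num
    have hα2 : 0 < α (1 / 2) := hα0 ▸ hαm h00 hhalf (by norm_num)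
    have hβ2 : 0 < β (1 / 2) := hβ0 ▸ hβm h00 hhalf (by norm_num)
    set ε := min (α (1 / 2)) (β (1 / 2)) with hε
    have hε0 : 0 < ε := lt_min hα2 hβ2
    have hopen : IsOpen {w : ℂ | |w.re| + |w.im| < ε} :=
      isOpen_lt (by fun_prop) continuous_const
    obtain ⟨W, hW, hWe⟩ := (continuousOn_iff'.mp hgc) _ hopen
    refine ⟨W \ {q}, hW.sdiff isClosed_singleton, ⟨?_, ?_⟩, ?_⟩
    · rw [hη.map_zero]
      have : p ∈ g ⁻¹' {w : ℂ | |w.re| + |w.im| < ε} ∩ (f \ {q}) :=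
        ⟨by simpa [hgp] using hε0, hpf⟩
      rw [hWe] at this
      exact this.1
    · rw [hη.map_zero]; exact hpf.2
    · rintro y ⟨⟨hyW, hyq⟩, hyf⟩
      have hy : y ∈ f \ {q} := ⟨hyf, hyq⟩
      have hsmall : y ∈ g ⁻¹' {w : ℂ | |w.re| + |w.im| < ε} ∩ (f \ {q}) := by
        rw [hWe]; exact ⟨hyW, hy⟩
      obtain ⟨hyi, hyh⟩ := hg y hy
      have hlt : |(g y).re| + |(g y).im| < ε := hsmall.1
      rw [abs_of_nonneg hyi] at hlt
      set s := (g y).im with hs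
      set t := σ * (g y).re with ht
      have htabs : |t| = |(g y).re| := by
        rw [ht, abs_mul]; rcases hσ with rfl | rfl <;> simp
      rw [← htabs] at hlt
      have hεα : ε ≤ α (1 / 2) := min_le_left _ _
      have hεβ : ε ≤ β (1 / 2) := min_le_right _ _
      obtain ⟨a, ha, hae⟩ := hαivt (1 / 2) hhalf (max t 0 + s) (by positivity) (by
        have : max t 0 ≤ |t| := max_le (le_abs_self t) (abs_nonneg t)
        linarith)
      obtain ⟨b, hb, hbe⟩ := hβivt (1 / 2) hhalf (max (-t) 0 + s) (by positivity) (by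
        have : max (-t) 0 ≤ |t| := max_le (neg_le_abs t) (abs_nonneg t)
        linarith)
      refine ⟨a, b, ha.1, hb.1, by linarith [ha.2, hb.2], ?_⟩
      refine Eq.trans ?_ hyh
      refine congrArg h ?_
      apply Complex.ext
      · simp only [F]
        rw [hae, hbe, add_sub_add_right_eq_sub]
        have : max t 0 - max (-t) 0 = t := by
          rcases le_total t 0 with h | h
          · rw [max_eq_right h, max_eq_left (by linarith)]; ring
          · rw [max_eq_left h, max_eq_right (by linarith)]; ring
        rw [this, ht, ← mul_assoc, hσ2, one_mul]
      · simp only [F]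
        rw [hae, hbe, ← min_add]
        have : min (max t 0) (max (-t) 0) = 0 := by
          rcases le_total t 0 with h | h
          · rw [max_eq_right h, min_eq_left (le_max_right _ _)]
          · rw [max_eq_right (by linarith : -t ≤ 0), min_eq_right (le_max_right _ _)]
        rw [this, zero_add]

end TwoComplex

/-! ### Gluing sectors around a point -/

/-- The point at distance `ρ` from the centre, in the `k`-th of `m` equal sectors of the unit disk,
at the fraction `τ` of the angle of that sector. -/
noncomputable def polarPoint (m k : ℕ) (ρ τ : ℝ) : ℂ :=
  ρ * Complex.exp ((2 * Real.pi * (k + τ) / m : ℝ) * Complex.I)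

theorem norm_polarPoint (m k : ℕ) {ρ : ℝ} (hρ : 0 ≤ ρ) (τ : ℝ) : ‖polarPoint m k ρ τ‖ = ρ := by
  rw [polarPoint, norm_mul, Complex.norm_exp_ofReal_mul_I, mul_one, Complex.norm_real,
    Real.norm_of_nonneg hρ]

/-- The coordinates `(k, ρ, τ)` and `(l, ρ', τ')` stand for the same point of the disk. -/
def SamePolarPoint (m k : ℕ) (ρ τ : ℝ) (l : ℕ) (ρ' τ' : ℝ) : Prop :=
  ρ = ρ' ∧ (ρ = 0 ∨ (k = l ∧ τ = τ') ∨ (τ = 1 ∧ τ' = 0 ∧ l = (k + 1) % m) ∨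
    (τ = 0 ∧ τ' = 1 ∧ k = (l + 1) % m))

theorem polarPoint_succ (m k : ℕ) (hm : 0 < m) (ρ : ℝ) :
    polarPoint m k ρ 1 = polarPoint m ((k + 1) % m) ρ 0 := by
  have hm' : (m : ℂ) ≠ 0 := by exact_mod_cast hm.ne'
  unfold polarPoint
  congr 1
  rw [Complex.exp_eq_exp_iff_exists_int]
  have h := Nat.div_add_mod (k + 1) m
  generalize (k + 1) / m = q at h
  have h' : (m * q + ((k + 1) % m : ℕ) : ℂ) = k + 1 := by exact_mod_cast h
  refine ⟨q, ?_⟩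
  push_cast at h' ⊢
  field_simp
  linear_combination -h'

theorem samePolarPoint_of_exp_eq {m k l : ℕ} {ρ τ τ' : ℝ} (hk : k < m) (hl : l < m)
    (hτ : τ ∈ Set.Icc (0 : ℝ) 1) (hτ' : τ' ∈ Set.Icc (0 : ℝ) 1)
    (h : Complex.exp ((2 * Real.pi * (k + τ) / m : ℝ) * Complex.I) =
      Complex.exp ((2 * Real.pi * (l + τ') / m : ℝ) * Complex.I)) :
    SamePolarPoint m k ρ τ l ρ τ' := by
  have hm : (0 : ℝ) < m := by exact_mod_cast (Nat.zero_le k).trans_lt hk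
  rw [Complex.exp_eq_exp_iff_exists_int] at h
  obtain ⟨j, hj⟩ := h
  have hj1 : (k : ℝ) + τ = l + τ' + j * m := by
    have h1 : ((2 * Real.pi * (k + τ) / m : ℝ) : ℂ) * Complex.I =
        ((2 * Real.pi * (l + τ') / m + j * (2 * Real.pi) : ℝ) : ℂ) * Complex.I := by
      rw [hj]; push_cast; ring
    have h2 := mul_right_cancel₀ Complex.I_ne_zero h1
    have h3 : 2 * Real.pi * (k + τ) / m = 2 * Real.pi * (l + τ') / m + j * (2 * Real.pi) := by
      exact_mod_cast h2
    field_simp at h3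
    linear_combination h3
  -- the difference of the fractional coordinates is an integer between `-1` and `1`
  have hz : τ - τ' = ((l + j * m - k : ℤ) : ℝ) := by push_cast; linarith
  have hz1 : (l + j * m - k : ℤ) ≤ 1 := by
    have : ((l + j * m - k : ℤ) : ℝ) ≤ 1 := by rw [← hz]; linarith [hτ.2, hτ'.1]
    exact_mod_cast this
  have hz2 : -1 ≤ (l + j * m - k : ℤ) := by
    have : ((-1 : ℤ) : ℝ) ≤ ((l + j * m - k : ℤ) : ℝ) := by
      rw [← hz]; push_cast; linarith [hτ.1, hτ'.2]
    exact_mod_cast this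
  refine ⟨rfl, Or.inr ?_⟩
  have hcases : (l + j * m - k : ℤ) = 0 ∨ (l + j * m - k : ℤ) = 1 ∨ (l + j * m - k : ℤ) = -1 := by
    omega
  have hmod : ∀ (a b : ℕ) (i : ℤ), b < m → (a : ℤ) = b + i * m → a % m = b := by
    intro a b i hb hab
    have h1 : ((a % m : ℕ) : ℤ) = ((b % m : ℕ) : ℤ) := by
      push_cast; rw [hab, Int.add_mul_emod_self_right]
    rw [Nat.mod_eq_of_lt hb] at h1
    exact_mod_cast h1
  rcases hcases with h0 | h0 | h0 <;> rw [h0] at hz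
  · left
    refine ⟨?_, by push_cast at hz; linarith⟩
    have := hmod k l j hl (by linarith)
    rwa [Nat.mod_eq_of_lt hk] at this
  · right; left
    push_cast at hz
    refine ⟨by linarith [hτ.2, hτ'.1], by linarith [hτ.2, hτ'.1], ?_⟩
    exact (hmod (k + 1) l j hl (by push_cast; linarith)).symm
  · right; right
    push_cast at hz
    refine ⟨by linarith [hτ.1, hτ'.2], by linarith [hτ.1, hτ'.2], ?_⟩
    exact (hmod (l + 1) k (-j) hk (by push_cast; linarith)).symm

theorem polarPoint_eq_iff {m k l : ℕ} {ρ τ ρ' τ' : ℝ} (hk : k < m) (hl : l < m)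
    (hρ : 0 ≤ ρ) (hρ' : 0 ≤ ρ') (hτ : τ ∈ Set.Icc (0 : ℝ) 1) (hτ' : τ' ∈ Set.Icc (0 : ℝ) 1) :
    polarPoint m k ρ τ = polarPoint m l ρ' τ' ↔ SamePolarPoint m k ρ τ l ρ' τ' := by
  have hm : 0 < m := (Nat.zero_le k).trans_lt hk
  constructor
  · intro h
    have hn := congrArg norm h
    rw [norm_polarPoint _ _ hρ, norm_polarPoint _ _ hρ'] at hn
    subst hn
    rcases hρ.eq_or_lt with h0 | h0
    · exact ⟨rfl, Or.inl h0.symm⟩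
    · have hρ0 : (ρ : ℂ) ≠ 0 := by exact_mod_cast h0.ne'
      exact samePolarPoint_of_exp_eq hk hl hτ hτ' (mul_left_cancel₀ hρ0 h)
  · rintro ⟨rfl, rfl | ⟨rfl, rfl⟩ | ⟨rfl, rfl, rfl⟩ | ⟨rfl, rfl, rfl⟩⟩
    · simp [polarPoint]
    · rfl
    · exact polarPoint_succ m k hm ρ
    · exact (polarPoint_succ m l hm ρ).symm

theorem exists_polarPoint_eq {m : ℕ} (hm : 0 < m) (z : ℂ) :
    ∃ k < m, ∃ τ ∈ Set.Icc (0 : ℝ) 1, polarPoint m k ‖z‖ τ = z := by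
  have hmr : (0 : ℝ) < m := by exact_mod_cast hm
  have hpi := Real.pi_pos
  obtain ⟨θ, hθ, hθ', hz⟩ : ∃ θ : ℝ, 0 ≤ θ ∧ θ ≤ 2 * Real.pi ∧
      (‖z‖ : ℂ) * Complex.exp (θ * Complex.I) = z := by
    rcases le_or_gt 0 z.arg with h | h
    · exact ⟨z.arg, h, by linarith [Complex.arg_le_pi z], Complex.norm_mul_exp_arg_mul_I z⟩
    · refine ⟨z.arg + 2 * Real.pi, by linarith [Complex.neg_pi_lt_arg z], by linarith, ?_⟩
      push_cast
      rw [add_mul, Complex.exp_periodic (z.arg * Complex.I), Complex.norm_mul_exp_arg_mul_I]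
  set t := m * θ / (2 * Real.pi) with ht
  have ht0 : 0 ≤ t := by positivity
  have htm : t ≤ m := by
    rw [ht, div_le_iff₀ (by positivity)]
    exact mul_le_mul_of_nonneg_left hθ' hmr.le
  have hfin : ∀ (k : ℕ) (τ : ℝ), (k : ℝ) + τ = t → polarPoint m k ‖z‖ τ = z := by
    intro k τ h
    rw [polarPoint, h]
    have : 2 * Real.pi * t / m = θ := by rw [ht]; field_simp
    rw [this, hz]
  rcases htm.eq_or_lt with h | h
  · refine ⟨m - 1, by omega, 1, ⟨zero_le_one, le_rfl⟩, hfin _ _ ?_⟩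
    rw [h, Nat.cast_sub hm]; push_cast; ring
  · refine ⟨⌊t⌋₊, (Nat.floor_lt ht0).mpr h, t - ⌊t⌋₊, ⟨?_, ?_⟩, hfin _ _ (by ring)⟩
    · linarith [Nat.floor_le ht0]
    · linarith [Nat.lt_floor_add_one t]

namespace TwoComplex

variable {X : Type u} [TopologicalSpace X] [T2Space X] {K : TwoComplex X}

/-- The faces `F k` are arranged cyclically around the point `p`, with period `m`: the half-edges
`η k` and `η (k + 1)` bound a sector of `F k`, parametrized by `ψ k`. -/
structure IsStar (K : TwoComplex X) (p : X) (m : ℕ) (F : ℕ → Set X) (η : ℕ → ℝ → X)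
    (ψ : ℕ → ℝ × ℝ → X) : Prop where
  pos : 0 < m
  face_mem : ∀ k, F k ∈ K.faces
  face_inj : ∀ k < m, ∀ l < m, F k = F l → k = l
  halfEdge : ∀ k, K.IsHalfEdge p (η k)
  halfEdge_periodic : ∀ k, η (k % m) = η k
  halfEdge_inj : ∀ k < m, ∀ l < m, ∀ a ∈ Set.Icc (0 : ℝ) 1, ∀ b ∈ Set.Icc (0 : ℝ) 1,
    η k a = η l b → a = b ∧ (a = 0 ∨ k = l)
  sector : ∀ k, K.IsSector (F k) (η k) (η (k + 1)) (ψ k)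

theorem polar_mem_square {ρ τ : ℝ} (hρ : ρ ∈ Set.Icc (0 : ℝ) 1) (hτ : τ ∈ Set.Icc (0 : ℝ) 1) :
    ((ρ * (1 - τ), ρ * τ) : ℝ × ℝ) ∈ Set.Icc (0 : ℝ) 1 ×ˢ Set.Icc (0 : ℝ) 1 :=
  ⟨⟨mul_nonneg hρ.1 (by linarith [hτ.2]),
    mul_le_one₀ hρ.2 (by linarith [hτ.2]) (by linarith [hτ.1])⟩,
    ⟨mul_nonneg hρ.1 hτ.1, mul_le_one₀ hρ.2 hτ.1 hτ.2⟩⟩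

namespace IsStar

variable {p : X} {m : ℕ} {F : ℕ → Set X} {η : ℕ → ℝ → X} {ψ : ℕ → ℝ × ℝ → X}

theorem apply_of_boundary (h : K.IsStar p m F η ψ) {k : ℕ} (hk : k < m) {ρ τ : ℝ}
    (hρ : ρ ∈ Set.Icc (0 : ℝ) 1) (hτ : ρ = 0 ∨ τ = 0 ∨ τ = 1) :
    ∃ i < m, ψ k (ρ * (1 - τ), ρ * τ) = η i ρ ∧
      (ρ = 0 ∨ (τ = 0 ∧ i = k) ∨ (τ = 1 ∧ i = (k + 1) % m)) := by
  rcases hτ with rfl | rfl | rfl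
  · refine ⟨k, hk, ?_, Or.inl rfl⟩
    rw [zero_mul, zero_mul]; exact (h.sector k).left 0 hρ
  · refine ⟨k, hk, ?_, Or.inr (Or.inl ⟨rfl, rfl⟩)⟩
    rw [sub_zero, mul_one, mul_zero]; exact (h.sector k).left ρ hρ
  · refine ⟨(k + 1) % m, Nat.mod_lt _ h.pos, ?_, Or.inr (Or.inr ⟨rfl, rfl⟩)⟩
    rw [sub_self, mul_zero, mul_one, h.halfEdge_periodic]; exact (h.sector k).right ρ hρ

theorem apply_notMem_skeleton (h : K.IsStar p m F η ψ) (k : ℕ) {ρ τ : ℝ}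
    (hρ : ρ ∈ Set.Icc (0 : ℝ) 1) (hτ : τ ∈ Set.Icc (0 : ℝ) 1)
    (hne : ¬(ρ = 0 ∨ τ = 0 ∨ τ = 1)) : ψ k (ρ * (1 - τ), ρ * τ) ∉ K.skeleton := by
  push Not at hne
  have h1 : 0 < ρ := lt_of_le_of_ne hρ.1 hne.1.symm
  have h2 : 0 < τ := lt_of_le_of_ne hτ.1 hne.2.1.symm
  have h3 : τ < 1 := lt_of_le_of_ne hτ.2 hne.2.2
  have h4 := polar_mem_square hρ hτ
  exact (h.sector k).interior _ _ (mul_pos h1 (by linarith)) h4.1.2 (mul_pos h1 h2) h4.2.2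

/-- Two points of the sectors have the same image only if their polar coordinates stand for the same
point: away from the half-edges because the faces have disjoint interiors, on them because the
half-edges meet in the centre only. -/
theorem apply_eq_iff (h : K.IsStar p m F η ψ) {k l : ℕ} (hk : k < m) (hl : l < m)
    {ρ τ ρ' τ' : ℝ} (hρ : ρ ∈ Set.Icc (0 : ℝ) 1) (hρ' : ρ' ∈ Set.Icc (0 : ℝ) 1)
    (hτ : τ ∈ Set.Icc (0 : ℝ) 1) (hτ' : τ' ∈ Set.Icc (0 : ℝ) 1) :
    ψ k (ρ * (1 - τ), ρ * τ) = ψ l (ρ' * (1 - τ'), ρ' * τ') ↔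
      SamePolarPoint m k ρ τ l ρ' τ' := by
  have hskel : ∀ {k : ℕ}, k < m → ∀ {ρ τ : ℝ}, ρ ∈ Set.Icc (0 : ℝ) 1 →
      (ρ = 0 ∨ τ = 0 ∨ τ = 1) → ψ k (ρ * (1 - τ), ρ * τ) ∈ K.skeleton := by
    intro k hk ρ τ hρ hτ
    obtain ⟨i, -, hi, -⟩ := h.apply_of_boundary hk hρ hτ
    rw [hi]; exact (h.halfEdge i).mem_skeleton ρ hρ
  constructor
  · intro heq
    by_cases hb : ρ = 0 ∨ τ = 0 ∨ τ = 1
    · have hb' : ρ' = 0 ∨ τ' = 0 ∨ τ' = 1 := by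
        by_contra hb'
        exact h.apply_notMem_skeleton l hρ' hτ' hb' (heq ▸ hskel hk hρ hb)
      obtain ⟨i, him, hi, hi'⟩ := h.apply_of_boundary hk hρ hb
      obtain ⟨j, hjm, hj, hj'⟩ := h.apply_of_boundary hl hρ' hb'
      rw [hi, hj] at heq
      obtain ⟨hρρ, h0⟩ := h.halfEdge_inj i him j hjm ρ hρ ρ' hρ' heq
      refine ⟨hρρ, ?_⟩
      rcases h0 with h0 | h0
      · exact Or.inl h0
      subst hρρ h0
      rcases hi' with hi' | ⟨rfl, rfl⟩ | ⟨rfl, rfl⟩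
      · exact Or.inl hi'
      · rcases hj' with hj' | ⟨rfl, rfl⟩ | ⟨rfl, hj'⟩
        · exact Or.inl hj'
        · exact Or.inr (Or.inl ⟨rfl, rfl⟩)
        · exact Or.inr (Or.inr (Or.inr ⟨rfl, rfl, hj'⟩))
      · rcases hj' with hj' | ⟨rfl, hj'⟩ | ⟨rfl, hj'⟩
        · exact Or.inl hj'
        · exact Or.inr (Or.inr (Or.inl ⟨rfl, rfl, hj'.symm⟩))
        · refine Or.inr (Or.inl ⟨?_, rfl⟩)
          have : k ≡ l [MOD m] := Nat.ModEq.add_right_cancel' 1 hj'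
          rwa [Nat.ModEq, Nat.mod_eq_of_lt hk, Nat.mod_eq_of_lt hl] at this
    · have hns := h.apply_notMem_skeleton k hρ hτ hb
      have hb' : ¬(ρ' = 0 ∨ τ' = 0 ∨ τ' = 1) := fun hb' => hns (heq ▸ hskel hl hρ' hb')
      have hkl : k = l := h.face_inj k hk l hl
        (face_eq_of_mem (h.face_mem k) (h.face_mem l)
          ((h.sector k).mapsTo (polar_mem_square hρ hτ))
          (heq ▸ (h.sector l).mapsTo (polar_mem_square hρ' hτ')) hns)
      subst hkl
      have h1 := (h.sector k).injOn (polar_mem_square hρ hτ) (polar_mem_square hρ' hτ') heq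
      rw [Prod.mk.injEq] at h1
      have h2 : ρ = ρ' := by linarith [h1.1, h1.2]
      subst h2
      exact ⟨rfl, Or.inr (Or.inl ⟨rfl, mul_left_cancel₀ (fun h0 => hb (Or.inl h0)) h1.2⟩)⟩
  · have hone : ∀ k, ψ k (ρ * (1 - 1), ρ * 1) = η (k + 1) ρ := fun k => by
      rw [sub_self, mul_zero, mul_one]; exact (h.sector k).right ρ hρ
    have hzero : ∀ k, ψ k (ρ * (1 - 0), ρ * 0) = η k ρ := fun k => by
      rw [sub_zero, mul_one, mul_zero]; exact (h.sector k).left ρ hρ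
    rintro ⟨rfl, rfl | ⟨rfl, rfl⟩ | ⟨rfl, rfl, rfl⟩ | ⟨rfl, rfl, rfl⟩⟩
    · simp only [zero_mul]
      rw [(h.sector k).left 0 hρ, (h.sector l).left 0 hρ, (h.halfEdge k).map_zero,
        (h.halfEdge l).map_zero]
    · rfl
    · rw [hone, hzero, h.halfEdge_periodic]
    · rw [hone, hzero, h.halfEdge_periodic]

/-- The sectors of a star form a disk: the map of the polar coordinates to the disk and the map to
the complex given by the sectors identify the same coordinates, so the latter descends to the disk,
which is compact and therefore has the quotient topology. -/
theorem exists_disk (h : K.IsStar p m F η ψ) :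
    ∃ Ψ : ℂ → X, ContinuousOn Ψ (Metric.closedBall 0 1) ∧
      Set.InjOn Ψ (Metric.closedBall 0 1) ∧
      ∀ k < m, ∀ ρ ∈ Set.Icc (0 : ℝ) 1, ∀ τ ∈ Set.Icc (0 : ℝ) 1,
        Ψ (polarPoint m k ρ τ) = ψ k (ρ * (1 - τ), ρ * τ) := by
  classical
  let T := Fin m × (Set.Icc (0 : ℝ) 1 × Set.Icc (0 : ℝ) 1)
  let κ : T → Metric.closedBall (0 : ℂ) 1 := fun t =>
    ⟨polarPoint m t.1 t.2.1 t.2.2, mem_closedBall_zero_iff.mpr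
      ((norm_polarPoint _ _ t.2.1.2.1 _).trans_le t.2.1.2.2)⟩
  let P : T → X := fun t => ψ t.1 ((t.2.1 : ℝ) * (1 - t.2.2), (t.2.1 : ℝ) * t.2.2)
  have hκ : Continuous κ := by
    refine Continuous.subtype_mk (continuous_prod_of_discrete_left.mpr fun k => ?_) _
    unfold polarPoint
    fun_prop
  have hP : Continuous P := by
    refine continuous_prod_of_discrete_left.mpr fun k => ?_
    exact (h.sector k).continuousOn.comp_continuous (by fun_prop)
      fun x => polar_mem_square x.1.2 x.2.2
  have hsurj : Function.Surjective κ := by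
    rintro ⟨z, hz⟩
    rw [mem_closedBall_zero_iff] at hz
    obtain ⟨k, hk, τ, hτ, he⟩ := exists_polarPoint_eq h.pos z
    exact ⟨(⟨k, hk⟩, ⟨‖z‖, norm_nonneg _, hz⟩, ⟨τ, hτ⟩), Subtype.ext he⟩
  have hfib : ∀ s t : T, κ s = κ t ↔ P s = P t := fun s t => by
    rw [Subtype.ext_iff]
    exact (polarPoint_eq_iff s.1.2 t.1.2 s.2.1.2.1 t.2.1.2.1 s.2.2.2 t.2.2.2).trans
      (h.apply_eq_iff s.1.2 t.1.2 s.2.1.2 t.2.1.2 s.2.2.2 t.2.2.2).symm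
  have hquot : IsQuotientMap κ := hκ.isClosedMap.isQuotientMap hκ hsurj
  let inv : Metric.closedBall (0 : ℂ) 1 → T := Function.surjInv hsurj
  have hinv : ∀ z, κ (inv z) = z := Function.surjInv_eq hsurj
  let Q : Metric.closedBall (0 : ℂ) 1 → X := fun z => P (inv z)
  have hQκ : Q ∘ κ = P := by
    funext t
    exact (hfib _ _).mp (hinv (κ t))
  have hQ : Continuous Q := hquot.continuous_iff.mpr (hQκ ▸ hP)
  let Ψ : ℂ → X := fun z => if hz : z ∈ Metric.closedBall (0 : ℂ) 1 then Q ⟨z, hz⟩ else p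
  have hΨ : ∀ z (hz : z ∈ Metric.closedBall (0 : ℂ) 1), Ψ z = Q ⟨z, hz⟩ := fun z hz => dif_pos hz
  refine ⟨Ψ, ?_, ?_, ?_⟩
  · rw [continuousOn_iff_continuous_domRestrict]
    have : Set.domRestrict (Metric.closedBall (0 : ℂ) 1) Ψ = Q := funext fun z => hΨ z z.2
    rw [this]; exact hQ
  · intro z hz w hw hzw
    rw [hΨ z hz, hΨ w hw] at hzw
    have := (hfib _ _).mpr hzw
    rw [hinv, hinv] at this
    exact congrArg Subtype.val this
  · intro k hk ρ hρ τ hτ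
    have : Ψ (κ (⟨k, hk⟩, ⟨ρ, hρ⟩, ⟨τ, hτ⟩)) = P (⟨k, hk⟩, ⟨ρ, hρ⟩, ⟨τ, hτ⟩) := by
      rw [hΨ _ (Subtype.coe_prop _)]
      exact congrFun hQκ _
    exact this

end IsStar

/-- An injective image of the disk that covers a neighbourhood of a point of the complex gives a
neighbourhood that is an open disk. -/
theorem exists_open_disk {Ψ : ℂ → X} (hc : ContinuousOn Ψ (Metric.closedBall 0 1))
    (hi : Set.InjOn Ψ (Metric.closedBall 0 1))
    (hm : Set.MapsTo Ψ (Metric.closedBall 0 1) K.space) {x : K.space} (hx : Ψ 0 = x) {W : Set X}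
    (hW : IsOpen W) (hxW : (x : X) ∈ W) (hcov : W ∩ K.space ⊆ Ψ '' Metric.closedBall 0 1) :
    ∃ U : Set K.space, IsOpen U ∧ x ∈ U ∧ Nonempty (U ≃ₜ Metric.ball (0 : ℂ) 1) := by
  have h0 : (0 : ℂ) ∈ Metric.closedBall (0 : ℂ) 1 := by simp
  obtain ⟨r, hr, hr1, hrW⟩ : ∃ r : ℝ, 0 < r ∧ r ≤ 1 ∧ ∀ z : ℂ, ‖z‖ < r → Ψ z ∈ W := by
    have h1 : Ψ ⁻¹' W ∈ 𝓝[Metric.closedBall 0 1] (0 : ℂ) :=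
      hc 0 h0 (hW.mem_nhds (hx ▸ hxW))
    rw [nhdsWithin_eq_nhds.mpr (Metric.closedBall_mem_nhds 0 one_pos),
      Metric.mem_nhds_iff] at h1
    obtain ⟨ε, hε, hεW⟩ := h1
    refine ⟨min ε 1, by positivity, min_le_right _ _, fun z hz => hεW ?_⟩
    rw [mem_ball_zero_iff]
    exact hz.trans_le (min_le_left _ _)
  have hball : ∀ z : ℂ, ‖z‖ < r → z ∈ Metric.closedBall (0 : ℂ) 1 := fun z hz => by
    rw [mem_closedBall_zero_iff]; linarith
  set C := Ψ '' (Metric.closedBall 0 1 \ Metric.ball 0 r) with hC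
  have hCc : IsClosed C :=
    (((isCompact_closedBall (0 : ℂ) 1).diff Metric.isOpen_ball).image_of_continuousOn
    (hc.mono Set.sdiff_subset)).isClosed
  let U : Set K.space := {y | (y : X) ∈ W \ C}
  have hUmem : ∀ z : ℂ, ‖z‖ < r → Ψ z ∈ W \ C := fun z hz => by
    refine ⟨hrW z hz, ?_⟩
    rintro ⟨w, ⟨hw, hwr⟩, hwz⟩
    rw [hi hw (hball z hz) hwz, mem_ball_zero_iff] at hwr
    exact hwr hz
  refine ⟨U, (hW.sdiff hCc).preimage continuous_subtype_val, ?_, ⟨Homeomorph.symm ?_⟩⟩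
  · have := hUmem 0 (by rwa [norm_zero])
    rw [hx] at this
    exact this
  · have hscale : ∀ z : Metric.ball (0 : ℂ) 1, ‖(r : ℂ) * z‖ < r := fun z => by
      have := mem_ball_zero_iff.mp z.2
      rw [norm_mul, Complex.norm_real, Real.norm_of_nonneg hr.le]
      nlinarith
    let e : Metric.ball (0 : ℂ) 1 → U := fun z =>
      ⟨⟨Ψ (r * z), hm (hball _ (hscale z))⟩, hUmem _ (hscale z)⟩
    have hrc : (r : ℂ) ≠ 0 := by exact_mod_cast hr.ne'
    have hsc : IsEmbedding fun z : Metric.ball (0 : ℂ) 1 =>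
        (⟨(r : ℂ) * z, hball _ (hscale z)⟩ : Metric.closedBall (0 : ℂ) 1) := by
      apply IsEmbedding.of_comp (by fun_prop) continuous_subtype_val
      exact (Homeomorph.mulLeft₀ (r : ℂ) hrc).isEmbedding.comp IsEmbedding.subtypeVal
    have hemb : IsEmbedding fun z : Metric.closedBall (0 : ℂ) 1 => Ψ z :=
      (Continuous.isClosedEmbedding (continuousOn_iff_continuous_domRestrict.mp hc)
        (fun z w hzw => Subtype.ext (hi z.2 w.2 hzw))).isEmbedding
    have hcomp : IsEmbedding fun z : Metric.ball (0 : ℂ) 1 => (((e z : K.space)) : X) :=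
      hemb.comp hsc
    have hec : Continuous e := Continuous.subtype_mk (Continuous.subtype_mk hcomp.continuous _) _
    have he : IsEmbedding e := IsEmbedding.of_comp hec
      (continuous_subtype_val.comp continuous_subtype_val) hcomp
    refine he.toHomeomorphOfSurjective ?_
    rintro ⟨⟨y, hyK⟩, hyW, hyC⟩
    obtain ⟨z, hz, rfl⟩ := hcov ⟨hyW, hyK⟩
    have hzr : ‖z‖ < r := by
      by_contra hzr
      exact hyC ⟨z, ⟨hz, by rwa [mem_ball_zero_iff]⟩, rfl⟩
    refine ⟨⟨z / r, ?_⟩, ?_⟩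
    · rw [mem_ball_zero_iff, norm_div, Complex.norm_real, Real.norm_of_nonneg hr.le,
        div_lt_one hr]
      exact hzr
    · apply Subtype.ext; apply Subtype.ext
      simp only [e]
      rw [mul_div_cancel₀ _ hrc]

theorem face_subset_space {f : Set X} (hf : f ∈ K.faces) : f ⊆ K.space :=
  fun _ hx => Or.inr ⟨f, hf, hx⟩

/-- The centre of a star that contains all of the complex near that point has an open disk as a
neighbourhood. -/
theorem IsStar.exists_open_disk {p : X} {m : ℕ} {F : ℕ → Set X} {η : ℕ → ℝ → X}
    {ψ : ℕ → ℝ × ℝ → X} (h : K.IsStar p m F η ψ) {W : Set X} (hW : IsOpen W) (hpW : p ∈ W)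
    (hcov : W ∩ K.space ⊆ ⋃ k < m, F k) {x : K.space} (hx : p = x) :
    ∃ U : Set K.space, IsOpen U ∧ x ∈ U ∧ Nonempty (U ≃ₜ Metric.ball (0 : ℂ) 1) := by
  obtain ⟨Ψ, hc, hi, hΨ⟩ := h.exists_disk
  choose V hV hpV hVF using fun k => (h.sector k).nhds
  have h01 : (0 : ℝ) ∈ Set.Icc (0 : ℝ) 1 := ⟨le_rfl, zero_le_one⟩
  refine TwoComplex.exists_open_disk hc hi ?_ (x := x) ?_
    (W := W ∩ ⋂ k ∈ Finset.range m, V k) ?_ ?_ ?_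
  · intro z hz
    rw [mem_closedBall_zero_iff] at hz
    obtain ⟨k, hk, τ, hτ, he⟩ := exists_polarPoint_eq h.pos z
    rw [← he, hΨ k hk _ ⟨norm_nonneg _, hz⟩ τ hτ]
    exact face_subset_space (h.face_mem k)
      ((h.sector k).mapsTo (polar_mem_square ⟨norm_nonneg _, hz⟩ hτ))
  · have := hΨ 0 h.pos 0 h01 0 h01
    rw [zero_mul, zero_mul, (h.sector 0).left 0 h01, (h.halfEdge 0).map_zero, hx] at this
    rw [← this]; simp [polarPoint]
  · exact hW.inter (isOpen_biInter_finset fun k _ => hV k)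
  · refine ⟨hx ▸ hpW, Set.mem_iInter₂.mpr fun k _ => ?_⟩
    have := hpV k
    rwa [(h.halfEdge k).map_zero, hx] at this
  · rintro y ⟨⟨hyW, hyV⟩, hyK⟩
    obtain ⟨k, hk, hyF⟩ : ∃ k < m, y ∈ F k := by simpa using hcov ⟨hyW, hyK⟩
    obtain ⟨a, b, ha, hb, hab, he⟩ := hVF k y
      ⟨Set.mem_iInter₂.mp hyV k (Finset.mem_range.mpr hk), hyF⟩
    rcases (add_nonneg ha hb).eq_or_lt with h0 | h0
    · have ha0 : a = 0 := by linarith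
      have hb0 : b = 0 := by linarith
      refine ⟨polarPoint m k 0 0, by simp [polarPoint], ?_⟩
      rw [hΨ k hk 0 h01 0 h01, ← he, ha0, hb0]
      simp
    · refine ⟨polarPoint m k (a + b) (b / (a + b)), ?_, ?_⟩
      · rw [mem_closedBall_zero_iff, norm_polarPoint _ _ h0.le]; exact hab
      · rw [hΨ k hk (a + b) ⟨h0.le, hab⟩ _
          ⟨by positivity, (div_le_one h0).mpr (by linarith)⟩, ← he]
        congr 2
        · field_simp; ring
        · field_simp

end TwoComplex

/-! ### The winding number of an injective map of the disk is odd -/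

theorem eq_of_exp_eq_const {D : ℝ → ℂ} {S : Set ℝ} (hS : IsPreconnected S) (hD : ContinuousOn D S)
    {w : ℂ} (hw : ∀ s ∈ S, Complex.exp (D s) = w) {s t : ℝ} (hs : s ∈ S) (ht : t ∈ S) :
    D s = D t := by
  refine (Complex.isCoveringMap_exp.eqOn_of_comp_eqOn hS hD continuousOn_const (fun r hr => ?_)
    ht rfl : Set.EqOn D (fun _ => D t) S) hs
  exact Subtype.ext ((hw r hr).trans (hw t ht).symm)

/-- A map of the plane that has no zeros has a continuous logarithm. -/
theorem exists_continuous_log {F : ℝ × ℝ → ℂ} (hF : Continuous F) (h0 : ∀ x, F x ≠ 0) :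
    ∃ Λ : ℝ × ℝ → ℂ, Continuous Λ ∧ ∀ x, Complex.exp (Λ x) = F x := by
  obtain ⟨Λ, hΛ, he⟩ := Complex.exists_continuousOn_eqOn_exp_comp (U := Set.univ)
    ((Homeomorph.Set.univ (ℝ × ℝ)).toHomotopyEquiv.simplyConnectedSpace_iff.mpr inferInstance)
    isOpen_univ hF.continuousOn
    (by rintro ⟨x, -, hx⟩; exact h0 x hx)
  exact ⟨Λ, continuousOn_univ.mp hΛ, fun x => he (Set.mem_univ x)⟩

/-- The winding number around `f 0` of the boundary circle of an injectively mapped disk is odd.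
The loop `f z - f 0` is homotopic to the odd loop `f z - f (-z)` through the loops
`f z - f (-t z)`, which avoid `0` because `f` is injective. -/
theorem exists_odd_winding {f : ℂ → ℂ} (hc : ContinuousOn f (Metric.closedBall 0 1))
    (hi : Set.InjOn f (Metric.closedBall 0 1)) {L : ℝ → ℂ} (hL : ContinuousOn L (Set.Icc 0 1))
    (hexp : ∀ θ ∈ Set.Icc (0 : ℝ) 1,
      Complex.exp (L θ) = f (Complex.exp ((2 * Real.pi * θ : ℝ) * Complex.I)) - f 0) :
    ∃ n : ℤ, L 1 - L 0 = (2 * n + 1) * (2 * Real.pi * Complex.I) := by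
  let c : ℝ → ℂ := fun θ => Complex.exp ((2 * Real.pi * θ : ℝ) * Complex.I)
  have hcc : Continuous c := by fun_prop
  have hcn : ∀ θ, ‖c θ‖ = 1 := fun θ => Complex.norm_exp_ofReal_mul_I _
  let π₁ : ℝ → ℝ := fun t => max 0 (min t 1)
  have hπc : Continuous π₁ := by fun_prop
  have hπ0 : ∀ t, 0 ≤ π₁ t := fun t => le_max_left _ _
  have hπ1 : ∀ t, π₁ t ≤ 1 := fun t => max_le zero_le_one (min_le_right _ _)
  have hmem : ∀ θ, c θ ∈ Metric.closedBall (0 : ℂ) 1 := fun θ => by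
    rw [mem_closedBall_zero_iff, hcn]
  have hmem' : ∀ t θ, -(π₁ t : ℂ) * c θ ∈ Metric.closedBall (0 : ℂ) 1 := fun t θ => by
    rw [mem_closedBall_zero_iff, norm_mul, norm_neg, hcn, mul_one, Complex.norm_real,
      Real.norm_of_nonneg (hπ0 t)]
    exact hπ1 t
  let F : ℝ × ℝ → ℂ := fun x => f (c x.2) - f (-(π₁ x.1 : ℂ) * c x.2)
  have hF : Continuous F := by
    refine Continuous.sub (hc.comp_continuous (by fun_prop) fun x => hmem _) ?_
    exact hc.comp_continuous (by fun_prop) fun x => hmem' _ _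
  have hF0 : ∀ x, F x ≠ 0 := by
    rintro ⟨t, θ⟩ h
    have h1 := hi (hmem θ) (hmem' t θ) (sub_eq_zero.mp h)
    have hc0 : c θ ≠ 0 := Complex.exp_ne_zero _
    have h2 : (1 : ℂ) = -(π₁ t : ℂ) := mul_right_cancel₀ hc0 (by rw [one_mul]; exact h1)
    have h3 : (1 : ℝ) = -π₁ t := by exact_mod_cast h2
    linarith [hπ0 t]
  obtain ⟨Λ, hΛ, he⟩ := exists_continuous_log hF hF0
  have hπ00 : π₁ 0 = 0 := by simp [π₁]
  have hπ11 : π₁ 1 = 1 := by simp [π₁]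
  have hc01 : c 1 = c 0 := by
    simp only [c]
    rw [Complex.exp_eq_exp_iff_exists_int]
    exact ⟨1, by push_cast; ring⟩
  have hchalf : ∀ θ, c (θ + 1 / 2) = -c θ := fun θ => by
    simp only [c]
    rw [show ((2 * Real.pi * (θ + 1 / 2) : ℝ) : ℂ) * Complex.I =
      (2 * Real.pi * θ : ℝ) * Complex.I + Real.pi * Complex.I by push_cast; ring,
      Complex.exp_add, Complex.exp_pi_mul_I, mul_neg_one]
  have h0 : (0 : ℝ) ∈ Set.Icc (0 : ℝ) 1 := ⟨le_rfl, zero_le_one⟩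
  have h1 : (1 : ℝ) ∈ Set.Icc (0 : ℝ) 1 := ⟨zero_le_one, le_rfl⟩
  have e1 : Λ (0, 1) - L 1 = Λ (0, 0) - L 0 := by
    refine eq_of_exp_eq_const (D := fun θ => Λ (0, θ) - L θ) isPreconnected_Icc
      (((hΛ.comp (by fun_prop : Continuous fun θ : ℝ => ((0 : ℝ), θ))).continuousOn).sub hL)
      (w := 1) (fun θ hθ => ?_) h1 h0
    rw [Complex.exp_sub, he, hexp θ hθ]
    have : F (0, θ) = f (c θ) - f 0 := by simp [F, hπ00]
    rw [this]
    exact div_self (this ▸ hF0 (0, θ))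
  have e2 : Λ (0, 1) - Λ (0, 0) = Λ (1, 1) - Λ (1, 0) := by
    refine eq_of_exp_eq_const (D := fun t => Λ (t, 1) - Λ (t, 0)) (isPreconnected_univ)
      (Continuous.continuousOn (by fun_prop)) (w := 1) (fun t _ => ?_) trivial trivial
    rw [Complex.exp_sub, he, he]
    have : F (t, 1) = F (t, 0) := by simp only [F, hc01]
    rw [this]
    exact div_self (hF0 _)
  have hneg : ∀ θ : ℝ, Complex.exp (Λ (1, θ + 1 / 2) - Λ (1, θ)) = -1 := fun θ => by
    rw [Complex.exp_sub, he, he]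
    have : F (1, θ + 1 / 2) = -F (1, θ) := by
      simp only [F, hchalf, hπ11]
      push_cast
      rw [neg_one_mul, neg_one_mul, neg_neg, neg_sub]
    rw [this, neg_div, div_self (hF0 _)]
  have e3 : Λ (1, 1 / 2 + 1 / 2) - Λ (1, 1 / 2) = Λ (1, 0 + 1 / 2) - Λ (1, 0) :=
    eq_of_exp_eq_const (D := fun θ => Λ (1, θ + 1 / 2) - Λ (1, θ)) (isPreconnected_univ)
      (Continuous.continuousOn (by fun_prop)) (w := -1) (fun θ _ => hneg θ) trivial trivial
  have e4 := hneg 0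
  rw [← Complex.exp_pi_mul_I, Complex.exp_eq_exp_iff_exists_int] at e4
  obtain ⟨n, hn⟩ := e4
  refine ⟨n, ?_⟩
  rw [zero_add] at e3 hn
  rw [show (1 / 2 + 1 / 2 : ℝ) = 1 by norm_num] at e3
  linear_combination -e1 + e2 + e3 + 2 * hn

theorem odd_mul_two_pi_I_ne_zero (n : ℤ) : (2 * n + 1 : ℂ) * (2 * Real.pi * Complex.I) ≠ 0 := by
  refine mul_ne_zero ?_ Complex.two_pi_I_ne_zero
  have : (2 * n + 1 : ℤ) ≠ 0 := by omega
  exact_mod_cast this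

/-- The disk cannot be mapped injectively to a closed half-plane with its centre going to the
boundary line. -/
theorem not_injOn_of_im_nonneg {f : ℂ → ℂ} (hc : ContinuousOn f (Metric.closedBall 0 1))
    (hi : Set.InjOn f (Metric.closedBall 0 1)) (h0 : f 0 = 0)
    (him : ∀ z ∈ Metric.closedBall (0 : ℂ) 1, 0 ≤ (f z).im) : False := by
  let c : ℝ → ℂ := fun θ => Complex.exp ((2 * Real.pi * θ : ℝ) * Complex.I)
  have hcc : Continuous c := by fun_prop
  have hmem : ∀ θ, c θ ∈ Metric.closedBall (0 : ℂ) 1 := fun θ => by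
    rw [mem_closedBall_zero_iff, Complex.norm_exp_ofReal_mul_I]
  have hne : ∀ θ, f (c θ) ≠ 0 := fun θ h => by
    rw [← h0] at h
    exact Complex.exp_ne_zero _ (hi (hmem θ) (by simp) h)
  have hslit : ∀ θ, -Complex.I * f (c θ) ∈ Complex.slitPlane := fun θ => by
    rw [Complex.mem_slitPlane_iff]
    have hre : (-Complex.I * f (c θ)).re = (f (c θ)).im := by simp
    have him' : (-Complex.I * f (c θ)).im = -(f (c θ)).re := by simp
    rw [hre, him']
    rcases (him _ (hmem θ)).eq_or_lt with h | h
    · right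
      intro h'
      exact hne θ (Complex.ext (by simpa using h') h.symm)
    · exact Or.inl h
  obtain ⟨n, hn⟩ := exists_odd_winding hc hi
    (L := fun θ => Complex.log (-Complex.I * f (c θ)) + Real.pi / 2 * Complex.I)
    (by
      refine Continuous.continuousOn (Continuous.add (Continuous.clog ?_ hslit) continuous_const)
      exact continuous_const.mul (hc.comp_continuous hcc hmem))
    (fun θ _ => by
      rw [Complex.exp_add, Complex.exp_log (Complex.slitPlane_ne_zero (hslit θ)),
        Complex.exp_pi_div_two_mul_I, h0, sub_zero]
      linear_combination (-f (c θ)) * Complex.I_mul_I)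
  have hc01 : c 1 = c 0 := by
    simp only [c]
    rw [Complex.exp_eq_exp_iff_exists_int]
    exact ⟨1, by push_cast; ring⟩
  simp only [hc01, sub_self] at hn
  exact odd_mul_two_pi_I_ne_zero n hn.symm

/-- The odd winding number as a difference of the changes of the logarithm along the two
half-circles from `1` to `-1`. -/
theorem exists_odd_winding_half_circles {f : ℂ → ℂ} (hc : ContinuousOn f (Metric.closedBall 0 1))
    (hi : Set.InjOn f (Metric.closedBall 0 1)) {a b : ℝ → ℂ} (ha : ContinuousOn a (Set.Icc 0 1))
    (hb : ContinuousOn b (Set.Icc 0 1))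
    (hae : ∀ τ ∈ Set.Icc (0 : ℝ) 1, Complex.exp (a τ) = f (polarPoint 2 0 1 τ) - f 0)
    (hbe : ∀ τ ∈ Set.Icc (0 : ℝ) 1, Complex.exp (b τ) = f (polarPoint 2 1 1 (1 - τ)) - f 0) :
    ∃ n : ℤ, (a 1 - a 0) - (b 1 - b 0) = (2 * n + 1) * (2 * Real.pi * Complex.I) := by
  have h0 : (0 : ℝ) ∈ Set.Icc (0 : ℝ) 1 := ⟨le_rfl, zero_le_one⟩
  have h1 : (1 : ℝ) ∈ Set.Icc (0 : ℝ) 1 := ⟨zero_le_one, le_rfl⟩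
  let L : ℝ → ℂ := fun θ => if θ ≤ 1 / 2 then a (2 * θ) else b (2 - 2 * θ) + (a 1 - b 1)
  have hab : Complex.exp (a 1 - b 1) = 1 := by
    have h2 := hbe 1 h1
    rw [sub_self, ← polarPoint_succ 2 0 (by norm_num) 1, ← hae 1 h1] at h2
    rw [Complex.exp_sub, h2, div_self (Complex.exp_ne_zero _)]
  have hLc : ContinuousOn L (Set.Icc 0 1) := by
    have e : Set.Icc (0 : ℝ) 1 = Set.Icc 0 (1 / 2) ∪ Set.Icc (1 / 2) 1 :=
      (Set.Icc_union_Icc_eq_Icc (by norm_num) (by norm_num)).symm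
    rw [e]
    refine ContinuousOn.union_of_isClosed ?_ ?_ isClosed_Icc isClosed_Icc
    · have : ContinuousOn (fun θ => a (2 * θ)) (Set.Icc 0 (1 / 2)) :=
        ha.comp (by fun_prop) fun θ hθ => ⟨by linarith [hθ.1], by linarith [hθ.2]⟩
      exact this.congr fun θ hθ => if_pos hθ.2
    · have : ContinuousOn (fun θ => b (2 - 2 * θ) + (a 1 - b 1)) (Set.Icc (1 / 2) 1) :=
        (hb.comp (by fun_prop) fun θ hθ => ⟨by linarith [hθ.2], by linarith [hθ.1]⟩).add
          continuousOn_const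
      refine this.congr fun θ hθ => ?_
      rcases hθ.1.eq_or_lt with h | h
      · simp only [L, ← h, le_refl, if_true]; norm_num
      · exact if_neg (not_le.mpr h)
  have hLe : ∀ θ ∈ Set.Icc (0 : ℝ) 1,
      Complex.exp (L θ) = f (Complex.exp ((2 * Real.pi * θ : ℝ) * Complex.I)) - f 0 := by
    intro θ hθ
    by_cases h : θ ≤ 1 / 2
    · have e : L θ = a (2 * θ) := if_pos h
      rw [e, hae _ ⟨by linarith [hθ.1], by linarith⟩]
      congr 2
      simp only [polarPoint]
      push_cast
      rw [one_mul]
      congr 1; ring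
    · have e : L θ = b (2 - 2 * θ) + (a 1 - b 1) := if_neg h
      rw [e, Complex.exp_add, hab, mul_one,
        hbe _ ⟨by linarith [hθ.2], by linarith [not_le.mp h]⟩]
      congr 2
      simp only [polarPoint]
      push_cast
      rw [one_mul]
      congr 1; ring
  obtain ⟨n, hn⟩ := exists_odd_winding hc hi hLc hLe
  refine ⟨n, ?_⟩
  rw [← hn]
  have e1 : L 1 = b 0 + (a 1 - b 1) := by
    simp only [L]; norm_num
  have e0 : L 0 = a 0 := by simp [L]
  rw [e1, e0]; ring

namespace TwoComplex

variable {X : Type u} [TopologicalSpace X] [T2Space X] {K : TwoComplex X}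

/-! ### Edges of a surface -/

/-- A neighbourhood of `p` that meets only the cells through `p`. -/
theorem exists_isOpen_cells (K : TwoComplex X) (p : X) :
    ∃ W : Set X, IsOpen W ∧ p ∈ W ∧ (∀ x ∈ W, x ∈ K.vertices → x = p) ∧
      (∀ e ∈ K.edges, ∀ x ∈ W, x ∈ e → p ∈ e) ∧ (∀ f ∈ K.faces, ∀ x ∈ W, x ∈ f → p ∈ f) := by
  have h1 : IsClosed (K.vertices \ {p}) := (K.finite_vertices.subset Set.sdiff_subset).isClosed
  have h2 : IsClosed (⋃₀ {e | e ∈ K.edges ∧ p ∉ e}) := by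
    rw [Set.sUnion_eq_biUnion]
    exact (K.finite_edges.subset fun e he => he.1).isClosed_biUnion
      fun e he => (K.edge_isCompact he.1).isClosed
  have h3 : IsClosed (⋃₀ {f | f ∈ K.faces ∧ p ∉ f}) := by
    rw [Set.sUnion_eq_biUnion]
    exact (K.finite_faces.subset fun e he => he.1).isClosed_biUnion
      fun e he => (K.face_isCompact he.1).isClosed
  refine ⟨((K.vertices \ {p}) ∪ ⋃₀ {e | e ∈ K.edges ∧ p ∉ e} ∪ ⋃₀ {f | f ∈ K.faces ∧ p ∉ f})ᶜ,
    ((h1.union h2).union h3).isOpen_compl, ?_, ?_, ?_, ?_⟩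
  · rintro ((h | ⟨e, he, h⟩) | ⟨f, hf, h⟩)
    exacts [h.2 rfl, he.2 h, hf.2 h]
  · intro x hx hxV
    by_contra h
    exact hx (Or.inl (Or.inl ⟨hxV, h⟩))
  · intro e he x hx hxe
    by_contra h
    exact hx (Or.inl (Or.inr ⟨e, ⟨he, h⟩, hxe⟩))
  · intro f hf x hx hxf
    by_contra h
    exact hx (Or.inr ⟨f, ⟨hf, h⟩, hxf⟩)

/-- An arc that is carried to a half-edge by an affine map of the parameter. -/
theorem isHalfEdge_affine {e : Set X} (he : e ∈ K.edges) (γ : unitInterval ≃ₜ e) {s t : ℝ}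
    (hs : s ∈ Set.Icc (0 : ℝ) 1) (ht : t ∈ Set.Icc (0 : ℝ) 1) (hst : s ≠ t) :
    K.IsHalfEdge (γ ⟨s, hs⟩) fun a => (γ (Set.projIcc 0 1 zero_le_one (s + a * (t - s))) : X) := by
  have hmem : ∀ a ∈ Set.Icc (0 : ℝ) 1, s + a * (t - s) ∈ Set.Icc (0 : ℝ) 1 := fun a ha =>
    ⟨by nlinarith [ha.1, ha.2, hs.1, ht.1], by nlinarith [ha.1, ha.2, hs.2, ht.2]⟩
  refine ⟨?_, ?_, ?_, ?_⟩
  · refine Continuous.continuousOn ?_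
    exact continuous_subtype_val.comp (γ.continuous.comp (continuous_projIcc.comp (by fun_prop)))
  · intro a ha b hb hab
    have h1 := γ.injective (Subtype.ext hab)
    have h2 := congrArg Subtype.val h1
    rw [Set.projIcc_of_mem _ (hmem a ha), Set.projIcc_of_mem _ (hmem b hb)] at h2
    exact mul_right_cancel₀ (sub_ne_zero.mpr hst.symm) (add_left_cancel h2)
  · simp only [zero_mul, add_zero]
    rw [Set.projIcc_of_mem _ hs]
  · intro a _
    exact K.subset_skeleton he (Subtype.coe_prop _)

/-- The two half-edges at a point in the interior of an edge. -/
theorem exists_halfEdges_of_mem_edge {e : Set X} (he : e ∈ K.edges) {p : X} (hp : p ∈ e)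
    (hpV : p ∉ K.vertices) : ∃ η η' : ℝ → X, K.IsHalfEdge p η ∧ K.IsHalfEdge p η' ∧
      (∀ a, η a ∈ e) ∧ (∀ a, η' a ∈ e) ∧
      ∀ a ∈ Set.Icc (0 : ℝ) 1, ∀ b ∈ Set.Icc (0 : ℝ) 1, η a = η' b → a = 0 ∧ b = 0 := by
  obtain ⟨γ, hγ⟩ := K.edge_spec e he
  obtain ⟨⟨s, hs⟩, hsp⟩ := γ.surjective ⟨p, hp⟩
  have hs0 : s ≠ 0 := by
    rintro rfl
    refine hpV ((hγ.symm ▸ Or.inl ?_ : p ∈ e ∩ K.vertices).2)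
    exact (congrArg Subtype.val hsp).symm
  have hs1 : s ≠ 1 := by
    rintro rfl
    refine hpV ((hγ.symm ▸ Or.inr ?_ : p ∈ e ∩ K.vertices).2)
    exact (congrArg Subtype.val hsp).symm
  have hs0' : 0 < s := lt_of_le_of_ne hs.1 hs0.symm
  have hs1' : s < 1 := lt_of_le_of_ne hs.2 hs1
  have h0 : (0 : ℝ) ∈ Set.Icc (0 : ℝ) 1 := ⟨le_rfl, zero_le_one⟩
  have h1 : (1 : ℝ) ∈ Set.Icc (0 : ℝ) 1 := ⟨zero_le_one, le_rfl⟩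
  have hη := isHalfEdge_affine he γ hs h0 hs0
  have hη' := isHalfEdge_affine he γ hs h1 hs1
  rw [hsp] at hη hη'
  refine ⟨_, _, hη, hη', fun a => Subtype.coe_prop _, fun a => Subtype.coe_prop _, ?_⟩
  intro a ha b hb hab
  have h2 := congrArg Subtype.val (γ.injective (Subtype.ext hab))
  rw [Set.projIcc_of_mem _ ⟨by nlinarith [ha.1, ha.2], by nlinarith [ha.1, ha.2]⟩,
    Set.projIcc_of_mem _ ⟨by nlinarith [hb.1, hb.2], by nlinarith [hb.1, hb.2]⟩] at h2
  simp only [zero_sub, mul_neg, add_right_inj] at h2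
  have h3 : 0 ≤ a * s := mul_nonneg ha.1 hs0'.le
  have h4 : 0 ≤ b * (1 - s) := mul_nonneg hb.1 (by linarith)
  have h5 : a * s = 0 := by linarith
  have h6 : b * (1 - s) = 0 := by linarith
  exact ⟨(mul_eq_zero.mp h5).resolve_right hs0, (mul_eq_zero.mp h6).resolve_right
    (by intro h; exact hs1 (by linarith))⟩

theorem IsSector.swap {f : Set X} {η η' : ℝ → X} {ψ : ℝ × ℝ → X} (h : K.IsSector f η η' ψ)
    (h0 : η 0 = η' 0) : K.IsSector f η' η (fun x => ψ (x.2, x.1)) := by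
  have hsw : Set.MapsTo (fun x : ℝ × ℝ => (x.2, x.1)) (Set.Icc 0 1 ×ˢ Set.Icc 0 1)
      (Set.Icc 0 1 ×ˢ Set.Icc 0 1) := fun x hx => ⟨hx.2, hx.1⟩
  refine ⟨h.continuousOn.comp (by fun_prop) hsw, ?_, h.mapsTo.comp hsw, h.right, h.left,
    fun a b ha ha1 hb hb1 => h.interior b a hb hb1 ha ha1, ?_⟩
  · intro x hx y hy hxy
    have := h.injOn (hsw hx) (hsw hy) hxy
    rw [Prod.mk.injEq] at this
    exact Prod.ext this.2 this.1
  · obtain ⟨W, hW, hW0, hWf⟩ := h.nhds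
    refine ⟨W, hW, h0 ▸ hW0, fun y hy => ?_⟩
    obtain ⟨a, b, ha, hb, hab, he⟩ := hWf y hy
    exact ⟨b, a, hb, ha, by linarith, he⟩

theorem exists_mem_skeleton_notMem_edge {f e e' : Set X} (hf : f ∈ K.faces) (he : e ∈ K.edges)
    (he' : e' ∈ K.edges) : ∃ q ∈ f, q ∈ K.skeleton ∧ q ∉ e ∧ q ∉ e' := by
  obtain ⟨e'', he'', hef, hne, hne'⟩ := exists_edge_ne_ne hf e e'
  obtain ⟨q, hq, hqV⟩ := K.exists_mem_edge_notMem_vertices he''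
  exact ⟨q, hef hq, K.subset_skeleton he'' hq, fun h => hne (K.edge_eq_of_mem he'' he hq h hqV),
    fun h => hne' (K.edge_eq_of_mem he'' he' hq h hqV)⟩

/-- Two faces that share two half-edges at `p` form a star of two sectors. -/
theorem isStar_two {p : X} {f g : Set X} (hf : f ∈ K.faces) (hg : g ∈ K.faces) (hfg : f ≠ g)
    {η η' : ℝ → X} (hη : K.IsHalfEdge p η) (hη' : K.IsHalfEdge p η')
    (hdisj : ∀ a ∈ Set.Icc (0 : ℝ) 1, ∀ b ∈ Set.Icc (0 : ℝ) 1, η a = η' b → a = 0 ∧ b = 0)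
    {ψ χ : ℝ × ℝ → X} (hψ : K.IsSector f η η' ψ) (hχ : K.IsSector g η' η χ) :
    K.IsStar p 2 (fun k => if k % 2 = 0 then f else g) (fun k => if k % 2 = 0 then η else η')
      (fun k => if k % 2 = 0 then ψ else χ) := by
  refine ⟨by norm_num, fun k => ?_, ?_, fun k => ?_, fun k => ?_, ?_, fun k => ?_⟩
  · split_ifs
    exacts [hf, hg]
  · intro k hk l hl h
    interval_cases k <;> interval_cases l <;> first | rfl | (simp at h; exact absurd h hfg) |
      (simp at h; exact absurd h.symm hfg)
  · split_ifs
    exacts [hη, hη']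
  · simp only [Nat.mod_mod]
  · intro k hk l hl a ha b hb h
    interval_cases k <;> interval_cases l
    · exact ⟨hη.injOn ha hb (by simpa using h), Or.inr rfl⟩
    · obtain ⟨rfl, rfl⟩ := hdisj a ha b hb (by simpa using h)
      exact ⟨rfl, Or.inl rfl⟩
    · obtain ⟨rfl, rfl⟩ := hdisj b hb a ha (by simpa using h.symm)
      exact ⟨rfl, Or.inl rfl⟩
    · exact ⟨hη'.injOn ha hb (by simpa using h), Or.inr rfl⟩
  · rcases Nat.mod_two_eq_zero_or_one k with h | h
    · have h' : (k + 1) % 2 = 1 := by omega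
      simpa [h, h'] using hψ
    · have h' : (k + 1) % 2 = 0 := by omega
      simpa [h, h'] using hχ

/-- An injective chart near a point of a surface, as a total function. -/
theorem IsSurface.exists_chart (hK : K.IsSurface) {p : X} (hp : p ∈ K.space) :
    ∃ (V : Set X) (χ : X → ℂ), IsOpen V ∧ p ∈ V ∧ ContinuousOn χ (V ∩ K.space) ∧
      Set.InjOn χ (V ∩ K.space) := by
  classical
  obtain ⟨U, hU, hpU, ⟨c⟩⟩ := hK ⟨p, hp⟩
  obtain ⟨V, hV, rfl⟩ := isOpen_induced_iff.mp hU
  let χ : X → ℂ := fun y => if hy : y ∈ V ∩ K.space then (c ⟨⟨y, hy.2⟩, hy.1⟩ : ℂ) else 0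
  have hχ : ∀ y (hy : y ∈ V ∩ K.space), χ y = (c ⟨⟨y, hy.2⟩, hy.1⟩ : ℂ) := fun y hy => dif_pos hy
  refine ⟨V, χ, hV, hpU, ?_, ?_⟩
  · rw [continuousOn_iff_continuous_domRestrict]
    have : Set.domRestrict (V ∩ K.space) χ =
        fun y : (V ∩ K.space : Set X) => (c ⟨⟨y, y.2.2⟩, y.2.1⟩ : ℂ) := funext fun y => hχ y y.2
    rw [this]
    exact continuous_subtype_val.comp (c.continuous.comp
      (Continuous.subtype_mk (Continuous.subtype_mk continuous_subtype_val _) _))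
  · intro y hy z hz hyz
    rw [hχ y hy, hχ z hz] at hyz
    have := c.injective (Subtype.ext hyz)
    exact congrArg (fun t : (Subtype.val ⁻¹' V : Set K.space) => ((t : K.space) : X)) this

/-- Arbitrarily small disks around a point of a surface, with that point as their centre. -/
theorem IsSurface.exists_small_disk (hK : K.IsSurface) {p : X} (hp : p ∈ K.space) {W : Set X}
    (hW : IsOpen W) (hpW : p ∈ W) : ∃ Ψ : ℂ → X, ContinuousOn Ψ (Metric.closedBall 0 1) ∧
      Set.InjOn Ψ (Metric.closedBall 0 1) ∧
      Set.MapsTo Ψ (Metric.closedBall 0 1) (W ∩ K.space) ∧ Ψ 0 = p := by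
  classical
  obtain ⟨U, hU, hpU, ⟨c⟩⟩ := hK ⟨p, hp⟩
  set ζ := c ⟨⟨p, hp⟩, hpU⟩ with hζ
  let d : Metric.ball (0 : ℂ) 1 → X := fun z => ((c.symm z : K.space) : X)
  have hd : Continuous d :=
    continuous_subtype_val.comp (continuous_subtype_val.comp c.symm.continuous)
  have hdi : Function.Injective d := fun z w h =>
    c.symm.injective (Subtype.ext (Subtype.ext h))
  have hdζ : d ζ = p := by simp [d, hζ]
  have hnhds : d ⁻¹' W ∈ 𝓝 ζ := hd.continuousAt.preimage_mem_nhds (hdζ ▸ hW.mem_nhds hpW)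
  obtain ⟨ε, hε, hεW⟩ := Metric.mem_nhds_iff.mp hnhds
  have hζ1 := mem_ball_zero_iff.mp ζ.2
  set r := min ε (1 - ‖(ζ : ℂ)‖) / 2 with hr
  have hr0 : 0 < r := by
    have : 0 < min ε (1 - ‖(ζ : ℂ)‖) := lt_min hε (by linarith)
    positivity
  have hr1 : r < 1 - ‖(ζ : ℂ)‖ := by
    have : min ε (1 - ‖(ζ : ℂ)‖) ≤ 1 - ‖(ζ : ℂ)‖ := min_le_right _ _
    linarith
  have hrε : r < ε := by
    have : min ε (1 - ‖(ζ : ℂ)‖) ≤ ε := min_le_left _ _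
    linarith
  have hsmall : ∀ z ∈ Metric.closedBall (0 : ℂ) 1, ‖(r : ℂ) * z‖ ≤ r := fun z hz => by
    rw [norm_mul, Complex.norm_real, Real.norm_of_nonneg hr0.le]
    exact mul_le_of_le_one_right hr0.le (mem_closedBall_zero_iff.mp hz)
  have hb : ∀ z ∈ Metric.closedBall (0 : ℂ) 1, (ζ : ℂ) + r * z ∈ Metric.ball (0 : ℂ) 1 :=
    fun z hz => by
      rw [mem_ball_zero_iff]
      refine (norm_add_le _ _).trans_lt ?_
      linarith [hsmall z hz]
  let Ψ : ℂ → X := fun z => if hz : z ∈ Metric.closedBall (0 : ℂ) 1 then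
    d ⟨(ζ : ℂ) + r * z, hb z hz⟩ else p
  have hΨ : ∀ z (hz : z ∈ Metric.closedBall (0 : ℂ) 1), Ψ z = d ⟨(ζ : ℂ) + r * z, hb z hz⟩ :=
    fun z hz => dif_pos hz
  refine ⟨Ψ, ?_, ?_, ?_, ?_⟩
  · rw [continuousOn_iff_continuous_domRestrict]
    have : Set.domRestrict (Metric.closedBall (0 : ℂ) 1) Ψ =
        fun z : Metric.closedBall (0 : ℂ) 1 => d ⟨(ζ : ℂ) + r * z, hb z z.2⟩ :=
      funext fun z => hΨ z z.2
    rw [this]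
    exact hd.comp (Continuous.subtype_mk (by fun_prop) _)
  · intro z hz w hw hzw
    rw [hΨ z hz, hΨ w hw] at hzw
    have h1 := congrArg Subtype.val (hdi hzw)
    have hrc : (r : ℂ) ≠ 0 := by exact_mod_cast hr0.ne'
    exact mul_left_cancel₀ hrc (add_left_cancel h1)
  · intro z hz
    rw [hΨ z hz]
    refine ⟨hεW ?_, Subtype.coe_prop _⟩
    rw [Metric.mem_ball, Subtype.dist_eq, dist_eq_norm]
    simp only [add_sub_cancel_left]
    exact (hsmall z hz).trans_lt hrε
  · rw [hΨ 0 (by simp), ← hdζ]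
    congr 1
    apply Subtype.ext
    simp

/-- A point of a surface has no neighbourhood that embeds into a half-plane with that point on the
boundary line. -/
theorem IsSurface.false_of_injOn_halfPlane (hK : K.IsSurface) {p : X} (hp : p ∈ K.space)
    {W S : Set X} (hW : IsOpen W) (hpW : p ∈ W) (hWS : W ∩ K.space ⊆ S) {g : X → ℂ}
    (hg : ContinuousOn g S) (hgi : Set.InjOn g S) (hgp : g p = 0) (him : ∀ y ∈ S, 0 ≤ (g y).im) :
    False := by
  obtain ⟨Ψ, hc, hi, hm, h0⟩ := hK.exists_small_disk hp hW hpW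
  have hm' : Set.MapsTo Ψ (Metric.closedBall 0 1) S := fun z hz => hWS (hm hz)
  exact not_injOn_of_im_nonneg (hg.comp hc hm') (hgi.comp hi hm')
    (by simp [h0, hgp]) fun z hz => him _ (hm' hz)

/-- Three faces of a surface cannot meet in an edge: the three disks formed by two of the three
pages have boundary loops whose winding numbers around a point of the edge are odd, but add up to
zero. -/
theorem IsSurface.not_three_faces (hK : K.IsSurface) {e : Set X} (he : e ∈ K.edges)
    {f : Fin 3 → Set X} (hf : ∀ i, f i ∈ K.faces) (hef : ∀ i, e ⊆ f i)
    (hinj : Function.Injective f) : False := by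
  obtain ⟨p, hp, hpV⟩ := K.exists_mem_edge_notMem_vertices he
  have hpK : p ∈ K.space := K.skeleton_subset_space (K.subset_skeleton he hp)
  obtain ⟨η, η', hη, hη', hηe, hηe', hdisj⟩ := exists_halfEdges_of_mem_edge he hp hpV
  have h0 : (0 : ℝ) ∈ Set.Icc (0 : ℝ) 1 := ⟨le_rfl, zero_le_one⟩
  have h1 : (1 : ℝ) ∈ Set.Icc (0 : ℝ) 1 := ⟨zero_le_one, le_rfl⟩
  have hsec : ∀ i, ∃ ψ, K.IsSector (f i) η η' ψ := fun i => by
    obtain ⟨q, hq, hqK, hqe, -⟩ := exists_mem_skeleton_notMem_edge (hf i) he he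
    exact exists_isSector (hf i) hq hqK hη hη'
      (fun a _ => ⟨hef i (hηe a), fun h => hqe (h ▸ hηe a)⟩)
      (fun a _ => ⟨hef i (hηe' a), fun h => hqe (h ▸ hηe' a)⟩)
      fun a ha b hb h => (hdisj a ha b hb h).1
  choose ψ hψ using hsec
  obtain ⟨V, χ, hV, hpV', hχc, hχi⟩ := hK.exists_chart hpK
  -- a radius at which all three pages lie in the domain of the chart
  have hψ0 : ∀ i, ψ i (0, 0) = p := fun i => by rw [(hψ i).left 0 h0, hη.map_zero]
  have hrad : ∀ i, ∃ r : ℝ, 0 < r ∧ ∀ x ∈ Set.Icc (0 : ℝ) 1 ×ˢ Set.Icc (0 : ℝ) 1,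
      x.1 ≤ r → x.2 ≤ r → ψ i x ∈ V := fun i => by
    have h2 : ψ i ⁻¹' V ∈ 𝓝[Set.Icc 0 1 ×ˢ Set.Icc 0 1] ((0 : ℝ), (0 : ℝ)) :=
      (hψ i).continuousOn (0, 0) ⟨h0, h0⟩ (hV.mem_nhds ((hψ0 i).symm ▸ hpV'))
    obtain ⟨ε, hε, hεV⟩ := Metric.mem_nhdsWithin_iff.mp h2
    refine ⟨ε / 2, by positivity, fun x hx hx1 hx2 => hεV ⟨?_, hx⟩⟩
    rw [Metric.mem_ball, Prod.dist_eq]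
    refine max_lt ?_ ?_
    · rw [Real.dist_eq, sub_zero, abs_of_nonneg hx.1.1]; linarith
    · rw [Real.dist_eq, sub_zero, abs_of_nonneg hx.2.1]; linarith
  choose R hR hRV using hrad
  obtain ⟨r, hr, hr1, hrR⟩ : ∃ r : ℝ, 0 < r ∧ r ≤ 1 ∧ ∀ i, r ≤ R i := by
    refine ⟨min 1 (Finset.univ.inf' Finset.univ_nonempty R), ?_, min_le_left _ _, fun i =>
      (min_le_right _ _).trans (Finset.inf'_le _ (Finset.mem_univ i))⟩
    exact lt_min one_pos ((Finset.lt_inf'_iff _).mpr fun i _ => hR i)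
  have hrI : r ∈ Set.Icc (0 : ℝ) 1 := ⟨hr.le, hr1⟩
  have hmemV : ∀ i, ∀ ρ τ : ℝ, 0 ≤ ρ → ρ ≤ r → τ ∈ Set.Icc (0 : ℝ) 1 →
      ψ i (ρ * (1 - τ), ρ * τ) ∈ V ∩ K.space := fun i ρ τ hρ hρr hτ => by
    have hsq := polar_mem_square ⟨hρ, hρr.trans hr1⟩ hτ
    refine ⟨hRV i _ hsq ?_ ?_, face_subset_space (hf i) ((hψ i).mapsTo hsq)⟩
    · exact (mul_le_of_le_one_right hρ (by linarith [hτ.1])).trans (hρr.trans (hrR i))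
    · exact (mul_le_of_le_one_right hρ hτ.2).trans (hρr.trans (hrR i))
  -- logarithms along the half-circles
  have hsymm : ∀ τ ∈ Set.Icc (0 : ℝ) 1, 1 - τ ∈ Set.Icc (0 : ℝ) 1 := fun τ hτ =>
    ⟨by linarith [hτ.2], by linarith [hτ.1]⟩
  have hlog : ∀ i, ∃ a : ℝ → ℂ, ContinuousOn a (Set.Icc 0 1) ∧ ∀ τ ∈ Set.Icc (0 : ℝ) 1,
      Complex.exp (a τ) = χ (ψ i (r * (1 - τ), r * τ)) - χ p := fun i => by
    let π₁ : ℝ → ℝ := fun t => max 0 (min t 1)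
    have hπI : ∀ t, π₁ t ∈ Set.Icc (0 : ℝ) 1 := fun t =>
      ⟨le_max_left _ _, max_le zero_le_one (min_le_right _ _)⟩
    let F : ℝ × ℝ → ℂ := fun x => χ (ψ i (r * (1 - π₁ x.1), r * π₁ x.1)) - χ p
    have hF : Continuous F := by
      refine Continuous.sub (hχc.comp_continuous ?_ fun x => hmemV i r _ hr.le le_rfl (hπI _))
        continuous_const
      exact (hψ i).continuousOn.comp_continuous (by fun_prop) fun x => polar_mem_square hrI (hπI _)
    have hF0 : ∀ x, F x ≠ 0 := fun x hx => by
      have h2 := hχi (hmemV i r _ hr.le le_rfl (hπI _)) ⟨hpV', hpK⟩ (sub_eq_zero.mp hx)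
      rw [← hψ0 i] at h2
      have h3 := (hψ i).injOn (polar_mem_square hrI (hπI _)) ⟨h0, h0⟩ h2
      rw [Prod.mk.injEq] at h3
      have : r = 0 := by linarith [h3.1, h3.2]
      exact hr.ne' this
    obtain ⟨Λ, hΛ, hΛe⟩ := exists_continuous_log hF hF0
    refine ⟨fun τ => Λ (τ, 0), (hΛ.comp (by fun_prop)).continuousOn, fun τ hτ => ?_⟩
    have : π₁ τ = τ := by simp [π₁, hτ.1, hτ.2]
    simp only [hΛe, F, this]
  choose a hac hae using hlog
  have hpair : ∀ i j, i ≠ j → ∃ n : ℤ,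
      (a i 1 - a i 0) - (a j 1 - a j 0) = (2 * n + 1) * (2 * Real.pi * Complex.I) := by
    intro i j hij
    obtain ⟨Ψ, hc, hi, hΨ⟩ := (isStar_two (hf i) (hf j) (hinj.ne hij) hη hη' hdisj (hψ i)
      ((hψ j).swap (by rw [hη.map_zero, hη'.map_zero]))).exists_disk
    have hΨ0 : ∀ ρ ∈ Set.Icc (0 : ℝ) 1, ∀ τ ∈ Set.Icc (0 : ℝ) 1,
        Ψ (polarPoint 2 0 ρ τ) = ψ i (ρ * (1 - τ), ρ * τ) := fun ρ hρ τ hτ => by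
      simpa using hΨ 0 (by norm_num) ρ hρ τ hτ
    have hΨ1 : ∀ ρ ∈ Set.Icc (0 : ℝ) 1, ∀ τ ∈ Set.Icc (0 : ℝ) 1,
        Ψ (polarPoint 2 1 ρ τ) = ψ j (ρ * τ, ρ * (1 - τ)) := fun ρ hρ τ hτ => by
      simpa using hΨ 1 (by norm_num) ρ hρ τ hτ
    have hscale : ∀ k ρ τ, (r : ℂ) * polarPoint 2 k ρ τ = polarPoint 2 k (r * ρ) τ :=
      fun k ρ τ => by simp only [polarPoint]; push_cast; ring
    have hΨp : Ψ 0 = p := by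
      have := hΨ0 0 h0 0 h0
      rw [zero_mul, zero_mul, hψ0] at this
      rw [← this]; simp [polarPoint]
    have hmaps : Set.MapsTo (fun z : ℂ => (r : ℂ) * z) (Metric.closedBall 0 1)
        (Metric.closedBall 0 1) := fun z hz => by
      rw [mem_closedBall_zero_iff] at hz ⊢
      rw [norm_mul, Complex.norm_real, Real.norm_of_nonneg hr.le]
      exact mul_le_one₀ hr1 (norm_nonneg _) hz
    have hmaps' : Set.MapsTo (fun z : ℂ => Ψ (r * z)) (Metric.closedBall 0 1)
        (V ∩ K.space) := fun z hz => by
      rw [mem_closedBall_zero_iff] at hz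
      obtain ⟨k, hk, τ, hτ, hz'⟩ := exists_polarPoint_eq (m := 2) (by norm_num) z
      have hρ : 0 ≤ r * ‖z‖ := mul_nonneg hr.le (norm_nonneg _)
      have hρr : r * ‖z‖ ≤ r := mul_le_of_le_one_right hr.le hz
      have hρI : r * ‖z‖ ∈ Set.Icc (0 : ℝ) 1 := ⟨hρ, hρr.trans hr1⟩
      simp only
      rw [← hz', hscale]
      interval_cases k
      · rw [hΨ0 _ hρI τ hτ]
        exact hmemV i _ τ hρ hρr hτ
      · rw [hΨ1 _ hρI τ hτ]
        have := hmemV j _ (1 - τ) hρ hρr (hsymm τ hτ)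
        rwa [sub_sub_cancel] at this
    have hrc : (r : ℂ) ≠ 0 := by exact_mod_cast hr.ne'
    refine exists_odd_winding_half_circles (f := fun z => χ (Ψ (r * z)))
      (hχc.comp (hc.comp (by fun_prop) hmaps) hmaps') ?_ (hac i) (hac j) ?_ ?_
    · exact hχi.comp (hi.comp (fun z _ w _ h => mul_left_cancel₀ hrc h) hmaps) hmaps'
    · intro τ hτ
      rw [hae i τ hτ]
      simp only [hscale, mul_one, mul_zero, hΨp]
      rw [hΨ0 r hrI τ hτ]
    · intro τ hτ
      rw [hae j τ hτ]
      simp only [hscale, mul_one, mul_zero, hΨp]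
      rw [hΨ1 r hrI _ (hsymm τ hτ), sub_sub_cancel]
  obtain ⟨n₁, h₁⟩ := hpair 0 1 (by decide)
  obtain ⟨n₂, h₂⟩ := hpair 1 2 (by decide)
  obtain ⟨n₃, h₃⟩ := hpair 2 0 (by decide)
  apply odd_mul_two_pi_I_ne_zero (n₁ + n₂ + n₃ + 1)
  push_cast
  linear_combination -h₁ - h₂ - h₃

/-- In a surface, every edge lies in some face: an interior point of an edge in no face has a
neighbourhood that is an arc, which embeds into the boundary line of the half-plane. -/
theorem IsSurface.exists_face (hK : K.IsSurface) {e : Set X} (he : e ∈ K.edges) :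
    ∃ f ∈ K.faces, e ⊆ f := by
  classical
  by_contra! hcon
  obtain ⟨p, hp, hpV⟩ := K.exists_mem_edge_notMem_vertices he
  have hpK : p ∈ K.space := K.skeleton_subset_space (K.subset_skeleton he hp)
  obtain ⟨W, hW, hpW, hWV, hWE, hWF⟩ := K.exists_isOpen_cells p
  obtain ⟨γ, -⟩ := K.edge_spec e he
  let g : X → ℂ := fun y => if hy : y ∈ e then
    (((γ.symm ⟨y, hy⟩ : ℝ) - (γ.symm ⟨p, hp⟩ : ℝ) : ℝ) : ℂ) else 0
  have hg : ∀ y (hy : y ∈ e), g y =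
    (((γ.symm ⟨y, hy⟩ : ℝ) - (γ.symm ⟨p, hp⟩ : ℝ) : ℝ) : ℂ) := fun y hy => dif_pos hy
  refine hK.false_of_injOn_halfPlane hpK hW hpW (S := e) (g := g) ?_ ?_ ?_ ?_ ?_
  · rintro y ⟨hyW, (hyV | ⟨e', he', hye'⟩) | ⟨f, hf, hyf⟩⟩
    · exact absurd (hWV y hyW hyV ▸ hyV) hpV
    · rwa [K.edge_eq_of_mem he he' hp (hWE e' he' y hyW hye') hpV]
    · exact absurd (edge_subset_of_mem_face he hf hp hpV (hWF f hf y hyW hyf)) (hcon f hf)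
  · rw [continuousOn_iff_continuous_domRestrict]
    have : Set.domRestrict e g = fun y : e =>
        (((γ.symm y : ℝ) - (γ.symm ⟨p, hp⟩ : ℝ) : ℝ) : ℂ) := funext fun y => hg y y.2
    rw [this]
    have := γ.symm.continuous
    fun_prop
  · intro y hy z hz hyz
    rw [hg y hy, hg z hz, Complex.ofReal_inj, sub_left_inj] at hyz
    exact congrArg Subtype.val (γ.symm.injective (Subtype.ext hyz))
  · rw [hg p hp, sub_self, Complex.ofReal_zero]
  · intro y hy
    rw [hg y hy, Complex.ofReal_im]

/-- In a surface, every edge lies in more than one face: near an interior point of an edge in a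
single face `f`, the surface is contained in `f`, for which there is a half-plane chart. -/
theorem IsSurface.exists_face_ne (hK : K.IsSurface) {e f : Set X} (he : e ∈ K.edges)
    (hf : f ∈ K.faces) (hef : e ⊆ f) : ∃ g ∈ K.faces, e ⊆ g ∧ g ≠ f := by
  by_contra! hcon
  obtain ⟨p, hp, hpV⟩ := K.exists_mem_edge_notMem_vertices he
  have hpK : p ∈ K.space := K.skeleton_subset_space (K.subset_skeleton he hp)
  obtain ⟨W, hW, hpW, hWV, hWE, hWF⟩ := K.exists_isOpen_cells p
  obtain ⟨q, hq, hqK, hqe, -⟩ := exists_mem_skeleton_notMem_edge hf he he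
  have hpq : p ≠ q := fun h => hqe (h ▸ hp)
  obtain ⟨h, g, hhc, hgc, hh, hg, hh0, -⟩ := exists_halfPlane_chart hf (hef hp)
    (K.subset_skeleton he hp) hq hqK hpq
  refine hK.false_of_injOn_halfPlane hpK (hW.sdiff isClosed_singleton)
    ⟨hpW, hpq⟩ (S := f \ {q}) (g := g) ?_ hgc ?_ ?_ fun y hy => (hg y hy).1
  · rintro y ⟨⟨hyW, hyq⟩, (hyV | ⟨e', he', hye'⟩) | ⟨f', hf', hyf'⟩⟩
    · exact absurd (hWV y hyW hyV ▸ hyV) hpV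
    · refine ⟨hef ?_, hyq⟩
      rwa [K.edge_eq_of_mem he he' hp (hWE e' he' y hyW hye') hpV]
    · refine ⟨?_, hyq⟩
      rwa [← hcon f' hf' (edge_subset_of_mem_face he hf' hp hpV (hWF f' hf' y hyW hyf'))]
  · intro y hy z hz hyz
    rw [← (hg y hy).2, ← (hg z hz).2, hyz]
  · rw [← hh0]; exact (hh 0 le_rfl).2

theorem IsSurface.degree_eq_two (hK : K.IsSurface) {e : Set X} (he : e ∈ K.edges) :
    K.degree e = 2 := by
  obtain ⟨f, hf, hef⟩ := hK.exists_face he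
  obtain ⟨g, hg, heg, hgf⟩ := hK.exists_face_ne he hf hef
  rw [degree, Set.ncard_eq_two]
  refine ⟨f, g, hgf.symm, Set.eq_of_subset_of_subset ?_ ?_⟩
  · rintro k ⟨hk, hek⟩
    by_contra hkn
    rw [Set.mem_insert_iff, Set.mem_singleton_iff, not_or] at hkn
    refine hK.not_three_faces he (f := ![f, g, k]) ?_ ?_ ?_
    · intro i; fin_cases i <;> assumption
    · intro i; fin_cases i <;> assumption
    · intro i j hij
      fin_cases i <;> fin_cases j <;> simp at hij ⊢
      exacts [hgf hij.symm, hkn.1 hij.symm, hgf hij, hkn.2 hij.symm, hkn.1 hij, hkn.2 hij]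
  · rintro k (rfl | rfl)
    exacts [⟨hf, hef⟩, ⟨hg, heg⟩]

end TwoComplex

/-! ### A complex with an Euler cover is even -/

theorem RestrictsToHomeomorph.image_eq {X : Type u} [TopologicalSpace X] {Y : Type v}
    [TopologicalSpace Y] {φ : Y → X}
    {s : Set Y} {t : Set X} (h : RestrictsToHomeomorph φ s t) : φ '' s = t := by
  obtain ⟨c, hc⟩ := h
  ext x
  constructor
  · rintro ⟨y, hy, rfl⟩
    rw [← hc ⟨y, hy⟩]; exact Subtype.coe_prop _
  · intro hx
    refine ⟨c.symm ⟨x, hx⟩, Subtype.coe_prop _, ?_⟩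
    rw [← hc, Homeomorph.apply_symm_apply]

theorem RestrictsToHomeomorph.injOn {X : Type u} [TopologicalSpace X] {Y : Type v}
    [TopologicalSpace Y] {φ : Y → X}
    {s : Set Y} {t : Set X} (h : RestrictsToHomeomorph φ s t) : Set.InjOn φ s := by
  obtain ⟨c, hc⟩ := h
  intro x hx y hy hxy
  rw [← hc ⟨x, hx⟩, ← hc ⟨y, hy⟩] at hxy
  exact congrArg Subtype.val (c.injective (Subtype.ext hxy))

namespace TwoComplex

variable {X : Type u} [TopologicalSpace X] [T2Space X] {K : TwoComplex X}

/-- The faces at an edge `e` of `K` correspond to the faces of the cover at the edges over `e`, each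
of which lies in two faces. -/
theorem isEven_of_isEulerCover {Y : Type v} [TopologicalSpace Y] [T2Space Y] {M : TwoComplex Y}
    {φ : Y → X} (h : IsEulerCover M K φ) (hK : ∀ e ∈ K.edges, ∃ f ∈ K.faces, e ⊆ f) :
    K.IsEven := by
  classical
  obtain ⟨hM, -, ⟨-, hV, hE, hF⟩, huniq⟩ := h
  have hE' : ∀ e ∈ M.edges, φ '' e ∈ K.edges := fun e he => by
    obtain ⟨e', he', hr⟩ := hE e he
    rwa [hr.image_eq]
  have hF' : ∀ f ∈ M.faces, φ '' f ∈ K.faces ∧ Set.InjOn φ f := fun f hf => by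
    obtain ⟨f', hf', hr⟩ := hF f hf
    exact ⟨by rwa [hr.image_eq], hr.injOn⟩
  intro e he
  refine ⟨?_, ?_⟩
  · obtain ⟨f, hf, hef⟩ := hK e he
    exact (Set.ncard_pos (K.finite_faces.subset fun g hg => hg.1)).mpr ⟨f, hf, hef⟩
  let I : Set (Set Y) := {e' | e' ∈ M.edges ∧ φ '' e' = e}
  have hI : I.Finite := M.finite_edges.subset fun e' he' => he'.1
  have : Fintype I := hI.fintype
  -- the faces of `M` that lie over a face containing `e`, sorted by their edge that lies over `e`
  let T : I → Set (Set Y) := fun e' => {f | f ∈ M.faces ∧ (e' : Set Y) ⊆ f}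
  have himage : {f | f ∈ K.faces ∧ e ⊆ f} = (fun f => φ '' f) '' ⋃ i, T i := by
    ext f
    constructor
    · rintro ⟨hf, hef⟩
      obtain ⟨f', ⟨hf', rfl⟩, -⟩ := huniq f hf
      obtain ⟨e', he', hef', hφe⟩ :=
        exists_side_image_eq hf hf' rfl (hF' f' hf').2 hV hE' he hef
      exact ⟨f', Set.mem_iUnion.mpr ⟨⟨e', he', hφe⟩, hf', hef'⟩, rfl⟩
    · rintro ⟨f', hf', rfl⟩
      obtain ⟨⟨e', he', hφe⟩, hf', hef'⟩ := Set.mem_iUnion.mp hf'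
      exact ⟨(hF' f' hf').1, hφe ▸ Set.image_mono hef'⟩
  have hinj : Set.InjOn (fun f => φ '' f) (⋃ i, T i) := by
    intro f hf g hg hfg
    obtain ⟨_, hf, -⟩ := Set.mem_iUnion.mp hf
    obtain ⟨_, hg, -⟩ := Set.mem_iUnion.mp hg
    exact (huniq _ (hF' f hf).1).unique ⟨hf, rfl⟩ ⟨hg, hfg.symm⟩
  rw [degree, himage, hinj.ncard_image, Set.ncard_iUnion_of_finite,
    finsum_eq_sum_of_fintype]
  · refine Finset.even_sum _ fun i _ => ?_
    have : (T i).ncard = 2 := hM.degree_eq_two i.2.1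
    rw [this]; exact even_two
  · exact fun i => M.finite_faces.subset fun f hf => hf.1
  · intro i j hij
    refine Set.disjoint_left.mpr fun f hfi hfj => hij (Subtype.ext ?_)
    exact ((hF' f hfi.1).2.image_eq_image_iff hfi.2 hfj.2).mp (i.2.2.trans j.2.2.symm)

/-- A nonempty surface has a face: it is infinite, so it has an edge or a face, and its edges lie in
faces. -/
theorem IsSurface.exists_mem_faces (hK : K.IsSurface) (hne : K.space.Nonempty) :
    ∃ f, f ∈ K.faces := by
  obtain ⟨x, hx⟩ := hne
  obtain ⟨U, -, -, ⟨c⟩⟩ := hK ⟨x, hx⟩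
  have hball : Infinite (Metric.ball (0 : ℂ) 1) := by
    refine Set.infinite_coe_iff.mpr (infinite_of_mem_nhds (0 : ℂ) (Metric.ball_mem_nhds _ one_pos))
  have hinf : (Set.range fun z => ((c.symm z : K.space) : X)).Infinite :=
    Set.infinite_range_of_injective fun z w h => c.symm.injective (Subtype.ext (Subtype.ext h))
  obtain ⟨y, ⟨z, hz⟩, hyV⟩ := (hinf.sdiff K.finite_vertices).nonempty
  have hy : y ∈ K.space := hz ▸ Subtype.coe_prop _
  rcases hy with (hy | ⟨e, he, -⟩) | ⟨f, hf, -⟩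
  · exact absurd hy hyV
  · obtain ⟨f, hf, -⟩ := hK.exists_face he
    exact ⟨f, hf⟩
  · exact ⟨f, hf⟩

theorem isClosed_sUnion_faces (K : TwoComplex X) {S : Set (Set X)} (hS : S ⊆ K.faces) :
    IsClosed (⋃₀ S) := by
  rw [Set.sUnion_eq_biUnion]
  exact (K.finite_faces.subset hS).isClosed_biUnion fun f hf => (K.face_isCompact (hS hf)).isClosed

theorem isClosed_sUnion_edges (K : TwoComplex X) {S : Set (Set X)} (hS : S ⊆ K.edges) :
    IsClosed (⋃₀ S) := by
  rw [Set.sUnion_eq_biUnion]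
  exact (K.finite_edges.subset hS).isClosed_biUnion fun f hf => (K.edge_isCompact (hS hf)).isClosed

/-- In a strongly connected complex that has a face every edge lies in a face: the interior of an
edge that does not would be a component of the complex without its vertices. -/
theorem StronglyConnected.exists_face (hK : K.StronglyConnected) (hf : ∃ f, f ∈ K.faces)
    {e : Set X} (he : e ∈ K.edges) : ∃ f ∈ K.faces, e ⊆ f := by
  by_contra! hcon
  have hpre := isPreconnected_closed_iff.mp hK.2.isPreconnected e
    (⋃₀ {e' | e' ∈ K.edges ∧ e' ≠ e} ∪ ⋃₀ K.faces) (K.edge_isCompact he).isClosed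
    ((K.isClosed_sUnion_edges fun e' he' => he'.1).union (K.isClosed_sUnion_faces subset_rfl))
    ?_ ?_ ?_
  · obtain ⟨x, ⟨-, hxV⟩, hxe, ⟨e', ⟨he', hne⟩, hxe'⟩ | ⟨f, hf, hxf⟩⟩ := hpre
    · exact hne (K.edge_eq_of_mem he' he hxe' hxe hxV)
    · exact hcon f hf (edge_subset_of_mem_face he hf hxe hxV hxf)
  · rintro x ⟨(hx | ⟨e', he', hx⟩) | hx, hxV⟩
    · exact absurd hx hxV
    · by_cases h : e' = e
      · exact Or.inl (h ▸ hx)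
      · exact Or.inr (Or.inl ⟨e', ⟨he', h⟩, hx⟩)
    · exact Or.inr (Or.inr hx)
  · obtain ⟨x, hx, hxV⟩ := K.exists_mem_edge_notMem_vertices he
    exact ⟨x, ⟨K.skeleton_subset_space (K.subset_skeleton he hx), hxV⟩, hx⟩
  · obtain ⟨f, hf⟩ := hf
    obtain ⟨x, hx, hxK⟩ := exists_mem_face_notMem_skeleton hf
    exact ⟨x, ⟨face_subset_space hf hx, fun h => hxK (Or.inl h)⟩, Or.inr ⟨f, hf, hx⟩⟩

theorem StronglyConnected.isEven_of_hasEulerCover (hK : K.StronglyConnected)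
    (h : K.HasEulerCover) : K.IsEven := by
  obtain ⟨Y, _, _, M, φ, h⟩ := h
  refine isEven_of_isEulerCover h fun e he => hK.exists_face ?_ he
  obtain ⟨f, hf⟩ := h.1.exists_mem_faces h.2.1.nonempty
  obtain ⟨f', hf', -⟩ := h.2.2.1.2.2.2 f hf
  exact ⟨f', hf'⟩

/-- In a strongly connected complex whose edges lie in faces, a set of faces that is closed under
passing to a face with a common edge is empty or contains all faces. -/
theorem StronglyConnected.face_induction (hK : K.StronglyConnected)
    (hE : ∀ e ∈ K.edges, ∃ f ∈ K.faces, e ⊆ f) {P : Set X → Prop}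
    (hP : ∀ f ∈ K.faces, ∀ g ∈ K.faces, ∀ e ∈ K.edges, e ⊆ f → e ⊆ g → P f → P g)
    {f g : Set X} (hf : f ∈ K.faces) (hg : g ∈ K.faces) (hPf : P f) : P g := by
  by_contra hPg
  have hpre := isPreconnected_closed_iff.mp hK.2.isPreconnected
    (⋃₀ {f | f ∈ K.faces ∧ P f}) (⋃₀ {f | f ∈ K.faces ∧ ¬ P f})
    (K.isClosed_sUnion_faces fun f hf => hf.1) (K.isClosed_sUnion_faces fun f hf => hf.1) ?_ ?_ ?_
  · obtain ⟨x, ⟨-, hxV⟩, ⟨f, ⟨hf, hPf⟩, hxf⟩, ⟨g, ⟨hg, hPg⟩, hxg⟩⟩ := hpre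
    have hne : f ≠ g := fun h => hPg (h ▸ hPf)
    obtain ⟨e, he, hxe⟩ := K.faces_inter f hf g hg hne ⟨hxf, hxg⟩
    exact hPg (hP f hf g hg e he (edge_subset_of_mem_face he hf hxe hxV hxf)
      (edge_subset_of_mem_face he hg hxe hxV hxg) hPf)
  · have hall : ∀ f ∈ K.faces, ∀ x ∈ f,
        x ∈ ⋃₀ {f | f ∈ K.faces ∧ P f} ∪ ⋃₀ {f | f ∈ K.faces ∧ ¬ P f} := fun f hf x hx => by
      by_cases h : P f
      · exact Or.inl ⟨f, ⟨hf, h⟩, hx⟩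
      · exact Or.inr ⟨f, ⟨hf, h⟩, hx⟩
    rintro x ⟨(hx | ⟨e, he, hx⟩) | ⟨f, hf, hx⟩, hxV⟩
    · exact absurd hx hxV
    · obtain ⟨f, hf, hef⟩ := hE e he
      exact hall f hf x (hef hx)
    · exact hall f hf x hx
  · obtain ⟨x, hx, hxK⟩ := exists_mem_face_notMem_skeleton hf
    exact ⟨x, ⟨face_subset_space hf hx, fun h => hxK (Or.inl h)⟩, ⟨f, ⟨hf, hPf⟩, hx⟩⟩
  · obtain ⟨x, hx, hxK⟩ := exists_mem_face_notMem_skeleton hg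
    exact ⟨x, ⟨face_subset_space hg hx, fun h => hxK (Or.inl h)⟩, ⟨g, ⟨hg, hPg⟩, hx⟩⟩

end TwoComplex

/-! ### Pairing the faces at every edge -/

section Pairing

variable {F E V : Type*}

/-- For every edge `e`, the map `σ e` matches the faces incident with `e` in pairs. -/
structure IsPairing (I : E → F → Prop) (σ : E → F → F) : Prop where
  incident : ∀ e f, I e f → I e (σ e f)
  ne : ∀ e f, I e f → σ e f ≠ f
  involutive : ∀ e f, I e f → σ e (σ e f) = f

/-- Two faces are linked if they are matched at one of the edges in `S`. -/
def Linked (I : E → F → Prop) (σ : E → F → F) (S : Set E) (f g : F) : Prop :=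
  ∃ e ∈ S, I e f ∧ σ e f = g

theorem exists_involution_of_even {α : Type*} (s : Set α) (hs : s.Finite) (h : Even s.ncard) :
    ∃ t : α → α, ∀ x ∈ s, t x ∈ s ∧ t x ≠ x ∧ t (t x) = x := by
  classical
  obtain ⟨k, hk⟩ := h
  have : Fintype s := hs.fintype
  have hcard : Fintype.card s = Fintype.card (Fin k × Bool) := by
    rw [← Nat.card_eq_fintype_card, Nat.card_coe_set_eq, hk]; simp; ring
  let c := Fintype.equivOfCardEq hcard
  refine ⟨fun x => if hx : x ∈ s then c.symm ((c ⟨x, hx⟩).1, !(c ⟨x, hx⟩).2) else x,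
    fun x hx => ?_⟩
  simp only [hx, dif_pos]
  refine ⟨Subtype.coe_prop _, fun h => ?_, ?_⟩
  · have h1 : c.symm ((c ⟨x, hx⟩).1, !(c ⟨x, hx⟩).2) = ⟨x, hx⟩ := Subtype.ext h
    have h2 := congrArg (fun y => (c y).2) h1
    simp at h2
  · simp

theorem exists_isPairing [Finite F] {I : E → F → Prop} (h : ∀ e, Even {f | I e f}.ncard) :
    ∃ σ, IsPairing I σ := by
  choose σ hσ using fun e => exists_involution_of_even {f | I e f} (Set.toFinite _) (h e)
  exact ⟨σ, fun e f hf => (hσ e f hf).1, fun e f hf => (hσ e f hf).2.1,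
    fun e f hf => (hσ e f hf).2.2⟩

variable {I : E → F → Prop} {σ σ' : E → F → F}

theorem IsPairing.linked_symm (h : IsPairing I σ) (S : Set E) {f g : F}
    (hfg : Linked I σ S f g) : Linked I σ S g f := by
  obtain ⟨e, he, hI, rfl⟩ := hfg
  exact ⟨e, he, h.incident e f hI, h.involutive e f hI⟩

theorem IsPairing.reach_symm (h : IsPairing I σ) (S : Set E) {f g : F}
    (hfg : Relation.ReflTransGen (Linked I σ S) f g) :
    Relation.ReflTransGen (Linked I σ S) g f := by
  induction hfg with
  | refl => exact Relation.ReflTransGen.refl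
  | tail _ h₂ ih => exact Relation.ReflTransGen.head (h.linked_symm S h₂) ih

/-- If every face has an even number of edges at the vertex `v`, then a link at an edge `e` through
`v` is not a bridge: when `σ'` differs from `σ` only at `e` and there only on the linked pair
`f₁`, `f₂` and on a pair that `σ` does not connect with it, then `σ'` connects `f₁` with `f₂`.
Otherwise the incidences at `v` of the faces that are reached from `f₁` would be matched by `σ`, all
but one. -/
theorem IsPairing.reach_of_swap [Finite F] [Finite E] {J : E → Prop}
    (hJ : ∀ f, Even {e | J e ∧ I e f}.ncard) (h : IsPairing I σ)
    {e : E} (he : J e) {f₁ f₂ f₃ f₄ : F} (h₁ : I e f₁) (h₁₂ : σ e f₁ = f₂) (h₃ : I e f₃)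
    (h₃₄ : σ e f₃ = f₄)
    (hσ : ∀ e' g, (e' = e → g ≠ f₁ ∧ g ≠ f₂ ∧ g ≠ f₃ ∧ g ≠ f₄) → σ' e' g = σ e' g)
    (hn : ¬Relation.ReflTransGen (Linked I σ Set.univ) f₁ f₃) :
    Relation.ReflTransGen (Linked I σ' Set.univ) f₁ f₂ := by
  classical
  by_contra hcon
  have := Fintype.ofFinite F
  have := Fintype.ofFinite E
  let S : Finset F := Finset.univ.filter fun g =>
    Relation.ReflTransGen (Linked I σ Set.univ) f₁ g ∧
      Relation.ReflTransGen (Linked I σ' Set.univ) f₁ g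
  have hS : ∀ g, g ∈ S ↔ Relation.ReflTransGen (Linked I σ Set.univ) f₁ g ∧
      Relation.ReflTransGen (Linked I σ' Set.univ) f₁ g := fun g => by simp [S]
  let A : Finset (Σ _ : F, E) := S.sigma fun g => Finset.univ.filter fun e' => J e' ∧ I e' g
  have hA : ∀ x, x ∈ A ↔ x.1 ∈ S ∧ J x.2 ∧ I x.2 x.1 := fun x => by simp [A]
  have hAeven : Even A.card := by
    rw [Finset.card_sigma]
    refine Finset.even_sum _ fun g _ => ?_
    have := hJ g
    rwa [Set.ncard_eq_toFinset_card', Set.toFinset_ofPred] at this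
  have hfA : (⟨f₁, e⟩ : Σ _ : F, E) ∈ A := (hA _).mpr
    ⟨(hS _).mpr ⟨Relation.ReflTransGen.refl, Relation.ReflTransGen.refl⟩, he, h₁⟩
  have hzero : ∑ _x ∈ A.erase ⟨f₁, e⟩, (1 : ZMod 2) = 0 := by
    have hmem : ∀ x ∈ A.erase ⟨f₁, e⟩, (⟨σ x.2 x.1, x.2⟩ : Σ _ : F, E) ∈ A.erase ⟨f₁, e⟩ := by
      rintro ⟨g, e'⟩ hx
      rw [Finset.mem_erase, hA] at hx
      obtain ⟨hne, hgS, hJe, hIg⟩ := hx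
      obtain ⟨hg, hg'⟩ := (hS g).mp hgS
      have hg2 : g ≠ f₂ := by rintro rfl; exact hcon hg'
      have hside : e' = e → g ≠ f₁ ∧ g ≠ f₂ ∧ g ≠ f₃ ∧ g ≠ f₄ := by
        rintro rfl
        refine ⟨by rintro rfl; exact hne rfl, hg2, by rintro rfl; exact hn hg, ?_⟩
        rintro rfl
        exact hn (hg.tail (h.linked_symm _ ⟨e', trivial, h₃, h₃₄⟩))
      have hlink' : Linked I σ' Set.univ g (σ e' g) := ⟨e', trivial, hIg, hσ e' g hside⟩
      rw [Finset.mem_erase, hA]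
      refine ⟨?_, (hS _).mpr ⟨hg.tail ⟨e', trivial, hIg, rfl⟩, hg'.tail hlink'⟩, hJe,
        h.incident _ _ hIg⟩
      intro heq
      rw [Sigma.mk.injEq] at heq
      obtain ⟨heq1, heq2⟩ := heq
      have heq2 := eq_of_heq heq2
      subst heq2
      apply hg2
      rw [← h₁₂, ← heq1, h.involutive _ _ hIg]
    refine Finset.sum_involution (fun x _ => ⟨σ x.2 x.1, x.2⟩) ?_ ?_ hmem ?_
    · intro x _; decide
    · rintro ⟨g, e'⟩ hx - heq
      rw [Sigma.mk.injEq] at heq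
      exact h.ne _ _ ((hA _).mp (Finset.mem_of_mem_erase hx)).2.2 heq.1
    · rintro ⟨g, e'⟩ hx
      simp only [h.involutive _ _ ((hA _).mp (Finset.mem_of_mem_erase hx)).2.2]
  rw [Finset.sum_const, nsmul_eq_mul, mul_one, ZMod.natCast_eq_zero_iff_even,
    Finset.card_erase_of_mem hfA] at hzero
  have hpos := Finset.card_pos.mpr ⟨_, hfA⟩
  obtain ⟨a, ha⟩ := hAeven
  obtain ⟨b, hb⟩ := hzero
  omega

/-- If the graph of faces with a common edge is connected, then so is some pairing: a pairing that
connects as many pairs of faces as possible connects them all, for otherwise two matched pairs at an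
edge could be exchanged. -/
theorem exists_connected_isPairing [Finite F] [Finite E] (J : V → E → Prop)
    (hI : ∀ e, Even {f | I e f}.ncard) (hJ : ∀ v f, Even {e | J v e ∧ I e f}.ncard)
    (hJE : ∀ e, ∃ v, J v e)
    (hconn : ∀ P : F → Prop, (∀ f g e, I e f → I e g → P f → P g) → ∀ f g, P f → P g) :
    ∃ σ, IsPairing I σ ∧ ∀ f g, Relation.ReflTransGen (Linked I σ Set.univ) f g := by
  classical
  let R : (E → F → F) → Set (F × F) := fun σ =>
    {x | Relation.ReflTransGen (Linked I σ Set.univ) x.1 x.2}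
  obtain ⟨σ, hσ, hmax⟩ := Set.exists_max_image {σ | IsPairing I σ} (fun σ => (R σ).ncard)
    (Set.toFinite _) (exists_isPairing hI)
  refine ⟨σ, hσ, fun f g => ?_⟩
  by_contra hfg
  obtain ⟨f₁, f₃, e, h₁, h₃, hf₁, hf₃⟩ : ∃ f₁ f₃ e, I e f₁ ∧ I e f₃ ∧
      Relation.ReflTransGen (Linked I σ Set.univ) f f₁ ∧
      ¬Relation.ReflTransGen (Linked I σ Set.univ) f f₃ := by
    by_contra! hcon
    exact hfg (hconn _ (fun f₁ f₃ e h₁ h₃ => hcon f₁ f₃ e h₁ h₃) f g Relation.ReflTransGen.refl)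
  have hn : ¬Relation.ReflTransGen (Linked I σ Set.univ) f₁ f₃ := fun h => hf₃ (hf₁.trans h)
  have hn' : ¬Relation.ReflTransGen (Linked I σ Set.univ) f₃ f₁ := fun h =>
    hn (hσ.reach_symm _ h)
  set f₂ := σ e f₁ with hf₂
  set f₄ := σ e f₃ with hf₄
  have h₂ : I e f₂ := hσ.incident e f₁ h₁
  have h₄ : I e f₄ := hσ.incident e f₃ h₃
  have e₂ : σ e f₂ = f₁ := hσ.involutive e f₁ h₁
  have e₄ : σ e f₄ = f₃ := hσ.involutive e f₃ h₃
  have l₁₂ : Linked I σ Set.univ f₁ f₂ := ⟨e, trivial, h₁, rfl⟩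
  have l₃₄ : Linked I σ Set.univ f₃ f₄ := ⟨e, trivial, h₃, rfl⟩
  have n₁₂ : f₂ ≠ f₁ := hσ.ne e f₁ h₁
  have n₃₄ : f₄ ≠ f₃ := hσ.ne e f₃ h₃
  have n₁₃ : f₁ ≠ f₃ := fun h => hn (h ▸ Relation.ReflTransGen.refl)
  have n₂₃ : f₂ ≠ f₃ := fun h => hn (h ▸ Relation.ReflTransGen.single l₁₂)
  have n₁₄ : f₁ ≠ f₄ := fun h => hn' (by rw [h]; exact Relation.ReflTransGen.single l₃₄)
  have n₂₄ : f₂ ≠ f₄ := fun h => n₁₃ (by rw [← e₂, h, e₄])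
  -- match `f₁` with `f₃` and `f₂` with `f₄` instead
  let σ' : E → F → F := fun e' g => if e' = e then
    (if g = f₁ then f₃ else if g = f₂ then f₄ else if g = f₃ then f₁ else if g = f₄ then f₂
      else σ e' g) else σ e' g
  have s₁ : σ' e f₁ = f₃ := by simp [σ']
  have s₂ : σ' e f₂ = f₄ := by simp [σ', n₁₂]
  have s₃ : σ' e f₃ = f₁ := by simp [σ', n₁₃.symm, n₂₃.symm]
  have s₄ : σ' e f₄ = f₂ := by simp [σ', n₁₄.symm, n₂₄.symm, n₃₄]
  have s₀ : ∀ e' g, (e' = e → g ≠ f₁ ∧ g ≠ f₂ ∧ g ≠ f₃ ∧ g ≠ f₄) → σ' e' g = σ e' g := by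
    intro e' g hg
    by_cases h : e' = e
    · obtain ⟨g1, g2, g3, g4⟩ := hg h
      simp [σ', g1, g2, g3, g4]
    · simp [σ', h]
  have hcase : ∀ e' g, (e' = e ∧ (g = f₁ ∨ g = f₂ ∨ g = f₃ ∨ g = f₄)) ∨
      (e' = e → g ≠ f₁ ∧ g ≠ f₂ ∧ g ≠ f₃ ∧ g ≠ f₄) := by
    intro e' g
    by_cases h : e' = e ∧ (g = f₁ ∨ g = f₂ ∨ g = f₃ ∨ g = f₄)
    · exact Or.inl h
    · right
      intro he
      simpa [he] using h
  have hσ' : IsPairing I σ' := by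
    refine ⟨fun e' g hg => ?_, fun e' g hg => ?_, fun e' g hg => ?_⟩
    · rcases hcase e' g with ⟨rfl, rfl | rfl | rfl | rfl⟩ | h
      · rwa [s₁]
      · rwa [s₂]
      · rwa [s₃]
      · rwa [s₄]
      · rw [s₀ _ _ h]; exact hσ.incident _ _ hg
    · rcases hcase e' g with ⟨rfl, rfl | rfl | rfl | rfl⟩ | h
      · rw [s₁]; exact n₁₃.symm
      · rw [s₂]; exact n₂₄.symm
      · rw [s₃]; exact n₁₃
      · rw [s₄]; exact n₂₄
      · rw [s₀ _ _ h]; exact hσ.ne _ _ hg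
    · rcases hcase e' g with ⟨rfl, rfl | rfl | rfl | rfl⟩ | h
      · rw [s₁, s₃]
      · rw [s₂, s₄]
      · rw [s₃, s₁]
      · rw [s₄, s₂]
      · rw [s₀ _ _ h, s₀ _ _ ?_, hσ.involutive _ _ hg]
        rintro rfl
        obtain ⟨g1, g2, g3, g4⟩ := h rfl
        have hinv := hσ.involutive _ _ hg
        refine ⟨fun h => g2 ?_, fun h => g1 ?_, fun h => g4 ?_, fun h => g3 ?_⟩
        · rw [← hinv, h]
        · rw [← hinv, h, e₂]
        · rw [← hinv, h]
        · rw [← hinv, h, e₄]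
  obtain ⟨v, hv⟩ := hJE e
  have r₁₂ : Relation.ReflTransGen (Linked I σ' Set.univ) f₁ f₂ :=
    hσ.reach_of_swap (hJ v) hv h₁ rfl h₃ rfl s₀ hn
  have r₃₄ : Relation.ReflTransGen (Linked I σ' Set.univ) f₃ f₄ :=
    hσ.reach_of_swap (hJ v) hv h₃ rfl h₁ rfl
      (fun e' g h => s₀ e' g fun he => ⟨(h he).2.2.1, (h he).2.2.2, (h he).1, (h he).2.1⟩) hn'
  have hlink : ∀ a b, Linked I σ Set.univ a b →
      Relation.ReflTransGen (Linked I σ' Set.univ) a b := by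
    rintro a b ⟨e', -, hIa, rfl⟩
    rcases hcase e' a with ⟨rfl, rfl | rfl | rfl | rfl⟩ | h
    · exact r₁₂
    · rw [e₂]; exact hσ'.reach_symm _ r₁₂
    · exact r₃₄
    · rw [e₄]; exact hσ'.reach_symm _ r₃₄
    · exact Relation.ReflTransGen.single ⟨e', trivial, hIa, s₀ _ _ h⟩
  have hsub : R σ ⊂ R σ' := by
    have hall : ∀ a b, Relation.ReflTransGen (Linked I σ Set.univ) a b →
        Relation.ReflTransGen (Linked I σ' Set.univ) a b := by
      intro a b hab
      induction hab with
      | refl => exact Relation.ReflTransGen.refl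
      | tail _ h₂ ih => exact ih.trans (hlink _ _ h₂)
    have hsub' : R σ ⊆ R σ' := fun x hx => hall _ _ hx
    exact (Set.ssubset_iff_of_subset hsub').mpr
      ⟨(f₁, f₃), Relation.ReflTransGen.single ⟨e, trivial, h₁, s₁⟩, hn⟩
  have h1 := hmax σ' hσ'
  have h2 := Set.ncard_lt_ncard hsub (Set.toFinite _)
  omega

end Pairing

/-! ### A complex all of whose edges have degree two and whose vertex links are connected -/

/-- For two involutions `τ`, `ρ` without fixed points, no iterate of `ρ ∘ τ` carries a
point `x` to `τ x` or `ρ x`: such a relation could be shortened to one that gives a fixed point of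
`τ` or `ρ`. -/
theorem iterate_ne_of_involutions {α : Type*} {τ ρ : α → α} (hτ : ∀ x, τ (τ x) = x)
    (hτ' : ∀ x, τ x ≠ x) (hρ : ∀ x, ρ (ρ x) = x) (hρ' : ∀ x, ρ x ≠ x) (k : ℕ) (x : α) :
    (ρ ∘ τ)^[k] x ≠ τ x ∧ (ρ ∘ τ)^[k] x ≠ ρ x := by
  induction k generalizing x with
  | zero => exact ⟨(hτ' x).symm, (hρ' x).symm⟩
  | succ k ih =>
    constructor
    · intro h
      rw [Function.iterate_succ_apply] at h
      refine (ih ((ρ ∘ τ) x)).2 (h.trans ?_)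
      simp [hρ]
    · intro h
      rw [Function.iterate_succ_apply'] at h
      refine (ih x).1 ?_
      have h1 := congrArg ρ h
      rw [Function.comp_apply, hρ, hρ] at h1
      exact (hτ _).symm.trans (congrArg τ h1)

/-- No two points of an orbit of `ρ ∘ τ` are exchanged by `τ` or `ρ`. -/
theorem iterate_ne_iterate_of_involutions {α : Type*} {τ ρ : α → α} (hτ : ∀ x, τ (τ x) = x)
    (hτ' : ∀ x, τ x ≠ x) (hρ : ∀ x, ρ (ρ x) = x) (hρ' : ∀ x, ρ x ≠ x) (k l : ℕ) (x : α) :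
    (ρ ∘ τ)^[k] x ≠ τ ((ρ ∘ τ)^[l] x) ∧ (ρ ∘ τ)^[k] x ≠ ρ ((ρ ∘ τ)^[l] x) := by
  rcases le_total l k with h | h
  · obtain ⟨d, rfl⟩ := Nat.exists_eq_add_of_le h
    rw [add_comm, Function.iterate_add_apply]
    exact iterate_ne_of_involutions hτ hτ' hρ hρ' d _
  · obtain ⟨d, rfl⟩ := Nat.exists_eq_add_of_le h
    rw [add_comm, Function.iterate_add_apply]
    have := iterate_ne_of_involutions hτ hτ' hρ hρ' d ((ρ ∘ τ)^[k] x)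
    refine ⟨fun h => this.1 ?_, fun h => this.2 ?_⟩
    · rw [h, hτ, ← h]
    · rw [h, hρ, ← h]

namespace TwoComplex

variable {X : Type u} [TopologicalSpace X] [T2Space X] {K : TwoComplex X}

theorem exists_halfEdge_at_vertex {e : Set X} (he : e ∈ K.edges) {p : X} (hp : p ∈ e)
    (hpV : p ∈ K.vertices) : ∃ η : ℝ → X, K.IsHalfEdge p η ∧ (∀ a, η a ∈ e) ∧
      ∀ a ∈ Set.Icc (0 : ℝ) 1, η a ∈ K.vertices → a = 0 := by
  obtain ⟨γ, hγ⟩ := K.edge_spec e he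
  have hhalf : (1 / 2 : ℝ) ∈ Set.Icc (0 : ℝ) 1 := by constructor <;> norm_num
  obtain ⟨s, hs, hsp⟩ : ∃ s : unitInterval, ((s : ℝ) = 0 ∨ (s : ℝ) = 1) ∧ (γ s : X) = p := by
    have : p ∈ e ∩ K.vertices := ⟨hp, hpV⟩
    rw [hγ] at this
    rcases this with h | h
    · exact ⟨0, Or.inl rfl, h.symm⟩
    · exact ⟨1, Or.inr rfl, h.symm⟩
  have hs2 : (s : ℝ) ≠ 1 / 2 := by rcases hs with h | h <;> rw [h] <;> norm_num
  have hη := isHalfEdge_affine he γ s.2 hhalf hs2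
  rw [Subtype.coe_eta, hsp] at hη
  refine ⟨_, hη, fun a => Subtype.coe_prop _, fun a ha haV => ?_⟩
  set t := Set.projIcc (0 : ℝ) 1 zero_le_one ((s : ℝ) + a * (1 / 2 - s)) with ht
  have htv : (t : ℝ) = (s : ℝ) + a * (1 / 2 - s) := by
    rw [ht, Set.projIcc_of_mem]
    rcases hs with h | h <;> rw [h] <;> constructor <;> linarith [ha.1, ha.2]
  have h1 : (γ t : X) ∈ e ∩ K.vertices := ⟨Subtype.coe_prop _, haV⟩
  rw [hγ] at h1
  have h2 : (t : ℝ) = 0 ∨ (t : ℝ) = 1 := by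
    rcases h1 with h | h
    · left; exact congrArg Subtype.val (γ.injective (Subtype.ext h))
    · right; exact congrArg Subtype.val (γ.injective (Subtype.ext h))
  rcases hs with h | h <;> rw [h] at htv <;> rcases h2 with h2 | h2 <;> linarith [ha.1, ha.2]

theorem exists_unique_other_edge {f e : Set X} (hf : f ∈ K.faces) {x : X} (hxV : x ∈ K.vertices)
    (he : e ∈ K.edges) (hxe : x ∈ e) (hef : e ⊆ f) :
    ∃ e' ∈ K.edges, x ∈ e' ∧ e' ⊆ f ∧ e' ≠ e ∧
      ∀ e'' ∈ K.edges, x ∈ e'' → e'' ⊆ f → e'' ≠ e → e'' = e' := by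
  obtain ⟨a, b, hab, h⟩ := exists_edges_at_corner hf (hef hxe) hxV
  have hmem : ∀ c, c ∈ K.edges ∧ x ∈ c ∧ c ⊆ f ↔ c = a ∨ c = b := fun c => by
    have : c ∈ {e | e ∈ K.edges ∧ x ∈ e ∧ e ⊆ f} ↔ c ∈ ({a, b} : Set (Set X)) := by rw [h]
    exact this
  have ha := (hmem a).mpr (Or.inl rfl)
  have hb := (hmem b).mpr (Or.inr rfl)
  rcases (hmem e).mp ⟨he, hxe, hef⟩ with rfl | rfl
  · exact ⟨b, hb.1, hb.2.1, hb.2.2, hab.symm, fun c hc hxc hcf hne =>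
      ((hmem c).mp ⟨hc, hxc, hcf⟩).resolve_left hne⟩
  · exact ⟨a, ha.1, ha.2.1, ha.2.2, hab, fun c hc hxc hcf hne =>
      ((hmem c).mp ⟨hc, hxc, hcf⟩).resolve_right hne⟩

theorem exists_unique_other_face {f e : Set X} (hdeg : K.degree e = 2) (hf : f ∈ K.faces)
    (hef : e ⊆ f) : ∃ g ∈ K.faces, e ⊆ g ∧ g ≠ f ∧ ∀ g' ∈ K.faces, e ⊆ g' → g' ≠ f → g' = g := by
  obtain ⟨a, b, hab, h⟩ := Set.ncard_eq_two.mp hdeg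
  have hmem : ∀ c, c ∈ K.faces ∧ e ⊆ c ↔ c = a ∨ c = b := fun c => by
    have : c ∈ {f | f ∈ K.faces ∧ e ⊆ f} ↔ c ∈ ({a, b} : Set (Set X)) := by rw [h]
    exact this
  have ha := (hmem a).mpr (Or.inl rfl)
  have hb := (hmem b).mpr (Or.inr rfl)
  rcases (hmem f).mp ⟨hf, hef⟩ with rfl | rfl
  · exact ⟨b, hb.1, hb.2, hab.symm, fun c hc hec hne => ((hmem c).mp ⟨hc, hec⟩).resolve_left hne⟩
  · exact ⟨a, ha.1, ha.2, hab, fun c hc hec hne => ((hmem c).mp ⟨hc, hec⟩).resolve_right hne⟩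

theorem exists_face_of_degree_eq_two {e : Set X} (hdeg : K.degree e = 2) :
    ∃ f ∈ K.faces, e ⊆ f := by
  obtain ⟨a, b, -, h⟩ := Set.ncard_eq_two.mp hdeg
  have : a ∈ {f | f ∈ K.faces ∧ e ⊆ f} := h ▸ Or.inl rfl
  exact ⟨a, this⟩

/-- A face contains a disk around each of its interior points. -/
theorem exists_open_disk_of_notMem_skeleton {f : Set X} (hf : f ∈ K.faces) {x : K.space}
    (hx : (x : X) ∈ f) (hxK : (x : X) ∉ K.skeleton) :
    ∃ U : Set K.space, IsOpen U ∧ x ∈ U ∧ Nonempty (U ≃ₜ Metric.ball (0 : ℂ) 1) := by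
  classical
  obtain ⟨G, hG⟩ := exists_homeomorph_face hf
  obtain ⟨W, hW, hxW, hWV, hWE, hWF⟩ := K.exists_isOpen_cells (x : X)
  set z₀ : ℂ := ((G.symm ⟨x, hx⟩ : Metric.closedBall (0 : ℂ) 1) : ℂ) with hz₀
  have hz₀1 : ‖z₀‖ < 1 := by
    refine lt_of_le_of_ne (mem_closedBall_zero_iff.mp (Subtype.coe_prop _)) fun h => hxK ?_
    have := (hG _).mp h
    rwa [Homeomorph.apply_symm_apply] at this
  set r := 1 - ‖z₀‖ with hr
  have hr0 : 0 < r := by linarith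
  have hrc : (r : ℂ) ≠ 0 := by exact_mod_cast hr0.ne'
  have hb : ∀ z ∈ Metric.closedBall (0 : ℂ) 1, z₀ + r * z ∈ Metric.closedBall (0 : ℂ) 1 :=
    fun z hz => by
      rw [mem_closedBall_zero_iff] at hz ⊢
      refine (norm_add_le _ _).trans ?_
      rw [norm_mul, Complex.norm_real, Real.norm_of_nonneg hr0.le]
      nlinarith
  let Ψ : ℂ → X := fun z => if hz : z ∈ Metric.closedBall (0 : ℂ) 1 then
    (G ⟨z₀ + r * z, hb z hz⟩ : X) else x
  have hΨ : ∀ z (hz : z ∈ Metric.closedBall (0 : ℂ) 1), Ψ z = G ⟨z₀ + r * z, hb z hz⟩ :=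
    fun z hz => dif_pos hz
  let g : f → ℂ := fun y => ((G.symm y : Metric.closedBall (0 : ℂ) 1) : ℂ)
  have hg : Continuous g := continuous_subtype_val.comp G.symm.continuous
  obtain ⟨W', hW', hWe⟩ := isOpen_induced_iff.mp (Metric.isOpen_ball.preimage hg :
    IsOpen (g ⁻¹' Metric.ball z₀ r))
  refine exists_open_disk (Ψ := Ψ) ?_ ?_ ?_ ?_ (hW.inter hW') ⟨hxW, ?_⟩ ?_
  · rw [continuousOn_iff_continuous_domRestrict]
    have : Set.domRestrict (Metric.closedBall (0 : ℂ) 1) Ψ =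
        fun z : Metric.closedBall (0 : ℂ) 1 => (G ⟨z₀ + r * z, hb z z.2⟩ : X) :=
      funext fun z => hΨ z z.2
    rw [this]
    exact continuous_subtype_val.comp (G.continuous.comp (Continuous.subtype_mk (by fun_prop) _))
  · intro z hz w hw hzw
    rw [hΨ z hz, hΨ w hw] at hzw
    have h1 := congrArg Subtype.val (G.injective (Subtype.ext hzw))
    exact mul_left_cancel₀ hrc (add_left_cancel h1)
  · intro z hz
    rw [hΨ z hz]
    exact face_subset_space hf (Subtype.coe_prop _)
  · rw [hΨ 0 (by simp)]
    simp [hz₀]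
  · have : (⟨x, hx⟩ : f) ∈ g ⁻¹' Metric.ball z₀ r := Metric.mem_ball_self hr0
    rw [← hWe] at this
    exact this
  · rintro y ⟨⟨hyW, hyW'⟩, (hyV | ⟨e, he, hye⟩) | ⟨f', hf', hyf'⟩⟩
    · exact absurd (Or.inl (hWV y hyW hyV ▸ hyV)) hxK
    · exact absurd (K.subset_skeleton he (hWE e he y hyW hye)) hxK
    · have hff' : f' = f := face_eq_of_mem hf' hf (hWF f' hf' y hyW hyf') hx hxK
      subst hff'
      have h1 : (⟨y, hyf'⟩ : f') ∈ g ⁻¹' Metric.ball z₀ r := by rw [← hWe]; exact hyW'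
      rw [Set.mem_preimage, Metric.mem_ball, dist_eq_norm] at h1
      have hz : (g ⟨y, hyf'⟩ - z₀) / r ∈ Metric.closedBall (0 : ℂ) 1 := by
        rw [mem_closedBall_zero_iff, norm_div, Complex.norm_real, Real.norm_of_nonneg hr0.le,
          div_le_one hr0]
        exact h1.le
      refine ⟨_, hz, ?_⟩
      rw [hΨ _ hz]
      have h2 : z₀ + r * ((g ⟨y, hyf'⟩ - z₀) / r) = g ⟨y, hyf'⟩ := by
        field_simp; ring
      simp only [h2]
      simp [g]

/-- Two faces at an edge give a star of two sectors around each interior point of the edge. -/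
theorem exists_open_disk_of_mem_edge (hdeg : ∀ e ∈ K.edges, K.degree e = 2) {e : Set X}
    (he : e ∈ K.edges) {x : K.space} (hx : (x : X) ∈ e) (hxV : (x : X) ∉ K.vertices) :
    ∃ U : Set K.space, IsOpen U ∧ x ∈ U ∧ Nonempty (U ≃ₜ Metric.ball (0 : ℂ) 1) := by
  obtain ⟨f, hf, hef⟩ := exists_face_of_degree_eq_two (hdeg e he)
  obtain ⟨g, hg, heg, hgf, huniq⟩ := exists_unique_other_face (hdeg e he) hf hef
  obtain ⟨η, η', hη, hη', hηe, hηe', hdisj⟩ := exists_halfEdges_of_mem_edge he hx hxV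
  have hsec : ∀ f ∈ K.faces, e ⊆ f → ∃ ψ, K.IsSector f η η' ψ := fun f hf hef => by
    obtain ⟨q, hq, hqK, hqe, -⟩ := exists_mem_skeleton_notMem_edge hf he he
    exact exists_isSector hf hq hqK hη hη'
      (fun a _ => ⟨hef (hηe a), fun h => hqe (h ▸ hηe a)⟩)
      (fun a _ => ⟨hef (hηe' a), fun h => hqe (h ▸ hηe' a)⟩)
      fun a ha b hb h => (hdisj a ha b hb h).1
  obtain ⟨ψ, hψ⟩ := hsec f hf hef
  obtain ⟨χ, hχ⟩ := hsec g hg heg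
  have hstar := isStar_two hf hg hgf.symm hη hη' hdisj hψ
    (hχ.swap (by rw [hη.map_zero, hη'.map_zero]))
  obtain ⟨W, hW, hxW, hWV, hWE, hWF⟩ := K.exists_isOpen_cells (x : X)
  refine hstar.exists_open_disk hW hxW ?_ rfl
  have hcov : ∀ y ∈ W ∩ K.space, y ∈ f ∨ y ∈ g := by
    rintro y ⟨hyW, (hyV | ⟨e', he', hye'⟩) | ⟨f', hf', hyf'⟩⟩
    · exact absurd (hWV y hyW hyV ▸ hyV) hxV
    · left
      rw [← K.edge_eq_of_mem he he' hx (hWE e' he' y hyW hye') hxV] at hye'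
      exact hef hye'
    · have hef' := edge_subset_of_mem_face he hf' hx hxV (hWF f' hf' y hyW hyf')
      by_cases h : f' = f
      · exact Or.inl (h ▸ hyf')
      · exact Or.inr (huniq f' hf' hef' h ▸ hyf')
  intro y hy
  rw [Set.mem_iUnion₂]
  rcases hcov y hy with h | h
  · exact ⟨0, by norm_num, by simpa using h⟩
  · exact ⟨1, by norm_num, by simpa using h⟩

/-- Around a vertex, the faces form a cycle in which consecutive faces share an edge: it is an orbit
of the permutation of the incident pairs of a face and an edge at the vertex that replaces first
the edge by the other edge of the face and then the face by the other face at that edge. -/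
theorem exists_open_disk_of_mem_vertices (hdeg : ∀ e ∈ K.edges, K.degree e = 2) {x : K.space}
    (hxV : (x : X) ∈ K.vertices) (hface : ∃ f ∈ K.faces, (x : X) ∈ f)
    (hlink : ∀ P : Set X → Prop, (∀ f ∈ K.faces, ∀ g ∈ K.faces, ∀ e ∈ K.edges, (x : X) ∈ e →
      e ⊆ f → e ⊆ g → P f → P g) →
      ∀ f ∈ K.faces, ∀ g ∈ K.faces, (x : X) ∈ f → (x : X) ∈ g → P f → P g) :
    ∃ U : Set K.space, IsOpen U ∧ x ∈ U ∧ Nonempty (U ≃ₜ Metric.ball (0 : ℂ) 1) := by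
  classical
  let Flag := {y : Set X × Set X // y.1 ∈ K.faces ∧ y.2 ∈ K.edges ∧ (x : X) ∈ y.2 ∧ y.2 ⊆ y.1}
  have hfin : Finite Flag := ((K.finite_faces.prod K.finite_edges).subset
    fun y hy => ⟨hy.1, hy.2.1⟩ : {y : Set X × Set X | y.1 ∈ K.faces ∧ y.2 ∈ K.edges ∧
      (x : X) ∈ y.2 ∧ y.2 ⊆ y.1}.Finite).to_subtype
  choose oe hoe hxoe hoef hoene hoeuniq using fun y : Flag =>
    exists_unique_other_edge y.2.1 hxV y.2.2.1 y.2.2.2.1 y.2.2.2.2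
  choose og hog heog hogne hoguniq using fun y : Flag =>
    exists_unique_other_face (hdeg _ y.2.2.1) y.2.1 y.2.2.2.2
  let τ : Flag → Flag := fun y => ⟨(y.1.1, oe y), y.2.1, hoe y, hxoe y, hoef y⟩
  let ρ : Flag → Flag := fun y => ⟨(og y, y.1.2), hog y, y.2.2.1, y.2.2.2.1, heog y⟩
  have hτ : ∀ y, τ (τ y) = y := fun y => by
    refine Subtype.ext (Prod.ext rfl ?_)
    exact (hoeuniq (τ y) y.1.2 y.2.2.1 y.2.2.2.1 y.2.2.2.2 (hoene y).symm).symm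
  have hτ' : ∀ y, τ y ≠ y := fun y h => hoene y (congrArg (fun z : Flag => z.1.2) h)
  have hρ : ∀ y, ρ (ρ y) = y := fun y => by
    refine Subtype.ext (Prod.ext ?_ rfl)
    exact (hoguniq (ρ y) y.1.1 y.2.1 y.2.2.2.2 (hogne y).symm).symm
  have hρ' : ∀ y, ρ y ≠ y := fun y h => hogne y (congrArg (fun z : Flag => z.1.1) h)
  -- flags with the same face, or the same edge, are equal or exchanged by an involution
  have hsameF : ∀ y z : Flag, y.1.1 = z.1.1 → y = z ∨ y = τ z := fun y z h => by
    by_cases he : y.1.2 = z.1.2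
    · exact Or.inl (Subtype.ext (Prod.ext h he))
    · exact Or.inr (Subtype.ext (Prod.ext h
        (hoeuniq z _ y.2.2.1 y.2.2.2.1 (h ▸ y.2.2.2.2) he)))
  have hsameE : ∀ y z : Flag, y.1.2 = z.1.2 → y = z ∨ y = ρ z := fun y z h => by
    by_cases he : y.1.1 = z.1.1
    · exact Or.inl (Subtype.ext (Prod.ext he h))
    · exact Or.inr (Subtype.ext (Prod.ext (hoguniq z _ y.2.1 (h ▸ y.2.2.2.2) he) h))
  obtain ⟨f₀, hf₀, hxf₀⟩ := hface
  obtain ⟨e₀, he₀, hxe₀, hef₀⟩ := exists_edge_of_mem_face hf₀ hxf₀ (Or.inl hxV)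
  let y₀ : Flag := ⟨(f₀, e₀), hf₀, he₀, hxe₀, hef₀⟩
  let N : Flag → Flag := ρ ∘ τ
  let y : ℕ → Flag := fun k => N^[k] y₀
  have hN : Function.Injective N := fun a b hab => by
    have h1 := congrArg ρ hab
    simp only [N, Function.comp_apply, hρ] at h1
    have h2 := congrArg τ h1
    rwa [hτ, hτ] at h2
  set m := Function.minimalPeriod N y₀ with hm
  have hm0 : 0 < m := Function.minimalPeriod_pos_of_mem_periodicPts (hN.mem_periodicPts y₀)
  have hymod : ∀ k, y (k % m) = y k := fun k => Function.iterate_mod_minimalPeriod_eq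
  have hyinj : ∀ k < m, ∀ l < m, y k = y l → k = l := fun k hk l hl h =>
    Function.iterate_injOn_Iio_minimalPeriod hk hl h
  have hysucc : ∀ k, y (k + 1) = ρ (τ (y k)) := fun k => Function.iterate_succ_apply' N k y₀
  have hyne : ∀ k l, y k ≠ τ (y l) ∧ y k ≠ ρ (y l) := fun k l =>
    iterate_ne_iterate_of_involutions hτ hτ' hρ hρ' k l y₀
  have hedge : ∀ k, (y (k + 1)).1.2 = oe (y k) := fun k => by rw [hysucc]
  have hexη : ∀ e, ∃ η : ℝ → X, e ∈ K.edges ∧ (x : X) ∈ e → K.IsHalfEdge (x : X) η ∧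
      (∀ a, η a ∈ e) ∧ ∀ a ∈ Set.Icc (0 : ℝ) 1, η a ∈ K.vertices → a = 0 := fun e => by
    by_cases he : e ∈ K.edges ∧ (x : X) ∈ e
    · obtain ⟨η, h⟩ := exists_halfEdge_at_vertex he.1 he.2 hxV
      exact ⟨η, fun _ => h⟩
    · exact ⟨fun _ => x, fun h => absurd h he⟩
  choose η hηall using hexη
  have hη := fun e he => (hηall e he).1
  have hηe := fun e he => (hηall e he).2.1
  have hηV := fun e he => (hηall e he).2.2
  have hyE : ∀ k, (y k).1.2 ∈ K.edges ∧ (x : X) ∈ (y k).1.2 := fun k =>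
    ⟨(y k).2.2.1, (y k).2.2.2.1⟩
  have hnext : ∀ k, (y (k + 1)).1.2 ⊆ (y k).1.1 := fun k => by rw [hedge]; exact hoef _
  have hcross : ∀ {e e' : Set X}, e ∈ K.edges ∧ (x : X) ∈ e → e' ∈ K.edges ∧ (x : X) ∈ e' →
      e ≠ e' → ∀ a ∈ Set.Icc (0 : ℝ) 1, ∀ b ∈ Set.Icc (0 : ℝ) 1, η e a = η e' b →
      a = 0 ∧ b = 0 := by
    intro e e' he he' hne a ha b hb hab
    have hV : η e a ∈ K.vertices :=
      K.edges_inter e he.1 e' he'.1 hne ⟨hηe e he a, hab ▸ hηe e' he' b⟩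
    exact ⟨hηV e he a ha hV, hηV e' he' b hb (hab ▸ hV)⟩
  have hsec : ∀ k, ∃ ψ, K.IsSector (y k).1.1 (η (y k).1.2) (η (y (k + 1)).1.2) ψ := fun k => by
    obtain ⟨q, hq, hqK, hqe, hqe'⟩ :=
      exists_mem_skeleton_notMem_edge (y k).2.1 (hyE k).1 (hyE (k + 1)).1
    refine exists_isSector (y k).2.1 hq hqK (hη _ (hyE k)) (hη _ (hyE (k + 1)))
      (fun a _ => ⟨(y k).2.2.2.2 (hηe _ (hyE k) a), fun h => hqe (h ▸ hηe _ (hyE k) a)⟩)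
      (fun a _ => ⟨hnext k (hηe _ (hyE (k + 1)) a), fun h => hqe' (h ▸ hηe _ (hyE (k + 1)) a)⟩)
      fun a ha b hb h => (hcross (hyE k) (hyE (k + 1)) ?_ a ha b hb h).1
    rw [hedge]
    exact (hoene _).symm
  choose ψ hψ using hsec
  have hstar : K.IsStar (x : X) m (fun k => (y k).1.1) (fun k => η (y k).1.2) ψ := by
    refine ⟨hm0, fun k => (y k).2.1, ?_, fun k => hη _ (hyE k), fun k => ?_, ?_, hψ⟩
    · intro k hk l hl h
      exact hyinj k hk l hl ((hsameF _ _ h).resolve_right (hyne k l).1)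
    · simp only [hymod]
    · intro k hk l hl a ha b hb h
      by_cases he : (y k).1.2 = (y l).1.2
      · have hkl := hyinj k hk l hl ((hsameE _ _ he).resolve_right (hyne k l).2)
        subst hkl
        exact ⟨(hη _ (hyE k)).injOn ha hb h, Or.inr rfl⟩
      · obtain ⟨rfl, rfl⟩ := hcross (hyE k) (hyE l) he a ha b hb h
        exact ⟨rfl, Or.inl rfl⟩
  -- every face at the vertex belongs to the cycle
  have hall : ∀ f ∈ K.faces, (x : X) ∈ f → ∃ k, (y k).1.1 = f := by
    intro f hf hxf
    refine hlink (fun f => ∃ k, (y k).1.1 = f) ?_ f₀ hf₀ f hf hxf₀ hxf ⟨0, rfl⟩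
    rintro _ - g hg e he hxe hef heg ⟨k, rfl⟩
    by_cases hgf : g = (y k).1.1
    · exact ⟨k, hgf.symm⟩
    by_cases hek : e = (y k).1.2
    · subst hek
      have h1 : y (k + m - 1 + 1) = y k := by
        rw [Nat.sub_add_cancel (by omega), ← hymod, Nat.add_mod_right, hymod]
      refine ⟨k + m - 1, ?_⟩
      have h2 : ρ (y k) = τ (y (k + m - 1)) := by rw [← h1, hysucc, hρ]
      have h3 : og (y k) = (y (k + m - 1)).1.1 := congrArg (fun z : Flag => z.1.1) h2
      rw [← h3]
      exact (hoguniq (y k) g hg heg hgf).symm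
    · refine ⟨k + 1, ?_⟩
      have h1 := hoeuniq (y k) e he hxe hef hek
      subst h1
      rw [hysucc]
      exact (hoguniq (τ (y k)) g hg heg hgf).symm
  obtain ⟨W, hW, hxW, hWV, hWE, hWF⟩ := K.exists_isOpen_cells (x : X)
  refine hstar.exists_open_disk hW hxW ?_ rfl
  have hcov : ∀ f ∈ K.faces, (x : X) ∈ f → ∀ z ∈ f, z ∈ ⋃ k < m, (y k).1.1 := by
    intro f hf hxf z hz
    obtain ⟨k, rfl⟩ := hall f hf hxf
    exact Set.mem_iUnion₂.mpr ⟨k % m, Nat.mod_lt _ hm0, by rwa [hymod]⟩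
  rintro z ⟨hzW, (hzV | ⟨e, he, hze⟩) | ⟨f, hf, hzf⟩⟩
  · rw [hWV z hzW hzV]
    exact hcov f₀ hf₀ hxf₀ _ hxf₀
  · obtain ⟨f, hf, hef⟩ := exists_face_of_degree_eq_two (hdeg e he)
    exact hcov f hf (hef (hWE e he z hzW hze)) z (hef hze)
  · exact hcov f hf (hWF f hf z hzW hzf) z hzf

/-- A complex is a surface if each of its edges lies in two faces and the faces at each vertex are
connected through their common edges at that vertex. -/
theorem isSurface_of_degree_eq_two (hdeg : ∀ e ∈ K.edges, K.degree e = 2)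
    (hface : ∀ x ∈ K.vertices, ∃ f ∈ K.faces, x ∈ f)
    (hlink : ∀ x ∈ K.vertices, ∀ P : Set X → Prop,
      (∀ f ∈ K.faces, ∀ g ∈ K.faces, ∀ e ∈ K.edges, x ∈ e → e ⊆ f → e ⊆ g → P f → P g) →
      ∀ f ∈ K.faces, ∀ g ∈ K.faces, x ∈ f → x ∈ g → P f → P g) : K.IsSurface := by
  intro x
  by_cases hxV : (x : X) ∈ K.vertices
  · exact exists_open_disk_of_mem_vertices hdeg hxV (hface x hxV) (hlink x hxV)
  · by_cases hxE : (x : X) ∈ K.skeleton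
    · obtain ⟨e, he, hxe⟩ := hxE.resolve_left hxV
      exact exists_open_disk_of_mem_edge hdeg he hxe hxV
    · obtain ⟨f, hf, hxf⟩ := x.2.resolve_left hxE
      exact exists_open_disk_of_notMem_skeleton hf hxf hxE

end TwoComplex

namespace TwoComplex

variable {X : Type u} [TopologicalSpace X] [T2Space X] {K : TwoComplex X}

/-! ### Gluing the faces along a pairing -/

/-- The incidence relation of edges and faces. -/
def Incident (K : TwoComplex X) (e : K.edges) (f : K.faces) : Prop := (e : Set X) ⊆ f

/-- The edges through a point. -/
def edgesAt (K : TwoComplex X) (x : X) : Set K.edges := {e | x ∈ (e : Set X)}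

/-- The equivalence relation on the disjoint union of the faces that identifies the points of
matched faces along the edges at which they are matched: two copies of a point `x` are equivalent if
their faces are connected by links at edges through `x`. -/
def gluing {σ : K.edges → K.faces → K.faces} (h : IsPairing K.Incident σ) :
    Setoid (Σ f : K.faces, (f : Set X)) where
  r p q := (p.2 : X) = q.2 ∧ Relation.ReflTransGen (Linked K.Incident σ (K.edgesAt p.2)) p.1 q.1
  iseqv := by
    refine ⟨fun p => ⟨rfl, Relation.ReflTransGen.refl⟩, ?_, ?_⟩
    · rintro p q ⟨h₁, h₂⟩
      exact ⟨h₁.symm, h.reach_symm _ (h₁ ▸ h₂)⟩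
    · rintro p q r ⟨h₁, h₂⟩ ⟨h₃, h₄⟩
      exact ⟨h₁.trans h₃, h₂.trans (h₁ ▸ h₄)⟩

/-- The space obtained by gluing the faces of `K` along a pairing. -/
def Glued {σ : K.edges → K.faces → K.faces} (h : IsPairing K.Incident σ) : Type u :=
  Quotient (gluing h)

namespace Glued

variable {σ : K.edges → K.faces → K.faces} {h : IsPairing K.Incident σ}

instance : TopologicalSpace (Glued h) := inferInstanceAs (TopologicalSpace (Quotient (gluing h)))

/-- The inclusion of a face in the glued space. -/
def sheet (h : IsPairing K.Incident σ) (f : K.faces) (x : (f : Set X)) : Glued h :=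
  Quotient.mk (gluing h) ⟨f, x⟩

/-- The projection of the glued space to `X`. -/
def proj (y : Glued h) : X :=
  Quotient.lift (s := gluing h) (fun p => (p.2 : X)) (fun _ _ hpq => hpq.1) y

theorem continuous_sheet (f : K.faces) : Continuous (sheet h f) :=
  continuous_quotient_mk'.comp continuous_sigmaMk

theorem continuous_proj : Continuous (proj : Glued h → X) :=
  Continuous.quotient_lift (s := gluing h)
    (continuous_sigma fun _ => continuous_subtype_val) _

theorem exists_sheet_eq (y : Glued h) : ∃ f x, y = sheet h f x := by
  obtain ⟨⟨f, x⟩, rfl⟩ := Quotient.exists_rep y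
  exact ⟨f, x, rfl⟩

theorem sheet_eq_iff {f g : K.faces} {x : (f : Set X)} {y : (g : Set X)} :
    sheet h f x = sheet h g y ↔ (x : X) = y ∧
      Relation.ReflTransGen (Linked K.Incident σ (K.edgesAt x)) f g :=
  Quotient.eq (r := gluing h)

/-- Faces that are connected by links at edges through `x` all contain `x`, if one of them does. -/
theorem mem_of_reach {f g : K.faces} {x : X} (hx : x ∈ (f : Set X))
    (hfg : Relation.ReflTransGen (Linked K.Incident σ (K.edgesAt x)) f g)
    (h : IsPairing K.Incident σ) : x ∈ (g : Set X) := by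
  induction hfg with
  | refl => exact hx
  | tail _ hl _ =>
    obtain ⟨e, hxe, hI, rfl⟩ := hl
    exact h.incident e _ hI hxe

/-- At a point that lies in the interior of an edge, only the two faces matched at that edge are
connected. -/
theorem eq_or_eq_of_reach (h : IsPairing K.Incident σ) {f g : K.faces} {x : X} {e : K.edges}
    (hxe : x ∈ (e : Set X)) (hxV : x ∉ K.vertices) (hef : K.Incident e f)
    (hfg : Relation.ReflTransGen (Linked K.Incident σ (K.edgesAt x)) f g) :
    g = f ∨ g = σ e f := by
  induction hfg with
  | refl => exact Or.inl rfl
  | tail _ hl ih =>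
    obtain ⟨e', hxe', hI, rfl⟩ := hl
    have hee' : e' = e := Subtype.ext (K.edge_eq_of_mem e'.2 e.2 hxe' hxe hxV)
    subst hee'
    rcases ih with rfl | rfl
    · exact Or.inr rfl
    · exact Or.inl (h.involutive _ _ hef)

theorem isClosedMap_mk (h : IsPairing K.Incident σ) :
    IsClosedMap (Quotient.mk (gluing h) : _ → Glued h) := by
  have := K.finite_faces.to_subtype
  have := K.finite_edges.to_subtype
  intro C hC
  have hq : Topology.IsQuotientMap (Quotient.mk (gluing h) : _ → Glued h) :=
    isQuotientMap_quotient_mk'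
  rw [← hq.isClosed_preimage, isClosed_sigma_iff]
  intro g
  -- a copy of `x` in `f` and its copy in `g` are identified along finitely many edges at a time
  have key : Sigma.mk g ⁻¹' (Quotient.mk (gluing h) ⁻¹' (Quotient.mk (gluing h) '' C)) =
      ⋃ f : K.faces, ⋃ T : {T : Set K.edges // Relation.ReflTransGen (Linked K.Incident σ T) f g},
        {x : (g : Set X) | (x : X) ∈
          (Subtype.val : ↥(f : Set X) → X) ''
            (Sigma.mk (β := fun f : K.faces => ↥(f : Set X)) f ⁻¹' C) ∩
          ⋂ e ∈ T.1, (e : Set X)} := by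
    ext x
    simp only [Set.mem_preimage, Set.mem_iUnion, Set.mem_image, Set.mem_ofPred_eq,
      Set.mem_inter_iff, Set.mem_iInter]
    constructor
    · rintro ⟨⟨f, y⟩, hy, hyx⟩
      obtain ⟨h₁, h₂⟩ := Quotient.exact hyx
      exact ⟨f, ⟨_, h₂⟩, ⟨y, hy, h₁⟩, fun e he => h₁ ▸ he⟩
    · rintro ⟨f, ⟨T, hT⟩, ⟨y, hy, hyx⟩, hxT⟩
      refine ⟨⟨f, y⟩, hy, Quotient.sound ⟨hyx, Relation.ReflTransGen.mono ?_ _ _ hT⟩⟩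
      rintro f' g' ⟨e, he, hI⟩
      exact ⟨e, show (y : X) ∈ (e : Set X) from hyx ▸ hxT e he, hI⟩
  rw [key]
  refine isClosed_iUnion_of_finite fun f => isClosed_iUnion_of_finite fun T => ?_
  refine IsClosed.preimage continuous_subtype_val (IsClosed.inter ?_ ?_)
  · exact (K.face_isCompact f.2).isClosed.isClosedEmbedding_subtypeVal.isClosedMap _
      (hC.preimage continuous_sigmaMk)
  · exact isClosed_biInter fun e _ => (K.edge_isCompact e.2).isClosed

/-- A quotient of a compact Hausdorff space by a closed map is Hausdorff. -/
instance : T2Space (Glued h) := by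
  have := K.finite_faces.to_subtype
  have := fun f : K.faces => isCompact_iff_compactSpace.mp (K.face_isCompact f.2)
  have hc : Continuous (Quotient.mk (gluing h) : _ → Glued h) := continuous_quotient_mk'
  have hcl : ∀ y : Glued h, IsClosed (Quotient.mk (gluing h) ⁻¹' {y}) := by
    intro y
    obtain ⟨p, rfl⟩ := Quotient.exists_rep y
    have := (isClosedMap_mk h _ (isClosed_singleton (x := p))).preimage hc
    rwa [Set.image_singleton] at this
  refine ⟨fun y z hyz => ?_⟩
  obtain ⟨U, V, hU, hV, hyU, hzV, hUV⟩ := normal_separation (hcl y) (hcl z)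
    (Disjoint.preimage _ (Set.disjoint_singleton.mpr hyz))
  refine ⟨(Quotient.mk (gluing h) '' Uᶜ)ᶜ, (Quotient.mk (gluing h) '' Vᶜ)ᶜ,
    (isClosedMap_mk h _ hU.isClosed_compl).isOpen_compl,
    (isClosedMap_mk h _ hV.isClosed_compl).isOpen_compl, ?_, ?_, ?_⟩
  · rintro ⟨p, hp, hpy⟩
    exact hp (hyU hpy)
  · rintro ⟨p, hp, hpy⟩
    exact hp (hzV hpy)
  · rw [Set.disjoint_left]
    intro w hwU hwV
    obtain ⟨p, rfl⟩ := Quotient.exists_rep w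
    have hpU : p ∈ U := by_contra fun hp => hwU ⟨p, hp, rfl⟩
    have hpV : p ∈ V := by_contra fun hp => hwV ⟨p, hp, rfl⟩
    exact Set.disjoint_left.mp hUV hpU hpV

/-- The copy of the set `s` in the sheet of the face `f`. -/
def lift (h : IsPairing K.Incident σ) (f : K.faces) (s : Set X) : Set (Glued h) :=
  sheet h f '' {x | (x : X) ∈ s}

theorem lift_mono (f : K.faces) {s t : Set X} (hst : s ⊆ t) : lift h f s ⊆ lift h f t :=
  Set.image_mono fun _ hx => hst hx

theorem proj_mem_of_mem_lift {f : K.faces} {s : Set X} {y : Glued h} (hy : y ∈ lift h f s) :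
    proj y ∈ s := by
  obtain ⟨x, hx, rfl⟩ := hy
  exact hx

theorem sheet_mem_lift {f : K.faces} {s : Set X} {x : (f : Set X)} :
    sheet h f x ∈ lift h f s ↔ (x : X) ∈ s :=
  ⟨proj_mem_of_mem_lift, fun hx => ⟨x, hx, rfl⟩⟩

/-- The projection identifies the copy of `s` with `s`. -/
def homeomorphLift (h : IsPairing K.Incident σ) {f : K.faces} {s : Set X} (hs : s ⊆ f) :
    lift h f s ≃ₜ s where
  toFun y := ⟨proj y.1, proj_mem_of_mem_lift y.2⟩
  invFun x := ⟨sheet h f ⟨x, hs x.2⟩, ⟨_, x.2, rfl⟩⟩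
  left_inv := by rintro ⟨_, ⟨x, hx, rfl⟩⟩; rfl
  right_inv _ := rfl
  continuous_toFun := (continuous_proj.comp continuous_subtype_val).subtype_mk _
  continuous_invFun := ((continuous_sheet f).comp
    (continuous_subtype_val.subtype_mk _)).subtype_mk _

theorem restrictsToHomeomorph_lift {f : K.faces} {s : Set X} (hs : s ⊆ f) :
    RestrictsToHomeomorph proj (lift h f s) s :=
  ⟨homeomorphLift h hs, fun _ => rfl⟩

theorem sheet_eq_of_mem_edge {e : K.edges} {f : K.faces} (hef : K.Incident e f)
    {x : X} (hx : x ∈ (e : Set X)) :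
    sheet h f ⟨x, hef hx⟩ = sheet h (σ e f) ⟨x, h.incident e f hef hx⟩ :=
  sheet_eq_iff.mpr ⟨rfl, Relation.ReflTransGen.single ⟨e, hx, hef, rfl⟩⟩

theorem lift_eq_lift {e : K.edges} {f : K.faces} (hef : K.Incident e f) :
    lift h f e = lift h (σ e f) e := by
  ext y
  constructor
  · rintro ⟨x, hx, rfl⟩
    exact ⟨⟨x, h.incident e f hef hx⟩, hx, (sheet_eq_of_mem_edge hef hx).symm⟩
  · rintro ⟨x, hx, rfl⟩
    exact ⟨⟨x, hef hx⟩, hx, sheet_eq_of_mem_edge hef hx⟩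

/-- Two sheets meet only along edges. -/
theorem exists_edge_of_sheet_eq {f g : K.faces} (hfg : f ≠ g) {x : (f : Set X)} {y : (g : Set X)}
    (hxy : sheet h f x = sheet h g y) : ∃ e : K.edges, (x : X) ∈ (e : Set X) ∧ K.Incident e f := by
  obtain ⟨-, hr⟩ := sheet_eq_iff.mp hxy
  rcases hr.cases_head with rfl | ⟨_, ⟨e, he, hI, -⟩, -⟩
  · exact absurd rfl hfg
  · exact ⟨e, he, hI⟩

theorem lift_self_injective : Function.Injective fun f : K.faces => lift h f f := by
  intro f g hfg
  obtain ⟨x, hx, hxs⟩ := K.exists_mem_face_notMem_skeleton f.2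
  have hmem : sheet h f ⟨x, hx⟩ ∈ lift h g g := by
    have := sheet_mem_lift (h := h) (x := ⟨x, hx⟩) (s := f) |>.mpr hx
    exact (show lift h f f = lift h g g from hfg) ▸ this
  obtain ⟨y, -, hy⟩ := hmem
  by_contra hne
  obtain ⟨e, he, -⟩ := exists_edge_of_sheet_eq hne hy.symm
  exact hxs (K.subset_skeleton e.2 he)

variable (h) in
/-- The glued space as a 2-complex, whose faces are the copies of the faces of `K`, and whose edges
and vertices are the copies of the sides and corners of these faces. -/
def complex : TwoComplex (Glued h) where
  vertices := proj ⁻¹' K.vertices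
  edges := {s | ∃ (f : K.faces) (e : K.edges), K.Incident e f ∧ s = lift h f e}
  faces := Set.range fun f : K.faces => lift h f f
  finite_vertices := by
    have := K.finite_faces.to_subtype
    refine (Set.finite_iUnion fun f : K.faces => Set.Finite.image (sheet h f)
      (K.finite_vertices.preimage Subtype.val_injective.injOn)).subset ?_
    intro y hy
    obtain ⟨f, x, rfl⟩ := exists_sheet_eq y
    exact Set.mem_iUnion.mpr ⟨f, x, hy, rfl⟩
  finite_edges := by
    have := K.finite_faces.to_subtype
    have := K.finite_edges.to_subtype
    refine (Set.finite_range fun p : K.faces × K.edges => lift h p.1 p.2).subset ?_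
    rintro _ ⟨f, e, -, rfl⟩
    exact ⟨(f, e), rfl⟩
  finite_faces := by
    have := K.finite_faces.to_subtype
    exact Set.finite_range _
  edge_spec := by
    rintro _ ⟨f, e, hef, rfl⟩
    obtain ⟨γ, hγ⟩ := K.edge_spec e e.2
    refine ⟨γ.trans (homeomorphLift h hef).symm, ?_⟩
    ext y
    constructor
    · rintro ⟨⟨x, hx, rfl⟩, hV⟩
      have : (x : X) ∈ (e : Set X) ∩ K.vertices := ⟨hx, hV⟩
      rw [hγ] at this
      rcases this with hx | hx
      · exact Or.inl (congrArg (sheet h f) (Subtype.ext hx))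
      · exact Or.inr (congrArg (sheet h f) (Subtype.ext hx))
    · have h0 : (γ 0 : X) ∈ (e : Set X) ∩ K.vertices := hγ ▸ Or.inl rfl
      have h1 : (γ 1 : X) ∈ (e : Set X) ∩ K.vertices := hγ ▸ Or.inr rfl
      rintro (rfl | rfl)
      · exact ⟨Subtype.coe_prop _, h0.2⟩
      · exact ⟨Subtype.coe_prop _, h1.2⟩
  face_spec := by
    rintro _ ⟨f, rfl⟩
    obtain ⟨n, hn, c, hV, hE, hS⟩ := K.face_spec f f.2
    refine ⟨n, hn, c.trans (homeomorphLift h subset_rfl).symm, fun k x hx => hV k x hx,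
      fun k => ⟨f, ⟨_, hE k⟩, ?_, ?_⟩, ?_⟩
    · rintro _ ⟨x, -, rfl⟩
      exact Subtype.coe_prop _
    · ext y
      constructor
      · rintro ⟨x, hx, rfl⟩
        exact ⟨c x, ⟨x, hx, rfl⟩, rfl⟩
      · rintro ⟨z, ⟨x, hx, hz⟩, rfl⟩
        exact ⟨x, hx, congrArg (sheet h f) (Subtype.ext hz)⟩
    · ext y
      constructor
      · rintro ⟨⟨x, hx, rfl⟩, hs⟩
        have : (x : X) ∈ (f : Set X) ∩ (K.vertices ∪ ⋃₀ K.edges) := by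
          refine ⟨hx, hs.imp id ?_⟩
          rintro ⟨_, ⟨g, e, -, rfl⟩, hxe⟩
          exact ⟨e, e.2, proj_mem_of_mem_lift hxe⟩
        rw [hS] at this
        obtain ⟨z, hz, hzx⟩ := this
        exact ⟨z, hz, congrArg (sheet h f) (Subtype.ext hzx)⟩
      · rintro ⟨z, ⟨k, hk⟩, rfl⟩
        refine ⟨Subtype.coe_prop _, Or.inr ⟨_, ⟨f, ⟨_, hE k⟩, ?_, rfl⟩, ⟨c z, ⟨z, hk, rfl⟩, rfl⟩⟩⟩
        rintro _ ⟨x, -, rfl⟩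
        exact Subtype.coe_prop _
  edges_inter := by
    rintro _ ⟨f, e, hef, rfl⟩ _ ⟨g, e', hef', rfl⟩ hne y ⟨⟨x, hx, rfl⟩, ⟨z, hz, hzx⟩⟩
    by_contra hV
    obtain ⟨hxz, hr⟩ := sheet_eq_iff.mp hzx.symm
    have hee : e = e' := Subtype.ext
      (K.edge_eq_of_mem e.2 e'.2 hx (show (x : X) ∈ (e' : Set X) from hxz ▸ hz) hV)
    subst hee
    rcases eq_or_eq_of_reach h hx hV hef hr with rfl | rfl
    · exact hne rfl
    · exact hne (lift_eq_lift hef)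
  faces_inter := by
    rintro _ ⟨f, rfl⟩ _ ⟨g, rfl⟩ hne y ⟨⟨x, hx, rfl⟩, ⟨z, hz, hzx⟩⟩
    obtain ⟨e, hxe, hef⟩ := exists_edge_of_sheet_eq (fun hfg => hne (by rw [hfg])) hzx.symm
    exact ⟨_, ⟨f, e, hef, rfl⟩, ⟨x, hxe, rfl⟩⟩

theorem degree_complex {e : Set (Glued h)} (he : e ∈ (complex h).edges) :
    (complex h).degree e = 2 := by
  obtain ⟨f, e, hef, rfl⟩ := he
  rw [degree, Set.ncard_eq_two]
  refine ⟨lift h f f, lift h (σ e f) (σ e f : K.faces),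
    fun heq => h.ne e f hef (lift_self_injective heq).symm, ?_⟩
  ext F
  constructor
  · rintro ⟨⟨g, rfl⟩, hg⟩
    obtain ⟨x, hx, hxV⟩ := K.exists_mem_edge_notMem_vertices e.2
    obtain ⟨y, -, hy⟩ := hg (sheet_mem_lift (x := ⟨x, hef hx⟩).mpr hx)
    rcases eq_or_eq_of_reach h hx hxV hef (sheet_eq_iff.mp hy.symm).2 with rfl | rfl
    · exact Or.inl rfl
    · exact Or.inr rfl
  · rintro (rfl | rfl)
    · exact ⟨⟨f, rfl⟩, lift_mono f hef⟩
    · refine ⟨⟨_, rfl⟩, ?_⟩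
      rw [lift_eq_lift hef]
      exact lift_mono _ (h.incident e f hef)

theorem isSurface_complex (h : IsPairing K.Incident σ) : (complex h).IsSurface := by
  refine isSurface_of_degree_eq_two (fun e he => degree_complex he) ?_ ?_
  · intro y _
    obtain ⟨f, x, rfl⟩ := exists_sheet_eq y
    exact ⟨_, ⟨f, rfl⟩, sheet_mem_lift.mpr x.2⟩
  · rintro y - P hP _ ⟨f, rfl⟩ _ ⟨g, rfl⟩ ⟨x, hx, rfl⟩ ⟨z, hz, hzx⟩ hPf
    have hr := (sheet_eq_iff.mp hzx.symm).2
    clear hzx hz z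
    induction hr with
    | refl => exact hPf
    | @tail f' g' hr hl ih =>
      obtain ⟨e, hxe, hef, rfl⟩ := hl
      refine hP _ ⟨f', rfl⟩ _ ⟨_, rfl⟩ (lift h f' e) ⟨f', e, hef, rfl⟩ ?_ (lift_mono _ hef) ?_ ih
      · have hxf := mem_of_reach x.2 hr h
        have hs : sheet h f x = sheet h f' ⟨x, hxf⟩ := sheet_eq_iff.mpr ⟨rfl, hr⟩
        exact ⟨⟨x, hxf⟩, hxe, hs.symm⟩
      · rw [lift_eq_lift hef]
        exact lift_mono _ (h.incident e f' hef)

theorem space_complex (h : IsPairing K.Incident σ) : (complex h).space = Set.univ := by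
  refine Set.eq_univ_of_forall fun y => ?_
  obtain ⟨f, x, rfl⟩ := exists_sheet_eq y
  exact Or.inr ⟨_, ⟨f, rfl⟩, sheet_mem_lift.mpr x.2⟩

theorem isPreconnected_lift (f : K.faces) : IsPreconnected (lift h f f) := by
  obtain ⟨n, -, c, -⟩ := K.face_spec f f.2
  have : PreconnectedSpace (closedPolygon n) :=
    isPreconnected_iff_preconnectedSpace.mp (convex_closedPolygon n).isPreconnected
  have := isPreconnected_range (((continuous_sheet (h := h) f)).comp c.continuous)
  rw [c.surjective.range_comp, ← Set.image_univ] at this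
  have huniv : {x : (f : Set X) | (x : X) ∈ (f : Set X)} = Set.univ :=
    Set.eq_univ_of_forall fun x => x.2
  rwa [lift, huniv]

theorem isPreconnected_univ (h : IsPairing K.Incident σ)
    (hconn : ∀ f g, Relation.ReflTransGen (Linked K.Incident σ Set.univ) f g) :
    IsPreconnected (Set.univ : Set (Glued h)) := by
  by_cases hne : Nonempty (Glued h)
  swap
  · rw [not_nonempty_iff] at hne
    rw [Set.univ_eq_empty_iff.mpr hne]
    exact isPreconnected_empty
  obtain ⟨y⟩ := hne
  obtain ⟨f, x, rfl⟩ := exists_sheet_eq y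
  refine isPreconnected_of_forall (sheet h f x) fun y hy => ?_
  clear hy
  obtain ⟨g, z, rfl⟩ := exists_sheet_eq y
  suffices ∃ t : Set (Glued h), lift h f f ⊆ t ∧ lift h g g ⊆ t ∧ IsPreconnected t by
    obtain ⟨t, hf, hg, ht⟩ := this
    exact ⟨t, Set.subset_univ _, hf (sheet_mem_lift.mpr x.2), hg (sheet_mem_lift.mpr z.2), ht⟩
  clear z
  induction hconn f g with
  | refl => exact ⟨_, subset_rfl, subset_rfl, isPreconnected_lift f⟩
  | tail _ hl ih =>
    obtain ⟨t, hf, hg, ht⟩ := ih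
    obtain ⟨e, -, hef, rfl⟩ := hl
    obtain ⟨a, ha, -⟩ := K.exists_mem_edge_notMem_vertices e.2
    refine ⟨t ∪ lift h (σ e _) (σ e _ : K.faces), hf.trans Set.subset_union_left,
      Set.subset_union_right, ht.union (sheet h _ ⟨a, hef ha⟩) (hg (sheet_mem_lift.mpr (hef ha)))
      ?_ (isPreconnected_lift _)⟩
    rw [sheet_eq_of_mem_edge hef ha]
    exact sheet_mem_lift.mpr (h.incident e _ hef ha)

theorem isEulerCover_proj (h : IsPairing K.Incident σ) (hne : K.faces.Nonempty)
    (hconn : ∀ f g, Relation.ReflTransGen (Linked K.Incident σ Set.univ) f g) :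
    IsEulerCover (complex h) K proj := by
  refine ⟨isSurface_complex h, ⟨?_, ?_⟩, ⟨continuous_proj.continuousOn, fun _ hx => hx, ?_, ?_⟩, ?_⟩
  · obtain ⟨f, hf⟩ := hne
    obtain ⟨x, hx, -⟩ := K.exists_mem_face_notMem_skeleton hf
    exact ⟨sheet h ⟨f, hf⟩ ⟨x, hx⟩, space_complex h ▸ Set.mem_univ _⟩
  · rw [space_complex]
    exact isPreconnected_univ h hconn
  · rintro _ ⟨f, e, hef, rfl⟩
    exact ⟨e, e.2, restrictsToHomeomorph_lift hef⟩
  · rintro _ ⟨f, rfl⟩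
    exact ⟨f, f.2, restrictsToHomeomorph_lift subset_rfl⟩
  · intro f hf
    refine ⟨lift h ⟨f, hf⟩ f,
      ⟨⟨⟨f, hf⟩, rfl⟩, (restrictsToHomeomorph_lift subset_rfl).image_eq⟩, ?_⟩
    rintro _ ⟨⟨g, rfl⟩, hg⟩
    have : (g : Set X) = f := by
      rw [← hg]; exact (restrictsToHomeomorph_lift subset_rfl).image_eq.symm
    subst this
    rfl

end Glued

/-- A face has two sides at a vertex that is one of its corners, and none at any other vertex. -/
theorem even_ncard_incident (K : TwoComplex X) (v : X) (hv : v ∈ K.vertices) (f : K.faces) :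
    Even {e : K.edges | v ∈ (e : Set X) ∧ K.Incident e f}.ncard := by
  have himg : Subtype.val '' {e : K.edges | v ∈ (e : Set X) ∧ K.Incident e f} =
      {e | e ∈ K.edges ∧ v ∈ e ∧ e ⊆ f} := by
    ext e
    constructor
    · rintro ⟨e, ⟨h₁, h₂⟩, rfl⟩
      exact ⟨e.2, h₁, h₂⟩
    · rintro ⟨he, h₁, h₂⟩
      exact ⟨⟨e, he⟩, ⟨h₁, h₂⟩, rfl⟩
  rw [← Subtype.val_injective.injOn.ncard_image, himg]
  by_cases hvf : v ∈ (f : Set X)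
  · obtain ⟨e, e', hne, heq⟩ := K.exists_edges_at_corner f.2 hvf hv
    rw [heq, Set.ncard_pair hne]
    exact even_two
  · have : {e | e ∈ K.edges ∧ v ∈ e ∧ e ⊆ (f : Set X)} = ∅ :=
      Set.eq_empty_of_forall_notMem fun e he => hvf (he.2.2 he.2.1)
    rw [this, Set.ncard_empty]
    exact Even.zero

theorem ncard_incident (K : TwoComplex X) (e : K.edges) :
    {f : K.faces | K.Incident e f}.ncard = K.degree e := by
  rw [← Subtype.val_injective.injOn.ncard_image, degree]
  congr 1
  ext f
  constructor
  · rintro ⟨f, hf, rfl⟩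
    exact ⟨f.2, hf⟩
  · rintro ⟨hf, hef⟩
    exact ⟨⟨f, hf⟩, hef, rfl⟩

theorem IsEven.exists_face_of_edge (hE : K.IsEven) {e : Set X} (he : e ∈ K.edges) :
    ∃ f ∈ K.faces, e ⊆ f :=
  Set.nonempty_of_ncard_ne_zero (hE e he).1.ne'

/-- Match the faces at every edge so that all faces are connected, and glue them along the matched
pairs. -/
theorem StronglyConnected.hasEulerCover_of_isEven (hK : K.StronglyConnected) (hE : K.IsEven) :
    K.HasEulerCover := by
  have := K.finite_faces.to_subtype
  have := K.finite_edges.to_subtype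
  have hne : K.faces.Nonempty := by
    obtain ⟨x, hx, hxV⟩ := hK.2.nonempty
    rcases hx with (hx | ⟨e, he, -⟩) | ⟨f, hf, -⟩
    · exact absurd hx hxV
    · obtain ⟨f, hf, -⟩ := hE.exists_face_of_edge he
      exact ⟨f, hf⟩
    · exact ⟨f, hf⟩
  obtain ⟨σ, hσ, hconn⟩ := exists_connected_isPairing (I := K.Incident)
    (fun (v : K.vertices) (e : K.edges) => (v : X) ∈ (e : Set X))
    (fun e => by rw [ncard_incident]; exact (hE e e.2).2)
    (fun v f => even_ncard_incident K v v.2 f)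
    (fun e => by
      obtain ⟨γ, hγ⟩ := K.edge_spec e e.2
      have : (γ 0 : X) ∈ (e : Set X) ∩ K.vertices := hγ ▸ Or.inl rfl
      exact ⟨⟨_, this.2⟩, this.1⟩)
    (fun P hP f g hPf => by
      obtain ⟨_, hg⟩ := hK.face_induction (fun e he => hE.exists_face_of_edge he)
        (P := fun s => ∃ hs : s ∈ K.faces, P ⟨s, hs⟩)
        (fun f hf g hg e he hef heg hPf => ⟨hg, hP ⟨f, hf⟩ ⟨g, hg⟩ ⟨e, he⟩ hef heg hPf.2⟩)
        f.2 g.2 ⟨f.2, hPf⟩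
      exact hg)
  exact ⟨_, _, _, Glued.complex hσ, Glued.proj, Glued.isEulerCover_proj hσ hne hconn⟩

end TwoComplex

theorem theorem2 {X : Type u} [TopologicalSpace X] [T2Space X] (K : TwoComplex X) :
    (K.StronglyConnected →
      [K.IsEven, K.IsFaceDisjointUnionOfCirclets, K.HasEulerCover].TFAE) ∧
    (K.IsEven ↔ K.IsFaceDisjointUnionOfCirclets) ∧
    (K.HasEulerCover → (∀ e ∈ K.edges, ∃ f ∈ K.faces, e ⊆ f) → K.IsEven) := by
  refine ⟨fun hK => ?_, K.isEven_iff_isFaceDisjointUnionOfCirclets, ?_⟩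
  · tfae_have 1 ↔ 2 := K.isEven_iff_isFaceDisjointUnionOfCirclets
    tfae_have 1 → 3 := hK.hasEulerCover_of_isEven
    tfae_have 3 → 1 := hK.isEven_of_hasEulerCover
    tfae_finish
  · rintro ⟨Y, _, _, M, φ, h⟩ hE
    exact TwoComplex.isEven_of_isEulerCover h hE
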